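/- Let $q\in\mathbb C\setminus\{0\}$ be equal to $1$ or not a root of unity. Put $[x]=\frac{q^x-q^{-x}}{q-q^{-1}}$ ($[x]=x$ if $q=1$), $[n]!=[1][2]\cdots[n]$ for integers $n\ge0$ with the convention $1/[n]!=0$ for $n<0$, $(\alpha|q)_n=\prod_{k=0}^{n-1}[\alpha+k]$, and ${n\brack r}_q=\frac{q^{r(n-r)}[n]!}{[r]!\,[n-r]!}$. Quotients of $q$-Pochhammer symbols with a negative subscript $-n$ are read as $\frac{(\alpha|q)_{-n}}{(\beta|q)_{-n}}=\frac{(\beta-n|q)_n}{(\alpha-n|q)_n}$. For $\varepsilon=\pm1$ let $${}^{\varepsilon}F^{A:B}_{C:D}\left[{(a)\atop(c)}:{(b)\atop(d)};{(b')\atop(d')};x,y\right]=\sum_{s,t\ge0}\frac{\prod_{j=1}^A(a_j|q)_{s+t}}{\prod_{j=1}^C(c_j|q)_{s+t}}\,\frac{\prod_{j=1}^B(b_j|q)_s(b'_j|q)_t}{\prod_{j=1}^D(d_j|q)_s(d'_j|q)_t}\,\frac{x^{\varepsilon s}y^{\varepsilon(1-2\delta_{AC})t}}{[s]!\,[t]!}\,q^{\varepsilon(A-C)st}$$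 (terms with vanishing numerator are $0$; all series below are finite). **I. Double $q$-factorial sums.** Let $a,b,c,d,m,n,e-a,f-b$ be nonnegative integers; all sums run over integers $s,z\ge0$ and are restricted by the $q$-factorials in the denominators. Let $$S_A=\sum_{s,z}\frac{(-1)^{s+z}q^{s(b+c+e-m-n+1)-z(a+d+f-m-n+1)}[c+s]![e-s]![d+z]![f-z]!}{[s]![a-s]![z]![b-z]![n-s-z]![m-a-b+s+z]!},$$ $$S_B=\frac{[e-a]![a+c-m]![d]![d+f+1]!}{[a]![m+n-a-b]!}\sum_{s,z}\frac{(-1)^{n+s}q^{n(b+c+1)-s(m+1)-z(a+b+c+d-m+1)}[c+s]![e-s]![f-z]!}{[s]![e-a-s]![z]![b-z]![d+f+1-z]![n-s-z]![a+c-m-n+s+z]!},$$ $$S_C=q^{a(c+e-n+1)+bn}\frac{[d]![d+f+1]![e-a]![c+e+1]!}{[m+n-a-b]!}\sum_{s,z}\frac{(-1)^{a+s+z}q^{-s(e-n+z)-z(b+d-m)}[a+c-s]![f-z]![m+n-s-z]!}{[s]![a-s]![m-s]![c+e+1-s]![z]![b-z]![n-z]![d+f+1-z]!},$$ $$S_D=q^{n(c+1)-b(b+d-m)-(b+e-a)(c+e-n+1)}\frac{[d]![d+f+1]![e-a]![c+e+1]!}{[m+n-a-b]!}\sum_{s,z}\frac{(-1)^{a+e+n+s}q^{s(b+e-n-z)+z(b+c+d+e-m+1)}[c+e-a-s]![c+e-m-s]![f-b+z]!}{[s]![e-a-s]![c+e+1-s]![b+c+e-m-n-s-z]![z]![b-z]![n-b+z]![d+f-b+1+z]!},$$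 $$S_E=q^{a(c+1)-n(a+d-m)}\frac{[e-a]![c+e+1]![f-b]!}{[b]![m+n-a-b]!}\sum_{s,z}\frac{(-1)^{s+z}q^{s(e-z)-z(m-a+1)}[c+s]![a+b+d-m-s]![f-n+z]![d+n-z]!}{[s]![a-s]![c+e-a+1+s]![a+b+d-m-s-z]![z]![n-z]![f-b-n+z]!},$$ $$S_F=q^{a(c+e-m-n+1)-b(d+f-n+1)}\frac{[f-b]![d+f+1]!}{[m+n-a-b]!}\sum_{s,z}\frac{(-1)^{a+b+s+z}q^{z(a+f-n-s)-s(c+e-m-n+1)}[e-a+s]![a+c-s]![b+d-z]![m+n-a-z]!}{[s]![a-s]![n-a+s]![z]![b-z]![d+f+1-z]![m-s-z]!},$$ $$S_G=q^{a(a+c+d+1)-n(a+d+1)+(a+b-f)(b-m)}\frac{[c]![d]![f-b]![d+f+1]![c+e+1]!}{[b]![m+n-a-b]!}\sum_{s,z}\frac{(-1)^{b-f+n+z}q^{-s(a+b+c+d-m+z+1)-z(m+n-a-b)}[e-a+s]![b+z]![b+d-m+z]!}{[s]![a-s]![a+d+f-m-n-s]![c+e-a+s+1]![z]![f-b-z]![b-a-f+n+s+z]![b+d+z+1]!}.$$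 Then $S_A=S_C=S_F$; if $m\le a+c$ and $n\le e$, also $S_A=S_B=S_D$; if $m\le b+d$ and $n\le f$, also $S_A=S_E=S_G$. In particular, one has the summation formulas $$S_A=\frac{[c]![d]![e]![f]!}{[a]![b]![m-a-b]!}\ (n=0),\qquad S_A=\frac{(-1)^{a+b}q^{a(b+c+e-n+1)-b(a+d+f-n+1)}[a+c]![e-a]![b+d]![f-b]!}{[a]![b]![n-a-b]!}\ (m=0);$$ if $m\le a+c$, $n\le e$ and $b+c+e=m+n$, then $S_A$ equals the term $s=z=0$ of $S_D$ (prefactor included); if $m\le b+d$, $n\le f$ and $a+d+f=m+n$, then $S_A$ equals the term $s=0$, $z=b+n-f$ of $S_E$ (prefactor included). **II. $q$-Kampé de Fériet functions.** Put $$\Phi_A={}^{+}F^{0:3}_{1:1}\left[{-\atop b_1+b_1'}:{b_1,b_2,-m\atop d};{b_1',b_2',-n\atop d'};q^{b_2-b_1'-d-m+1},q^{b_2'-b_1-d'-n+1}\right],$$ $$\Phi_B={}^{-}F^{1:2}_{0:2}\left[{1-b_1-b_1'-m-n\atop-}:{-m-d+1,-m\atop1-b_1-m,1-b_2-m};{-d'-n+1,-n\atop1-b_1'-n,1-b_2'-n};q^{b_2-b_1'-d-m-n+1},q^{b_2'-b_1-d'-m-n+1}\right]$$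 $$\times(-1)^{m+n}q^{m(b_2-b_1'-d-m+1)+n(b_2'-b_1-d'-m-n+1)}\frac{(b_1|q)_m(b_2|q)_m(b_1'|q)_n(b_2'|q)_n}{(d|q)_m(d'|q)_n(b_1+b_1'|q)_{m+n}},$$ $$\Phi_C={}^{-}F^{1:2}_{0:2}\left[{b_2-b_1-b_1'-n+1\atop-}:{b_2-d+1,b_2\atop b_2+m+1,b_2-b_1+1};{1-d'-n,-n\atop1-b_1'-n,1-b_2'-n};q^{b_2-b_1'-d-m-n+1},q^{b_2-b_1+b_2'-d'-n+1}\right]$$ $$\times(-1)^{b_1'+b_2+d+m-1}q^{n(b_2'-d')+b_2(d+m-b_2-1)+b_1'(2b_1+b_1'+2n-1)}\frac{(b_2'|q)_n(d-b_2|q)_{-d-m}}{(d'|q)_n(m+1|q)_{-d-m}}{b_1-b_2-1\brack-b_1'-n}_q{-b_1-b_1'\brack-b_1}_q^{-1},$$ $$\Phi_D={}^{+}F^{0:3}_{1:1}\left[{-\atop d'-b_2'+b_1+b_1'+n}:{b_1-b_2'+d'+n,b_2,-m\atop d};{d'-b_2',b_1',d'+n\atop d'};q^{b_2-b_1'-d-m+1},q^{-b_1+1}\right](-1)^{b_1'}q^{-b_1'(b_2'-d'-n)}\frac{(d'-b_2'+b_1+b_1'+n|q)_{-b_1'}}{(-b_1+1|q)_{-b_1'}},$$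 $$\Phi_E={}^{+}F^{0:3}_{1:1}\left[{-\atop1-b_1-m-n}:{b_1',1-d-m,-m\atop b_2-d-m+1};{d'-b_2',1-b_1-b_1'-m-n,-n\atop1-b_2'-n};q^{b_1+b_1'-b_2+n},q^{d'-b_1'}\right]$$ $$\times q^{m(b_2-b_1')+n(b_1'+b_2'-d')}\frac{(1-b_1-m-n|q)_{-b_1'}(d-b_2|q)_m(b_2'|q)_n}{(-b_1+1|q)_{-b_1'}(d|q)_m(d'|q)_n},$$ $$\Phi_F={}^{-}F^{1:2}_{0:2}\left[{b_1\atop-}:{d-b_2,-m\atop1-b_1'-m,d};{b_2',-n\atop b_2'-d'-n+1,b_1+b_1'+m};q^{b_1+b_1'-b_2},q^{d'-b_1'-m}\right]q^{mb_1+nb_2'}\frac{(b_1'|q)_m(d'-b_2'|q)_n}{(b_1+b_1'|q)_m(d'|q)_n},$$ $$\Phi_G={}^{+}F^{1:2}_{1:1}\left[{b_1'\atop1-b_1-m-n}:{1-d-m,-m\atop b_2-d-m+1};{d'-b_2',-n\atop d'};q^{b_1+b_1'-b_2+n},q^{b_1+b_1'-b_2'+m}\right]q^{m(b_2-b_1')+b_1'n}\frac{(d-b_2|q)_m(-b_1-m-n+1|q)_{-b_1'}}{(d|q)_m(-b_1+1|q)_{-b_1'}},$$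 $$\Phi_H={}^{-}F^{1:2}_{1:1}\left[{b_1'\atop b_1+b_1'-d+1}:{b_2-d+1,1-d-m\atop b_2-d-m+1};{b_2',-n\atop d'};q^{-b_1+1},q^{d-d'-b_1+b_2'-n}\right]q^{b_1'(d-1)+mb_2}\frac{(d-b_2|q)_m(d-b_1|q)_{-b_1'}}{(d|q)_m(-b_1+1|q)_{-b_1'}},$$ $$\Phi_I={}^{+}F^{1:2}_{1:1}\left[{b_2-b_1-b_1'-n+1\atop b_2-b_1'-d-n+2}:{b_2-d+1,m+1\atop b_2+m+1};{1-d'-n,-n\atop1-b_2'-n};q^{-b_1+1},q^{d-d'-b_1+b_2'-n}\right](-1)^{b_1'+b_2+d+m-1}$$ $$\times q^{b_2(2b_1'-b_2+d+m-1)-b_1'(b_1'-1)+n(b_2'-d')+2(b_2-b_1-b_1'-n+1)(b_2-b_1'-d+1)}\frac{(b_2'|q)_n(d-b_2|q)_{-d-m}}{(d'|q)_n(m+1|q)_{-d-m}}{b_1-d\brack b_1+b_1'-b_2+n-1}_q{-b_1-b_1'\brack-b_1}_q^{-1},$$ $$\Phi_J={}^{-}F^{0:3}_{1:1}\left[{-\atop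 b_1+b_1'}:{b_1,b_2',-n\atop b_2'-d'-n+1};{b_1',b_2,-m\atop b_2-d-m+1};q^{d'-b_1'},q^{d-b_1}\right]q^{mb_2+nb_2'}\frac{(d-b_2|q)_m(b_2'-d'-n+1|q)_n}{(d|q)_m(-n-d'+1|q)_n},$$ $$\Phi_K={}^{+}F^{1:2}_{0:2}\left[{b_2-b_1-b_1'-n+1\atop-}:{d'-b_2',-n\atop d-b_1-n,1-b_2'-n};{b_2-d+1,m+1\atop b_2+m+1,b_2-b_1'-d+2};q^{d'-d+b_2-b_1'+1},q^{-n-b_1+1}\right](-1)^{b_1'+b_2+d+m+1}$$ $$\times q^{2(b_2-b_1-b_1'-n+1)(b_2-b_1'-d+1)-b_2(b_2-d-m+1)+n(b_2'-d')+b_1'(2b_2-b_1'+1)}\frac{(b_2'|q)_n(d-b_2|q)_{-d-m}}{(d'|q)_n(m+1|q)_{-d-m}}{b_1+n-d\brack b_2-b_1'-d+1}_q{-b_1-b_1'\brack-b_1}_q^{-1}.$$ (1) Let $m,n$ be nonnegative integers and $b_1,b_1',b_2,b_2',d,d'$ complex with $(b_1+b_1'|q)_{m+n},(d|q)_m,(d'|q)_n\ne0$.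 Then: $\Phi_A=\Phi_B$ if $(b_1|q)_m,(b_2|q)_m,(b_1'|q)_n,(b_2'|q)_n\neq0$; $\Phi_A=\Phi_F$ if $(b_1'|q)_m,(d'-b_2'|q)_n\ne0$; $\Phi_A=\Phi_J$ if $(d-b_2|q)_m,(d'-b_2'|q)_n\ne0$. Moreover $\Phi_A$ is invariant under the interchange of $(b_1,b_2,m,d)$ with $(b_1',b_2',n,d')$; and $\Phi_A=q^{nb_2'}(d'-b_2'|q)_n/(d'|q)_n$ if $b_1=0$, $\Phi_A=q^{mb_2}(d-b_2|q)_m/(d|q)_m$ if $b_1'=0$. (2) Assume in addition that $b_1'$ is an integer, $(b_1|q)_{m+n}\ne0$, $(d-b_2|q)_m\ne0$, and that $(1-b_1|q)_{-b_1'}\neq0$ if $b_1'\le0$, respectively $(1-b_1-m-n-b_1'|q)_{b_1'}\ne0$ if $b_1'\geq0$. Then $\Phi_A=\Phi_G$, and $\Phi_A=\Phi_E$ if $(b_2'|q)_n\neq0$. (3) Under the assumptions of (1), let $b_1'=-k$ with an integer $k\ge0$ and $(1-b_1|q)_k\ne0$. Then $\Phi_A=\Phi_D$ if $(d'|q)_k,(d'-b_2'+b_1-k+n|q)_{m+k}\ne0$,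 and $\Phi_A=\Phi_H$ if $(d-b_1|q)_k,(b_2-d-m+1|q)_k\neq0$. (4) Let $m\geq 0$ be an integer, $b_1'=-k$ with an integer $k\ge0$, and $n,b_1,b_2,b_2',d,d'$ complex with $(b_1-k|q)_{m+k},(d|q)_m,(d'|q)_k,(1-b_1|q)_k\ne0$. Then $\Phi_A=\Phi_D$ if $(d'-b_2'+b_1-k+n|q)_{m+k}\ne0$; $\Phi_A=\Phi_G$ if $(d-b_2|q)_m,(1-b_1-m-n|q)_k\neq0$; $\Phi_A=\Phi_H$ if $(d-b_1|q)_k,(b_2-d-m+1|q)_k\ne0$. (5) Let $m,n\ge0$ and $b_1,b_1',b_2,d$ be integers with $b_1\le0$, $b_1'\le0$, $b_2+1\le d$, $d\le-m$, $d\le b_1$, $m+n\le-b_1-b_1'$, $m+d-b_2-1+b_1'\ge0$, $b_1+b_1'-b_2-1+n\ge0$, and let $b_2',d'$ be complex with $(b_2'|q)_n,(d'|q)_n\ne0$. Then $\Phi_A=\Phi_C$ if $n\le-b_1'$; $\Phi_A=\Phi_I$ if $b_2-b_1'-d-n+1\ge0$; $\Phi_A=\Phi_K$ if $b_2-b_1'-d+1\ge0$.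 If moreover $b_2-b_1-b_1'-n+1=0$, then $$\Phi_A=(-1)^{b_1'+b_2+d+m-1}q^{n(b_2'-d')+b_2(d+m-b_2-1)+b_1'(2b_1+b_1'+2n-1)}\frac{(b_2'|q)_n(d-b_2|q)_{-d-m}}{(d'|q)_n(m+1|q)_{-d-m}}{-b_1-b_1'\brack-b_1}_q^{-1},$$ and the same value is taken by $\Phi_A$ with $(b_1,b_2,m,d)$ and $(b_1',b_2',n,d')$ interchanged. -/

import Mathlib

noncomputable section

/-- The symmetric q-number `[x] = (q^x - q^(-x)) / (q - q^(-1))`, equal to `x` when `q = 1`. -/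
def qNum (q x : ℂ) : ℂ :=
  if q = 1 then x else (q ^ x - q ^ (-x)) / (q - q⁻¹)

/-- The q-factorial `[n]! = [1][2]...[n]` of an integer `n ≥ 0`. At negative `n` it has the
value `0`, so that division by it gives the usual convention `1 / [n]! = 0` for `n < 0`. -/
def qFact (q : ℂ) (n : ℤ) : ℂ :=
  if n < 0 then 0 else ∏ k ∈ Finset.Icc 1 n, qNum q (k : ℂ)

/-- The symmetric q-Pochhammer symbol `(α|q)_n = [α][α+1]...[α+n-1]`. -/
def qPoch (q α : ℂ) (n : ℕ) : ℂ :=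
  ∏ k ∈ Finset.range n, qNum q (α + (k : ℂ))

/-- The quotient `(α|q)_k / (β|q)_k` with integer subscript; for a negative subscript `k = -n`
it is `(β-n|q)_n / (α-n|q)_n`. -/
def qPochRatio (q α β : ℂ) (k : ℤ) : ℂ :=
  if 0 ≤ k then qPoch q α k.toNat / qPoch q β k.toNat
  else qPoch q (β + (k : ℂ)) (-k).toNat / qPoch q (α + (k : ℂ)) (-k).toNat

/-- The q-binomial (Gaussian) coefficient `q^(r(n-r)) [n]! / ([r]! [n-r]!)`. -/
def qBinom (q : ℂ) (n r : ℤ) : ℂ :=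
  qFact q n * q ^ (r * (n - r)) / (qFact q r * qFact q (n - r))

/-- The product `∏_j (α_j|q)_n` over a list of parameters. -/
def qPochs (q : ℂ) (l : List ℂ) (n : ℕ) : ℂ :=
  (l.map fun α => qPoch q α n).prod

/-- The q-Kampé de Fériet function `^{ε}F^{A:B}_{C:D}[(a);(c):(b);(d):(b');(d'); x, y; q]` with
`ε = ±1`; the numbers of parameters are the lengths of the lists. -/
def qKdF (ε : ℤ) (a c b d b' d' : List ℂ) (x y q : ℂ) : ℂ :=
  ∑' p : ℕ × ℕ,
    qPochs q a (p.1 + p.2) / qPochs q c (p.1 + p.2)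
      * ((qPochs q b p.1 * qPochs q b' p.2) / (qPochs q d p.1 * qPochs q d' p.2))
      * (x ^ (ε * (p.1 : ℤ))
          * y ^ (ε * (1 - 2 * (if a.length = c.length then 1 else 0)) * (p.2 : ℤ))
          / (qFact q (p.1 : ℤ) * qFact q (p.2 : ℤ)))
      * q ^ (ε * ((a.length : ℤ) - (c.length : ℤ)) * (p.1 : ℤ) * (p.2 : ℤ))

/-! Seven double q-factorial sums. In each of them the summation ranges over all integers for
which the arguments of the q-factorials in the denominator are nonnegative; the ranges written
below contain all these integers. -/

def dsumA (q : ℂ) (a b c d e f m n : ℤ) : ℂ :=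
  ∑ s ∈ Finset.Icc 0 a, ∑ z ∈ Finset.Icc 0 b,
    (-1) ^ (s + z)
      * q ^ (s * (b + c + e - m - n + 1) - z * (a + d + f - m - n + 1))
      * (qFact q (c + s) * qFact q (e - s) * qFact q (d + z) * qFact q (f - z))
      / (qFact q s * qFact q (a - s) * qFact q z * qFact q (b - z)
          * qFact q (n - s - z) * qFact q (m - a - b + s + z))

def dsumB (q : ℂ) (a b c d e f m n : ℤ) : ℂ :=
  qFact q (e - a) * qFact q (a + c - m) * qFact q d * qFact q (d + f + 1)
      / (qFact q a * qFact q (m + n - a - b))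
    * ∑ s ∈ Finset.Icc 0 (e - a), ∑ z ∈ Finset.Icc 0 b,
      (-1) ^ (n + s)
        * q ^ (n * (b + c + 1) - s * (m + 1) - z * (a + b + c + d - m + 1))
        * (qFact q (c + s) * qFact q (e - s) * qFact q (f - z))
        / (qFact q s * qFact q (e - a - s) * qFact q z * qFact q (b - z)
            * qFact q (d + f + 1 - z) * qFact q (n - s - z)
            * qFact q (a + c - m - n + s + z))

def dsumC (q : ℂ) (a b c d e f m n : ℤ) : ℂ :=
  q ^ (a * (c + e - n + 1) + b * n)
      * (qFact q d * qFact q (d + f + 1) * qFact q (e - a) * qFact q (c + e + 1))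
      / qFact q (m + n - a - b)
    * ∑ s ∈ Finset.Icc 0 a, ∑ z ∈ Finset.Icc 0 b,
      (-1) ^ (a + s + z)
        * q ^ (-s * (e - n + z) - z * (b + d - m))
        * (qFact q (a + c - s) * qFact q (f - z) * qFact q (m + n - s - z))
        / (qFact q s * qFact q (a - s) * qFact q (m - s) * qFact q (c + e + 1 - s)
            * qFact q z * qFact q (b - z) * qFact q (n - z) * qFact q (d + f + 1 - z))

def dsumD (q : ℂ) (a b c d e f m n : ℤ) : ℂ :=
  q ^ (n * (c + 1) - b * (b + d - m) - (b + e - a) * (c + e - n + 1))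
      * (qFact q d * qFact q (d + f + 1) * qFact q (e - a) * qFact q (c + e + 1))
      / qFact q (m + n - a - b)
    * ∑ s ∈ Finset.Icc 0 (e - a), ∑ z ∈ Finset.Icc 0 b,
      (-1) ^ (a + e + n + s)
        * q ^ (s * (b + e - n - z) + z * (b + c + d + e - m + 1))
        * (qFact q (c + e - a - s) * qFact q (c + e - m - s) * qFact q (f - b + z))
        / (qFact q s * qFact q (e - a - s) * qFact q (c + e + 1 - s)
            * qFact q (b + c + e - m - n - s - z) * qFact q z * qFact q (b - z)
            * qFact q (n - b + z) * qFact q (d + f - b + 1 + z))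

def dsumE (q : ℂ) (a b c d e f m n : ℤ) : ℂ :=
  q ^ (a * (c + 1) - n * (a + d - m))
      * (qFact q (e - a) * qFact q (c + e + 1) * qFact q (f - b))
      / (qFact q b * qFact q (m + n - a - b))
    * ∑ s ∈ Finset.Icc 0 a, ∑ z ∈ Finset.Icc 0 n,
      (-1) ^ (s + z)
        * q ^ (s * (e - z) - z * (m - a + 1))
        * (qFact q (c + s) * qFact q (a + b + d - m - s) * qFact q (f - n + z)
            * qFact q (d + n - z))
        / (qFact q s * qFact q (a - s) * qFact q (c + e - a + 1 + s)
            * qFact q (a + b + d - m - s - z) * qFact q z * qFact q (n - z)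
            * qFact q (f - b - n + z))

def dsumF (q : ℂ) (a b c d e f m n : ℤ) : ℂ :=
  q ^ (a * (c + e - m - n + 1) - b * (d + f - n + 1))
      * (qFact q (f - b) * qFact q (d + f + 1))
      / qFact q (m + n - a - b)
    * ∑ s ∈ Finset.Icc 0 a, ∑ z ∈ Finset.Icc 0 b,
      (-1) ^ (a + b + s + z)
        * q ^ (z * (a + f - n - s) - s * (c + e - m - n + 1))
        * (qFact q (e - a + s) * qFact q (a + c - s) * qFact q (b + d - z)
            * qFact q (m + n - a - z))
        / (qFact q s * qFact q (a - s) * qFact q (n - a + s) * qFact q z * qFact q (b - z)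
            * qFact q (d + f + 1 - z) * qFact q (m - s - z))

def dsumG (q : ℂ) (a b c d e f m n : ℤ) : ℂ :=
  q ^ (a * (a + c + d + 1) - n * (a + d + 1) + (a + b - f) * (b - m))
      * (qFact q c * qFact q d * qFact q (f - b) * qFact q (d + f + 1)
          * qFact q (c + e + 1))
      / (qFact q b * qFact q (m + n - a - b))
    * ∑ s ∈ Finset.Icc 0 a, ∑ z ∈ Finset.Icc 0 (f - b),
      (-1) ^ (b - f + n + z)
        * q ^ (-s * (a + b + c + d - m + z + 1) - z * (m + n - a - b))
        * (qFact q (e - a + s) * qFact q (b + z) * qFact q (b + d - m + z))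
        / (qFact q s * qFact q (a - s) * qFact q (a + d + f - m - n - s)
            * qFact q (c + e - a + s + 1) * qFact q z * qFact q (f - b - z)
            * qFact q (b - a - f + n + s + z) * qFact q (b + d + z + 1))

/-! Eleven q-Kampé de Fériet functions, multiplied by their prefactors. -/

/-- `^{+}F^{0:3}_{1:1}`, without prefactor. -/
def kdfA (q b1 b1' b2 b2' d d' m n : ℂ) : ℂ :=
  qKdF 1 [] [b1 + b1'] [b1, b2, -m] [d] [b1', b2', -n] [d']
    (q ^ (b2 - b1' - d - m + 1)) (q ^ (b2' - b1 - d' - n + 1)) q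

/-- `^{-}F^{1:2}_{0:2}` with prefactor. -/
def kdfB (q b1 b1' b2 b2' d d' : ℂ) (m n : ℕ) : ℂ :=
  qKdF (-1) [1 - b1 - b1' - m - n] [] [-m - d + 1, -m] [1 - b1 - m, 1 - b2 - m]
      [-d' - n + 1, -n] [1 - b1' - n, 1 - b2' - n]
      (q ^ (b2 - b1' - d - m - n + 1)) (q ^ (b2' - b1 - d' - m - n + 1)) q
    * ((-1) ^ (m + n)
      * q ^ (m * (b2 - b1' - d - m + 1) + n * (b2' - b1 - d' - m - n + 1)))
    * ((qPoch q b1 m * qPoch q b2 m * qPoch q b1' n * qPoch q b2' n)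
      / (qPoch q d m * qPoch q d' n * qPoch q (b1 + b1') (m + n)))

/-- `^{-}F^{1:2}_{0:2}` with prefactor. -/
def kdfC (q : ℂ) (b1 b1' b2 : ℤ) (b2' : ℂ) (d : ℤ) (d' : ℂ) (m n : ℕ) : ℂ :=
  qKdF (-1) [b2 - b1 - b1' - n + 1] [] [b2 - d + 1, b2] [b2 + m + 1, b2 - b1 + 1]
      [1 - d' - n, -n] [1 - b1' - n, 1 - b2' - n]
      (q ^ ((b2 : ℂ) - b1' - d - m - n + 1)) (q ^ (b2 - b1 + b2' - d' - n + 1)) q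
    * ((-1) ^ (b1' + b2 + d + m - 1)
      * q ^ (n * (b2' - d') + b2 * (d + m - b2 - 1) + b1' * (2 * b1 + b1' + 2 * n - 1)))
    * (qPoch q b2' n / qPoch q d' n * qPochRatio q (d - b2) (m + 1) (-d - m))
    * (qBinom q (b1 - b2 - 1) (-b1' - n) / qBinom q (-b1 - b1') (-b1))

/-- `^{+}F^{0:3}_{1:1}` with prefactor. -/
def kdfD (q b1 : ℂ) (b1' : ℤ) (b2 b2' d d' : ℂ) (m : ℕ) (n : ℂ) : ℂ :=
  qKdF 1 [] [d' - b2' + b1 + b1' + n] [b1 - b2' + d' + n, b2, -m] [d]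
      [d' - b2', b1', d' + n] [d']
      (q ^ (b2 - b1' - d - m + 1)) (q ^ (-b1 + 1)) q
    * ((-1) ^ b1' * q ^ (-b1' * (b2' - d' - n)))
    * qPochRatio q (d' - b2' + b1 + b1' + n) (-b1 + 1) (-b1')

/-- `^{+}F^{0:3}_{1:1}` with prefactor. -/
def kdfE (q b1 : ℂ) (b1' : ℤ) (b2 b2' d d' : ℂ) (m n : ℕ) : ℂ :=
  qKdF 1 [] [1 - b1 - m - n] [b1', 1 - d - m, -m] [b2 - d - m + 1]
      [d' - b2', 1 - b1 - b1' - m - n, -n] [1 - b2' - n]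
      (q ^ (b1 + b1' - b2 + n)) (q ^ (d' - b1')) q
    * q ^ (m * (b2 - b1') + n * (b1' + b2' - d'))
    * qPochRatio q (1 - b1 - m - n) (-b1 + 1) (-b1')
    * ((qPoch q (d - b2) m * qPoch q b2' n) / (qPoch q d m * qPoch q d' n))

/-- `^{-}F^{1:2}_{0:2}` with prefactor. -/
def kdfF (q b1 b1' b2 b2' d d' : ℂ) (m n : ℕ) : ℂ :=
  qKdF (-1) [b1] [] [d - b2, -m] [1 - b1' - m, d]
      [b2', -n] [b2' - d' - n + 1, b1 + b1' + m]
      (q ^ (b1 + b1' - b2)) (q ^ (d' - b1' - m)) q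
    * q ^ (m * b1 + n * b2')
    * ((qPoch q b1' m * qPoch q (d' - b2') n)
      / (qPoch q (b1 + b1') m * qPoch q d' n))

/-- `^{+}F^{1:2}_{1:1}` with prefactor. -/
def kdfG (q b1 : ℂ) (b1' : ℤ) (b2 b2' d d' : ℂ) (m : ℕ) (n : ℂ) : ℂ :=
  qKdF 1 [(b1' : ℂ)] [1 - b1 - m - n] [1 - d - m, -m] [b2 - d - m + 1]
      [d' - b2', -n] [d']
      (q ^ (b1 + b1' - b2 + n)) (q ^ (b1 + b1' - b2' + m)) q
    * q ^ (m * (b2 - b1') + b1' * n)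
    * (qPoch q (d - b2) m / qPoch q d m)
    * qPochRatio q (-b1 - m - n + 1) (-b1 + 1) (-b1')

/-- `^{-}F^{1:2}_{1:1}` with prefactor. -/
def kdfH (q b1 : ℂ) (b1' : ℤ) (b2 b2' d d' : ℂ) (m : ℕ) (n : ℂ) : ℂ :=
  qKdF (-1) [(b1' : ℂ)] [b1 + b1' - d + 1] [b2 - d + 1, 1 - d - m] [b2 - d - m + 1]
      [b2', -n] [d']
      (q ^ (-b1 + 1)) (q ^ (d - d' - b1 + b2' - n)) q
    * q ^ (b1' * (d - 1) + m * b2)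
    * (qPoch q (d - b2) m / qPoch q d m)
    * qPochRatio q (d - b1) (-b1 + 1) (-b1')

/-- `^{+}F^{1:2}_{1:1}` with prefactor. -/
def kdfI (q : ℂ) (b1 b1' b2 : ℤ) (b2' : ℂ) (d : ℤ) (d' : ℂ) (m n : ℕ) : ℂ :=
  qKdF 1 [b2 - b1 - b1' - n + 1] [b2 - b1' - d - n + 2] [b2 - d + 1, m + 1] [b2 + m + 1]
      [1 - d' - n, -n] [1 - b2' - n]
      (q ^ (-(b1 : ℂ) + 1)) (q ^ (d - d' - b1 + b2' - n)) q
    * ((-1) ^ (b1' + b2 + d + m - 1)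
      * q ^ (b2 * (2 * b1' - b2 + d + m - 1) - b1' * (b1' - 1) + n * (b2' - d')
          + 2 * (b2 - b1 - b1' - n + 1) * (b2 - b1' - d + 1)))
    * (qPoch q b2' n / qPoch q d' n * qPochRatio q (d - b2) (m + 1) (-d - m))
    * (qBinom q (b1 - d) (b1 + b1' - b2 + n - 1) / qBinom q (-b1 - b1') (-b1))

/-- `^{-}F^{0:3}_{1:1}` with prefactor. -/
def kdfJ (q b1 b1' b2 b2' d d' : ℂ) (m n : ℕ) : ℂ :=
  qKdF (-1) [] [b1 + b1'] [b1, b2', -n] [b2' - d' - n + 1] [b1', b2, -m] [b2 - d - m + 1]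
      (q ^ (d' - b1')) (q ^ (d - b1)) q
    * q ^ (m * b2 + n * b2')
    * ((qPoch q (d - b2) m * qPoch q (b2' - d' - n + 1) n)
      / (qPoch q d m * qPoch q (-n - d' + 1) n))

/-- `^{+}F^{1:2}_{0:2}` with prefactor. -/
def kdfK (q : ℂ) (b1 b1' b2 : ℤ) (b2' : ℂ) (d : ℤ) (d' : ℂ) (m n : ℕ) : ℂ :=
  qKdF 1 [b2 - b1 - b1' - n + 1] [] [d' - b2', -n] [d - b1 - n, 1 - b2' - n]
      [b2 - d + 1, m + 1] [b2 + m + 1, b2 - b1' - d + 2]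
      (q ^ (d' - d + b2 - b1' + 1)) (q ^ (-(n : ℂ) - b1 + 1)) q
    * ((-1) ^ (b1' + b2 + d + m + 1)
      * q ^ (2 * (b2 - b1 - b1' - n + 1) * (b2 - b1' - d + 1) - b2 * (b2 - d - m + 1)
          + n * (b2' - d') + b1' * (2 * b2 - b1' + 1)))
    * (qPoch q b2' n / qPoch q d' n * qPochRatio q (d - b2) (m + 1) (-d - m))
    * (qBinom q (b1 + n - d) (b2 - b1' - d + 1) / qBinom q (-b1 - b1') (-b1))

/-- The triangular conditions on the integers `b1, b1', b2, d, m, n`. -/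
def Triangular (b1 b1' b2 d : ℤ) (m n : ℕ) : Prop :=
  b1 ≤ 0 ∧ b1' ≤ 0 ∧ b2 + 1 ≤ d ∧ d ≤ -m ∧ d ≤ b1 ∧ m + n ≤ -b1 - b1' ∧
    0 ≤ m + d - b2 - 1 + b1' ∧ 0 ≤ b1 + b1' - b2 - 1 + n

/-- The closed form of the series in the case `b2 = b1 + b1' + n - 1`. -/
def kdfClosed (q : ℂ) (b1 b1' b2 : ℤ) (b2' : ℂ) (d : ℤ) (d' : ℂ) (m n : ℕ) : ℂ :=
  (-1) ^ (b1' + b2 + d + m - 1)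
    * q ^ (n * (b2' - d') + b2 * (d + m - b2 - 1) + b1' * (2 * b1 + b1' + 2 * n - 1))
    * (qPoch q b2' n / qPoch q d' n * qPochRatio q (d - b2) (m + 1) (-d - m))
    / qBinom q (-b1 - b1') (-b1)

end

/-! One transformation of terminating 3φ2 series, applied to one summation index of a double series
while the other is frozen, carries everything. Multiplied by (d)_n (e)_n / [n]!, the terminating 3φ2
becomes `qSer`, which has no denominator parameters, so `qSer_transform` holds for all complex
parameters. It arises by expanding one Pochhammer symbol with q-Vandermonde, exchanging the sums and
evaluating the inner one with q-Vandermonde again; two applications give the Euler type formula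
`qSer_euler`. The sign ε distinguishes the versions for q and 1/q.

For natural m and n the functions Φ are cleared of denominators in the same way (`polyA`, `polyF`,
...; there c1, c2, f stand for b1', b2', d'). The cleared sums are joined by one-index
transformations passing through two auxiliary sums X and Y: A–X–J, X–Y–G–E and A–F, while Φ_B is Φ_A
summed backwards. The nonvanishing hypotheses serve only to divide back.

If b1' = -k, the index t is bounded by k whatever n is. Then -n is an ordinary parameter: D comes
from the Euler formula in t, and G and H from sums over the triangle s + t ≤ k.

For integer parameters Pochhammer symbols become factorials. `polyG` turns into `factA`, where the
second index still carries two complex parameters β and φ. The sum over s then has a further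
terminating parameter, and `sum_fact_transform_cut` replaces its length a by e - a. This opens a
second chain A–Q–B–D–G, with a branch Q–K. With β = -d-f-1 and φ = -f one obtains S_B and S_D; S_C
and S_F come from `polyA` and `polyF`; S_E and S_G come from K and G, because S_A is unchanged when
q is replaced by 1/q and (a,c,e) is exchanged with (b,d,f). With β = b2' and φ = d' left complex, D,
B and K give Φ_C, Φ_I and Φ_K in the triangular case. The closed forms are the cases in which a
single term survives. -/

noncomputable section

open Finset

variable {q : ℂ}

/-! ### Symmetric q-numbers, Pochhammer symbols and reciprocal factorials. -/

/-- The standing assumption on `q`: nonzero, and equal to `1` or not a root of unity. -/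
def QAdm (q : ℂ) : Prop := q ≠ 0 ∧ ∀ k : ℕ, 0 < k → q ^ k = 1 → q = 1

/-- The reciprocal `1 / [n]!`, which vanishes at negative `n`. -/
def qRF (q : ℂ) (n : ℤ) : ℂ := (qFact q n)⁻¹

lemma QAdm.cpow_add (h : QAdm q) (x y : ℂ) : q ^ (x + y) = q ^ x * q ^ y :=
  Complex.cpow_add x y h.1

lemma QAdm.sub_inv_ne (h : QAdm q) (h1 : q ≠ 1) : q - q⁻¹ ≠ 0 := by
  intro h0
  have h2 : q ^ 2 = 1 := by
    have := h.1
    field_simp at h0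
    linear_combination h0
  exact h1 (h.2 2 (by norm_num) h2)

lemma qNum_zero : qNum q 0 = 0 := by
  simp [qNum]

lemma qNum_neg (x : ℂ) : qNum q (-x) = -qNum q x := by
  unfold qNum
  split_ifs
  · rfl
  · rw [neg_neg]; ring

/-- The two mixed powers q^(y-x) cancel. This addition rule is what drives the induction for
q-Vandermonde. -/
lemma qNum_add (h : QAdm q) (x y : ℂ) :
    qNum q (x + y) = q ^ y * qNum q x + q ^ (-x) * qNum q y := by
  unfold qNum
  split_ifs with h1
  · subst h1; simp
  · rw [neg_add, h.cpow_add, h.cpow_add]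
    field_simp
    ring

lemma qNum_nat_ne (h : QAdm q) {n : ℕ} (hn : 0 < n) : qNum q n ≠ 0 := by
  unfold qNum
  split_ifs with h1
  · exact_mod_cast hn.ne'
  · refine div_ne_zero ?_ (h.sub_inv_ne h1)
    intro h0
    apply h1
    -- [n] = 0 means q^n = q^(-n), that is q^(2n) = 1.
    apply h.2 (n + n) (by omega)
    rw [Complex.cpow_neg, Complex.cpow_natCast] at h0
    have := pow_ne_zero n h.1
    field_simp at h0
    rw [pow_add]
    linear_combination h0

lemma qNum_int_ne (h : QAdm q) {n : ℤ} (hn : n ≠ 0) : qNum q n ≠ 0 := by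
  obtain ⟨k, rfl | rfl⟩ := n.eq_nat_or_neg
  · exact_mod_cast qNum_nat_ne h (n := k) (by omega)
  · push_cast
    rw [qNum_neg]
    exact neg_ne_zero.mpr (qNum_nat_ne h (by omega))

@[simp] lemma qPoch_zero (x : ℂ) : qPoch q x 0 = 1 := by simp [qPoch]

lemma qPoch_succ (x : ℂ) (n : ℕ) : qPoch q x (n + 1) = qPoch q x n * qNum q (x + n) := by
  simp [qPoch, prod_range_succ]

lemma qPoch_add (x : ℂ) (m n : ℕ) :
    qPoch q x (m + n) = qPoch q x m * qPoch q (x + m) n := by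
  simp only [qPoch, prod_range_add]
  congr 1
  refine prod_congr rfl fun i _ => ?_
  push_cast
  rw [add_assoc]

lemma qPoch_add' (x : ℂ) (m n : ℕ) :
    qPoch q x (m + n) = qPoch q x n * qPoch q (x + n) m := by
  rw [add_comm, qPoch_add]

lemma qPoch_swap (x : ℂ) (m n : ℕ) :
    qPoch q x m * qPoch q (x + m) n = qPoch q x n * qPoch q (x + n) m := by
  rw [← qPoch_add, ← qPoch_add']

lemma qPoch_ne_of_le {x : ℂ} {m n : ℕ} (hmn : m ≤ n) (hx : qPoch q x n ≠ 0) :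
    qPoch q x m ≠ 0 := by
  obtain ⟨k, rfl⟩ := Nat.exists_eq_add_of_le hmn
  rw [qPoch_add] at hx
  exact left_ne_zero_of_mul hx

/-- Reading the product backwards negates every argument, and the symmetric q-number is odd; unlike
for the usual q-shifted factorials, no power of q appears. -/
lemma qPoch_reflect (x y : ℂ) (n : ℕ) (hy : y = 1 - x - n) :
    qPoch q y n = (-1) ^ n * qPoch q x n := by
  subst hy
  rw [qPoch, ← prod_range_reflect, qPoch]
  rw [show ((-1 : ℂ)) ^ n = ∏ _k ∈ range n, (-1 : ℂ) by simp, ← prod_mul_distrib]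
  refine prod_congr rfl fun i hi => ?_
  have hi : i < n := mem_range.mp hi
  rw [Nat.cast_sub (by omega), Nat.cast_sub (by omega)]
  rw [neg_one_mul, ← qNum_neg]
  congr 1
  push_cast
  ring

lemma neg_one_sq_pow (n : ℕ) : ((-1 : ℂ)) ^ n * (-1) ^ n = 1 := by
  rw [← mul_pow]; simp

lemma qPoch_neg_nat_eq_zero {m s : ℕ} (hs : m < s) : qPoch q (-(m : ℂ)) s = 0 :=
  prod_eq_zero (mem_range.mpr hs) (by simp [qNum_zero])

lemma qFact_neg {n : ℤ} (hn : n < 0) : qFact q n = 0 := by simp [qFact, hn]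

lemma qFact_zero : qFact q 0 = 1 := by simp [qFact]

lemma qFact_succ {n : ℤ} (hn : 0 ≤ n) : qFact q (n + 1) = qFact q n * qNum q ((n : ℂ) + 1) := by
  unfold qFact
  rw [if_neg (by omega), if_neg (by omega)]
  have : Icc 1 (n + 1) = insert (n + 1) (Icc 1 n) := by
    ext k; simp only [mem_Icc, mem_insert]; omega
  rw [this, prod_insert (by simp)]
  push_cast
  ring

lemma qFact_ne (h : QAdm q) {n : ℤ} (hn : 0 ≤ n) : qFact q n ≠ 0 := by
  unfold qFact
  rw [if_neg (by omega)]
  refine prod_ne_zero_iff.mpr fun k hk => qNum_int_ne h ?_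
  have := (mem_Icc.mp hk).1
  omega

lemma qRF_neg {n : ℤ} (hn : n < 0) : qRF q n = 0 := by simp [qRF, qFact_neg hn]

lemma qRF_zero : qRF q 0 = 1 := by simp [qRF, qFact_zero]

lemma qRF_ne (h : QAdm q) {n : ℤ} (hn : 0 ≤ n) : qRF q n ≠ 0 := inv_ne_zero (qFact_ne h hn)

lemma qFact_mul_qRF (h : QAdm q) {n : ℤ} (hn : 0 ≤ n) : qFact q n * qRF q n = 1 :=
  mul_inv_cancel₀ (qFact_ne h hn)

/-- No sign condition is needed: at n = -1 the factor [0] supplies the zero. Hence 1/[n]! can be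
manipulated without tracking the natural range of a sum. -/
lemma qRF_succ (h : QAdm q) (n : ℤ) : qRF q n = qNum q ((n : ℂ) + 1) * qRF q (n + 1) := by
  rcases lt_trichotomy n (-1) with hn | hn | hn
  · rw [qRF_neg (by omega), qRF_neg (by omega), mul_zero]
  · subst hn
    rw [qRF_neg (by omega)]
    simp [qNum_zero]
  · have h1 := qFact_mul_qRF h (n := n) (by omega)
    have h2 := qFact_mul_qRF h (n := n + 1) (by omega)
    rw [qFact_succ (by omega)] at h2
    linear_combination qNum q ((n : ℂ) + 1) * qRF q (n + 1) * h1 - qRF q n * h2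

/-- Valid for all integers `y`. -/
lemma qPoch_mul_qRF (h : QAdm q) {x : ℂ} {y z : ℤ} {k : ℕ} (hx : x = y + 1) (hz : z = y + k) :
    qPoch q x k * qRF q z = qRF q y := by
  subst hx hz
  induction k with
  | zero => simp
  | succ k ih =>
    rw [qPoch_succ, ← ih, qRF_succ h (y + k)]
    push_cast
    rw [show (y : ℂ) + k + 1 = y + 1 + k by ring, show y + (k : ℤ) + 1 = y + (k + 1) by ring]
    ring

/-- Arguments enter through the equations hx and hz, so that the lemma applies to any spelling of
the same number, complex or integer. -/
lemma qPoch_neg_mul_qRF (h : QAdm q) {x : ℂ} {y z : ℤ} {k : ℕ} (hx : x = -y) (hz : z = y - k) :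
    qPoch q x k * qRF q y = (-1) ^ k * qRF q z := by
  rw [qPoch_reflect ((z : ℂ) + 1) x k (by subst hx hz; push_cast; ring), mul_assoc,
    qPoch_mul_qRF h rfl (by omega)]

lemma qPoch_eq_fact (h : QAdm q) {x : ℂ} {y z : ℤ} {k : ℕ} (hx : x = y + 1) (hz : z = y + k)
    (hz0 : 0 ≤ z) : qPoch q x k = qFact q z * qRF q y := by
  rw [← qPoch_mul_qRF h hx hz]
  linear_combination -qPoch q x k * qFact_mul_qRF h hz0

lemma qPoch_neg_eq_fact (h : QAdm q) {x : ℂ} {y z : ℤ} {k : ℕ} (hx : x = -y) (hz : z = y - k)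
    (hy : 0 ≤ y) : qPoch q x k = (-1) ^ k * qFact q y * qRF q z := by
  have := qPoch_neg_mul_qRF h hx hz
  linear_combination qFact q y * this - qPoch q x k * qFact_mul_qRF h hy

/-! ### q-Vandermonde and the transformations of terminating 3φ2 series. -/

/-- Symmetric `q`-Vandermonde formula. -/
lemma qPoch_vandermonde_pos (h : QAdm q) (x y : ℂ) (n : ℕ) :
    qPoch q (x + y) n * qRF q n = ∑ p ∈ antidiagonal n,
      qRF q p.1 * qRF q p.2 * qPoch q x p.1 * qPoch q y p.2
        * q ^ ((p.1 : ℂ) * y - p.2 * x) := by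
  induction n with
  | zero => simp [qRF_zero]
  | succ n ih =>
    have hn : qNum q ((n : ℂ) + 1) ≠ 0 := by
      have := qNum_nat_ne h (n := n + 1) (by omega)
      exact_mod_cast this
    apply mul_left_cancel₀ hn
    have e1 : qNum q ((n : ℂ) + 1) * (qPoch q (x + y) (n + 1) * qRF q ((n + 1 : ℕ) : ℤ))
        = qNum q (x + y + n) * (qPoch q (x + y) n * qRF q n) := by
      have := qRF_succ h (n : ℤ)
      rw [this, qPoch_succ]
      push_cast
      ring
    rw [e1, ih, mul_sum, mul_sum]
    -- On the antidiagonal n + 1 = s + r, so [n+1] = q^r [s] + q^(-s) [r]. The first part vanishes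
    -- at s = 0 and the second at r = 0; after a shift both are sums over the antidiagonal n.
    have key : ∀ p ∈ antidiagonal (n + 1),
        qNum q ((n : ℂ) + 1) * (qRF q p.1 * qRF q p.2 * qPoch q x p.1 * qPoch q y p.2
          * q ^ ((p.1 : ℂ) * y - p.2 * x))
        = (q ^ (p.2 : ℂ) * qNum q p.1) * (qRF q p.1 * qRF q p.2 * qPoch q x p.1 * qPoch q y p.2
          * q ^ ((p.1 : ℂ) * y - p.2 * x))
        + (q ^ (-(p.1 : ℂ)) * qNum q p.2) * (qRF q p.1 * qRF q p.2 * qPoch q x p.1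
          * qPoch q y p.2 * q ^ ((p.1 : ℂ) * y - p.2 * x)) := by
      rintro ⟨s, r⟩ hp
      have hp : s + r = n + 1 := mem_antidiagonal.mp hp
      have : (n : ℂ) + 1 = s + r := by exact_mod_cast hp.symm
      simp only
      rw [this, qNum_add h]
      ring
    rw [sum_congr rfl key, sum_add_distrib, Nat.sum_antidiagonal_succ]
    rw [Nat.sum_antidiagonal_succ' (n := n) (f := fun p : ℕ × ℕ =>
      (q ^ (-(p.1 : ℂ)) * qNum q p.2) * (qRF q p.1 * qRF q p.2 * qPoch q x p.1
          * qPoch q y p.2 * q ^ ((p.1 : ℂ) * y - p.2 * x)))]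
    simp only [Nat.cast_zero, qNum_zero, mul_zero, zero_mul, zero_add]
    rw [← sum_add_distrib]
    refine sum_congr rfl ?_
    rintro ⟨s, r⟩ hp
    have hp : s + r = n := mem_antidiagonal.mp hp
    subst hp
    simp only
    -- Splitting [x+y+n] = [(x+s)+(y+r)] by the same rule gives exactly the two shifted terms.
    rw [show x + y + ((s + r : ℕ) : ℂ) = (x + s) + (y + r) by push_cast; ring, qNum_add h,
      qPoch_succ, qPoch_succ, qRF_succ h (s : ℤ), qRF_succ h (r : ℤ)]
    push_cast
    have h1 : q ^ (y + r) * q ^ ((s : ℂ) * y - r * x)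
        = q ^ (r : ℂ) * q ^ (((s : ℂ) + 1) * y - r * x) := by
      rw [← h.cpow_add, ← h.cpow_add]; ring_nf
    have h2 : q ^ (-(x + s)) * q ^ ((s : ℂ) * y - r * x)
        = q ^ (-(s : ℂ)) * q ^ ((s : ℂ) * y - ((r : ℂ) + 1) * x) := by
      rw [← h.cpow_add, ← h.cpow_add]; ring_nf
    linear_combination
      (qNum q (x + s) * qNum q (s + 1) * qRF q (s + 1) * qNum q (r + 1) * qRF q (r + 1)
        * qPoch q x s * qPoch q y r) * h1
      + (qNum q (y + r) * qNum q (s + 1) * qRF q (s + 1) * qNum q (r + 1) * qRF q (r + 1)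
        * qPoch q x s * qPoch q y r) * h2

/-- Exchanging x and y fixes the left side and reverses the exponent on the right, so the formula
for 1/q comes for free. -/
lemma qPoch_vandermonde (h : QAdm q) {ε : ℂ} (hε : ε = 1 ∨ ε = -1) (x y : ℂ) (n : ℕ) :
    qPoch q (x + y) n * qRF q n = ∑ p ∈ antidiagonal n,
      qRF q p.1 * qRF q p.2 * qPoch q x p.1 * qPoch q y p.2
        * q ^ (ε * ((p.1 : ℂ) * y - p.2 * x)) := by
  rcases hε with rfl | rfl
  · simpa using qPoch_vandermonde_pos h x y n
  · rw [add_comm, qPoch_vandermonde_pos h, ← Nat.sum_antidiagonal_swap]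
    refine sum_congr rfl fun p _ => ?_
    simp only [Prod.fst_swap, Prod.snd_swap]
    rw [show (p.2 : ℂ) * x - p.1 * y = -1 * ((p.1 : ℂ) * y - p.2 * x) by ring]
    ring

/-- This is Vandermonde at a and 1 - n - d with both reflected symbols turned back. The tail (d+s)_r
is the shape in which `qTerm` stores its denominator parameters. -/
lemma qPoch_sub_vandermonde (h : QAdm q) {ε : ℂ} (hε : ε = 1 ∨ ε = -1) (a d : ℂ) (n : ℕ) :
    qPoch q (d - a) n * qRF q n = ∑ p ∈ antidiagonal n,
      (-1) ^ p.1 * qRF q p.1 * qRF q p.2 * qPoch q a p.1 * qPoch q (d + p.1) p.2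
        * q ^ (ε * ((p.1 : ℂ) * (1 - n - d) - p.2 * a)) := by
  have h1 := qPoch_vandermonde h hε a (1 - n - d) n
  rw [qPoch_reflect (d - a) (a + (1 - n - d)) n (by ring)] at h1
  have h2 : qPoch q (d - a) n * qRF q n
      = (-1) ^ n * ((-1) ^ n * qPoch q (d - a) n * qRF q n) := by
    linear_combination -qPoch q (d - a) n * qRF q n * neg_one_sq_pow n
  rw [h2, h1, mul_sum]
  refine sum_congr rfl ?_
  rintro ⟨s, r⟩ hp
  have hp : s + r = n := mem_antidiagonal.mp hp
  subst hp
  simp only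
  rw [qPoch_reflect (d + s) (1 - ((s + r : ℕ) : ℂ) - d) r (by push_cast; ring), pow_add]
  linear_combination (-1) ^ s * qRF q s * qRF q r * qPoch q a s * qPoch q (d + s) r
    * q ^ (ε * ((s : ℂ) * (1 - ((s + r : ℕ) : ℂ) - d) - r * a)) * neg_one_sq_pow r

/-- A term of the terminating series `3φ2(a, b, -s-r; d, e)` without denominator parameters. -/
def qTerm (q ε a b d e : ℂ) (s r : ℕ) : ℂ :=
  (-1) ^ s * qRF q s * qRF q r * qPoch q a s * qPoch q b s * qPoch q (d + s) r
    * qPoch q (e + s) r * q ^ (ε * s * ((s : ℂ) + r + d + e - a - b - 1))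

/-- The terminating series `3φ2(a, b, -n; d, e)` without denominator parameters. -/
def qSer (q ε a b d e : ℂ) (n : ℕ) : ℂ :=
  ∑ p ∈ antidiagonal n, qTerm q ε a b d e p.1 p.2

lemma qSer_comm_num (ε a b d e : ℂ) (n : ℕ) : qSer q ε a b d e n = qSer q ε b a d e n := by
  refine sum_congr rfl fun p _ => ?_
  unfold qTerm
  rw [show (p.1 : ℂ) + p.2 + d + e - a - b - 1 = (p.1 : ℂ) + p.2 + d + e - b - a - 1 by ring]
  ring

lemma qSer_comm_den (ε a b d e : ℂ) (n : ℕ) : qSer q ε a b d e n = qSer q ε a b e d n := by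
  refine sum_congr rfl fun p _ => ?_
  unfold qTerm
  rw [show (p.1 : ℂ) + p.2 + d + e - a - b - 1 = (p.1 : ℂ) + p.2 + e + d - a - b - 1 by ring]
  ring

/-- The basic transformation of terminating `3φ2` series. -/
lemma qSer_transform (h : QAdm q) {ε : ℂ} (hε : ε = 1 ∨ ε = -1) (a b d e : ℂ) (n : ℕ) :
    qSer q ε a b d e n = q ^ (-(ε * n * a)) * ∑ p ∈ antidiagonal n,
      qRF q p.1 * qRF q p.2 * qPoch q a p.1 * qPoch q (e - b) p.1 * qPoch q (e + p.1) p.2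
        * qPoch q (d - a) p.2 * q ^ (ε * p.1 * (d - b)) := by
  have hε' : -ε = 1 ∨ -ε = -1 := by
    rcases hε with rfl | rfl
    · right; rfl
    · left; ring
  -- The common summand: (b)_s, written as (e - (e-b))_s, is expanded over s = j + i; here p = (s,
  -- r) and u = (j, i).
  let f : ℕ × ℕ → ℕ × ℕ → ℂ := fun p u =>
    (-1) ^ (p.1 + u.1) * qRF q p.2 * qRF q u.1 * qRF q u.2 * qPoch q a p.1
      * qPoch q (e - b) u.1 * qPoch q (e + u.1) (u.2 + p.2) * qPoch q (d + p.1) p.2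
      * q ^ (ε * p.1 * ((p.1 : ℂ) + p.2 + d + e - a - b - 1)
        + ε * ((u.1 : ℂ) * (1 - p.1 - e) - u.2 * (e - b)))
  have hL : qSer q ε a b d e n = ∑ p ∈ antidiagonal n, ∑ u ∈ antidiagonal p.1, f p u := by
    refine sum_congr rfl ?_
    rintro ⟨s, r⟩ _
    have hb := qPoch_sub_vandermonde h hε (e - b) e s
    rw [sub_sub_cancel] at hb
    have : qTerm q ε a b d e s r = (qPoch q b s * qRF q s) * ((-1) ^ s * qRF q r * qPoch q a s
        * qPoch q (d + s) r * qPoch q (e + s) r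
        * q ^ (ε * s * ((s : ℂ) + r + d + e - a - b - 1))) := by
      unfold qTerm; ring
    simp only
    rw [this, hb, sum_mul]
    refine sum_congr rfl ?_
    rintro ⟨j, i⟩ hp
    have hp : j + i = s := mem_antidiagonal.mp hp
    subst hp
    simp only [f]
    rw [h.cpow_add, qPoch_add (e + j), pow_add,
      show e + ((j + i : ℕ) : ℂ) = e + j + i by push_cast; ring]
    ring
  -- In the other order j is fixed and i + r = k varies; Vandermonde with sign -ε sums this to
  -- (d-a)_k.
  have hR : q ^ (-(ε * n * a)) * ∑ p ∈ antidiagonal n,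
      qRF q p.1 * qRF q p.2 * qPoch q a p.1 * qPoch q (e - b) p.1 * qPoch q (e + p.1) p.2
        * qPoch q (d - a) p.2 * q ^ (ε * p.1 * (d - b))
      = ∑ p ∈ antidiagonal n, ∑ u ∈ antidiagonal p.2, f (p.1 + u.1, u.2) (p.1, u.1) := by
    rw [mul_sum]
    refine sum_congr rfl ?_
    rintro ⟨j, k⟩ hp
    have hp : j + k = n := mem_antidiagonal.mp hp
    subst hp
    have hb := qPoch_sub_vandermonde h hε' (a + j) (d + j) k
    rw [add_sub_add_right_eq_sub] at hb
    simp only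
    have : q ^ (-(ε * ((j + k : ℕ) : ℂ) * a)) * (qRF q j * qRF q k * qPoch q a j
        * qPoch q (e - b) j * qPoch q (e + j) k * qPoch q (d - a) k * q ^ (ε * j * (d - b)))
        = (qPoch q (d - a) k * qRF q k) * (q ^ (-(ε * ((j + k : ℕ) : ℂ) * a)) * qRF q j
          * qPoch q a j * qPoch q (e - b) j * qPoch q (e + j) k * q ^ (ε * j * (d - b))) := by
      ring
    rw [this, hb, sum_mul]
    refine sum_congr rfl ?_
    rintro ⟨i, r⟩ hp
    have hp : i + r = k := mem_antidiagonal.mp hp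
    subst hp
    simp only [f]
    have hE : q ^ (ε * ((j + i : ℕ) : ℂ) * (((j + i : ℕ) : ℂ) + r + d + e - a - b - 1)
        + ε * ((j : ℂ) * (1 - ((j + i : ℕ) : ℂ) - e) - i * (e - b)))
        = q ^ (-ε * ((i : ℂ) * (1 - ((i + r : ℕ) : ℂ) - (d + j)) - r * (a + j)))
          * (q ^ (-(ε * ((j + (i + r) : ℕ) : ℂ) * a)) * q ^ (ε * j * (d - b))) := by
      rw [← h.cpow_add, ← h.cpow_add]
      congr 1
      push_cast
      ring
    rw [hE, qPoch_add a, show d + ((j + i : ℕ) : ℂ) = d + j + i by push_cast; ring,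
      show j + i + j = j + j + i by ring, pow_add, pow_add, neg_one_sq_pow]
    ring
  rw [hL, hR, sum_sigma', sum_sigma']
  refine sum_bij' (fun x _ => ⟨(x.2.1, x.2.2 + x.1.2), (x.2.2, x.1.2)⟩)
    (fun x _ => ⟨(x.1.1 + x.2.1, x.2.2), (x.1.1, x.2.1)⟩) ?_ ?_ ?_ ?_ ?_
  · rintro ⟨⟨s, r⟩, ⟨j, i⟩⟩ hx
    simp only [mem_sigma, HasAntidiagonal.mem_antidiagonal] at hx ⊢
    exact ⟨by omega, by trivial⟩
  · rintro ⟨⟨s, r⟩, ⟨j, i⟩⟩ hx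
    simp only [mem_sigma, HasAntidiagonal.mem_antidiagonal] at hx ⊢
    exact ⟨by omega, by trivial⟩
  · rintro ⟨⟨s, r⟩, ⟨j, i⟩⟩ hx
    simp only [mem_sigma, HasAntidiagonal.mem_antidiagonal] at hx ⊢
    obtain ⟨h1, rfl⟩ := hx
    rfl
  · rintro ⟨⟨s, r⟩, ⟨j, i⟩⟩ hx
    simp only [mem_sigma, HasAntidiagonal.mem_antidiagonal] at hx ⊢
    obtain ⟨h1, rfl⟩ := hx
    rfl
  · rintro ⟨⟨s, r⟩, ⟨j, i⟩⟩ hx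
    simp only [mem_sigma, HasAntidiagonal.mem_antidiagonal] at hx
    obtain ⟨h1, rfl⟩ := hx
    rfl

/-- Reflecting (d-a)_r gives the tail of a new denominator parameter 1 - n - d + a, so the
transformed sum is again a `qSer`, with the sign ε reversed. -/
lemma qSer_transform' (h : QAdm q) {ε : ℂ} (hε : ε = 1 ∨ ε = -1) (a b d e : ℂ) (n : ℕ) :
    qSer q ε a b d e n
      = (-1) ^ n * q ^ (-(ε * n * a)) * qSer q (-ε) a (e - b) (1 - n - d + a) e n := by
  rw [qSer_transform h hε, qSer, mul_sum, mul_sum]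
  refine sum_congr rfl ?_
  rintro ⟨s, r⟩ hp
  have hp : s + r = n := mem_antidiagonal.mp hp
  subst hp
  simp only [qTerm]
  rw [qPoch_reflect (d - a) (1 - ((s + r : ℕ) : ℂ) - d + a + s) r (by push_cast; ring),
    show -ε * s * ((s : ℂ) + r + (1 - ((s + r : ℕ) : ℂ) - d + a) + e - a - (e - b) - 1)
      = ε * s * (d - b) by push_cast; ring, pow_add]
  linear_combination (-q ^ (-(ε * ((s + r : ℕ) : ℂ) * a)) * qRF q s * qRF q r * qPoch q a s
    * qPoch q (e - b) s * qPoch q (e + s) r * qPoch q (d - a) r * q ^ (ε * s * (d - b)))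
    * ((-1) ^ s * (-1) ^ s * neg_one_sq_pow r + neg_one_sq_pow s)

/-- Two applications of `qSer_transform'`, the second to the other numerator parameter: the signs
cancel, ε returns, and the reflected denominator parameter becomes d + e - a - b. -/
lemma qSer_euler (h : QAdm q) {ε : ℂ} (hε : ε = 1 ∨ ε = -1) (a b d e : ℂ) (n : ℕ) :
    qSer q ε a b d e n
      = q ^ (ε * n * (e - a - b)) * qSer q ε (e - a) (e - b) (d + e - a - b) e n := by
  have hε' : -ε = 1 ∨ -ε = -1 := by
    rcases hε with rfl | rfl
    · right; rfl
    · left; ring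
  rw [qSer_transform' h hε, qSer_comm_num, qSer_transform' h hε', neg_neg,
    show 1 - (n : ℂ) - (1 - n - d + a) + (e - b) = d + e - a - b by ring,
    qSer_comm_num ε (e - b)]
  have : q ^ (ε * n * (e - a - b)) = q ^ (-(ε * n * a)) * q ^ (-(-ε * n * (e - b))) := by
    rw [← h.cpow_add]; congr 1; ring
  rw [this]
  linear_combination (q ^ (-(ε * n * a)) * q ^ (-(-ε * n * (e - b)))
    * qSer q ε (e - a) (e - b) (d + e - a - b) e n) * neg_one_sq_pow n

/-! ### Double sums and transformations in one index. -/

/-- The double sum over `s + r = m`, `t + w = n`. -/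
def qDouble (m n : ℕ) (f : ℕ → ℕ → ℕ → ℕ → ℂ) : ℂ :=
  ∑ p ∈ antidiagonal m, ∑ u ∈ antidiagonal n, f p.1 p.2 u.1 u.2

lemma qDouble_mul_eq {m n : ℕ} {f g : ℕ → ℕ → ℕ → ℕ → ℂ} (c k : ℂ)
    (hfg : ∀ s r t w, s + r = m → t + w = n → f s r t w * c = k * g s r t w) :
    qDouble m n f * c = k * qDouble m n g := by
  unfold qDouble
  rw [sum_mul, mul_sum]
  refine sum_congr rfl fun p hp => ?_
  rw [sum_mul, mul_sum]
  exact sum_congr rfl fun u hu => hfg _ _ _ _ (HasAntidiagonal.mem_antidiagonal.mp hp)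
    (HasAntidiagonal.mem_antidiagonal.mp hu)

lemma qDouble_congr_left {m n : ℕ} {f g : ℕ → ℕ → ℕ → ℕ → ℂ}
    (hfg : ∀ t w, t + w = n → ∑ p ∈ antidiagonal m, f p.1 p.2 t w
      = ∑ p ∈ antidiagonal m, g p.1 p.2 t w) :
    qDouble m n f = qDouble m n g := by
  unfold qDouble
  rw [sum_comm, sum_comm (s := antidiagonal m)]
  exact sum_congr rfl fun u hu => hfg _ _ (HasAntidiagonal.mem_antidiagonal.mp hu)

lemma qDouble_congr_right {m n : ℕ} {f g : ℕ → ℕ → ℕ → ℕ → ℂ}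
    (hfg : ∀ s r, s + r = m → ∑ u ∈ antidiagonal n, f s r u.1 u.2
      = ∑ u ∈ antidiagonal n, g s r u.1 u.2) :
    qDouble m n f = qDouble m n g :=
  sum_congr rfl fun _ hp => hfg _ _ (HasAntidiagonal.mem_antidiagonal.mp hp)

lemma qDouble_swap (m n : ℕ) (f : ℕ → ℕ → ℕ → ℕ → ℂ) :
    qDouble m n (fun s r t w => f r s w t) = qDouble m n f := by
  unfold qDouble
  rw [← Nat.sum_antidiagonal_swap]
  refine sum_congr rfl fun p _ => ?_
  rw [← Nat.sum_antidiagonal_swap]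
  rfl

/-- The parameters and the prefactor C may depend on the frozen pair (t, w). An application only has
to display both summands in the two shapes occurring in `qSer_transform`. -/
lemma qDouble_transform_left (h : QAdm q) {ε : ℂ} (hε : ε = 1 ∨ ε = -1) {m n : ℕ}
    {f g : ℕ → ℕ → ℕ → ℕ → ℂ} (a b d e C : ℕ → ℕ → ℂ)
    (hf : ∀ t w, t + w = n → ∀ s r, s + r = m →
      f s r t w = C t w * qTerm q ε (a t w) (b t w) (d t w) (e t w) s r)
    (hg : ∀ t w, t + w = n → ∀ s r, s + r = m → g s r t w = C t w * q ^ (-(ε * m * a t w)) *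
      (qRF q s * qRF q r * qPoch q (a t w) s * qPoch q (e t w - b t w) s
        * qPoch q (e t w + s) r * qPoch q (d t w - a t w) r * q ^ (ε * s * (d t w - b t w)))) :
    qDouble m n f = qDouble m n g := by
  refine qDouble_congr_left fun t w htw => ?_
  rw [sum_congr rfl fun p hp => hf t w htw p.1 p.2 (HasAntidiagonal.mem_antidiagonal.mp hp),
    sum_congr rfl fun p hp => hg t w htw p.1 p.2 (HasAntidiagonal.mem_antidiagonal.mp hp),
    ← mul_sum, ← mul_sum]
  have := qSer_transform h hε (a t w) (b t w) (d t w) (e t w) m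
  rw [qSer] at this
  rw [this, ← mul_assoc (C t w)]

lemma qDouble_transform_right (h : QAdm q) {ε : ℂ} (hε : ε = 1 ∨ ε = -1) {m n : ℕ}
    {f g : ℕ → ℕ → ℕ → ℕ → ℂ} (a b d e C : ℕ → ℕ → ℂ)
    (hf : ∀ s r, s + r = m → ∀ t w, t + w = n →
      f s r t w = C s r * qTerm q ε (a s r) (b s r) (d s r) (e s r) t w)
    (hg : ∀ s r, s + r = m → ∀ t w, t + w = n → g s r t w = C s r * q ^ (-(ε * n * a s r)) *
      (qRF q t * qRF q w * qPoch q (a s r) t * qPoch q (e s r - b s r) t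
        * qPoch q (e s r + t) w * qPoch q (d s r - a s r) w * q ^ (ε * t * (d s r - b s r)))) :
    qDouble m n f = qDouble m n g := by
  have hs : ∀ F : ℕ → ℕ → ℕ → ℕ → ℂ,
      qDouble m n F = qDouble n m fun s r t w => F t w s r := fun F => sum_comm
  rw [hs f, hs g]
  exact qDouble_transform_left h hε a b d e C hf hg

/-! ### Denominator-free forms of the Kampé de Fériet functions and the identities between them. -/

section DenominatorFree

variable (q) (b1 c1 b2 c2 d f : ℂ) (m n : ℕ)

/-- The term of Φ_A times (b1+c1)_{m+n} (d)_m (f)_n / ([m]! [n]!), with r = m - s and w = n - t.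
Each denominator symbol has become the tail of its product. -/
def polyA (s r t w : ℕ) : ℂ :=
  (-1) ^ (s + t) * (qRF q s * qRF q r * qRF q t * qRF q w) * qPoch q b1 s * qPoch q b2 s
    * qPoch q (d + s) r * qPoch q c1 t * qPoch q c2 t * qPoch q (f + t) w
    * qPoch q (b1 + c1 + (s + t : ℕ)) (r + w)
    * q ^ (s * (b2 - c1 - d - m + 1) + t * (c2 - b1 - f - n + 1) - s * t)

/-- An auxiliary sum without counterpart among the Φ. From it J and, through `polyY`, also G and E
are reached; its factor (c1)_{s+t} makes the case c1 = 0 collapse. -/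
def polyX (s r t w : ℕ) : ℂ :=
  (-1) ^ t * (qRF q s * qRF q r * qRF q t * qRF q w) * qPoch q c1 (s + t) * qPoch q b2 s
    * qPoch q (d - b2) r * qPoch q c2 t * qPoch q (f + t) w
    * qPoch q (b1 + c1 + (s + t : ℕ)) (r + w)
    * q ^ (m * b2 - s * (d - b1) + t * (c2 - b1 - f - n + 1))

def polyJ (s r t w : ℕ) : ℂ :=
  (qRF q s * qRF q r * qRF q t * qRF q w) * qPoch q c1 s * qPoch q b2 s
    * qPoch q (d - b2) r * qPoch q c2 t * qPoch q b1 t * qPoch q (f - c2) w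
    * qPoch q (b1 + c1 + (s + t : ℕ)) (r + w)
    * q ^ (m * b2 + n * c2 - s * (d - b1) - t * (f - c1) + s * t)

def polyY (s r t w : ℕ) : ℂ :=
  (qRF q s * qRF q r * qRF q t * qRF q w) * qPoch q c1 (s + t) * qPoch q b2 s
    * qPoch q (d - b2) r * qPoch q (f - c2) t * qPoch q b1 w * qPoch q (f + t) w
    * qPoch q (b1 + c1 + n + s) r
    * q ^ (m * b2 + n * c1 + n * s - s * (d - b1) - t * (b1 + c1 + s - c2))

def polyG (s r t w : ℕ) : ℂ :=
  (-1) ^ s * (qRF q s * qRF q r * qRF q t * qRF q w) * qPoch q c1 (s + t)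
    * qPoch q (1 - d - m) s * qPoch q (d - b2) r * qPoch q (f - c2) t * qPoch q (f + t) w
    * qPoch q b1 (r + w)
    * q ^ (m * b2 + n * c1 - m * c1 + s * (b1 + c1 - b2 + n) - t * (b1 + c1 - c2 + m))

def polyE (s r t w : ℕ) : ℂ :=
  (-1) ^ (s + t) * (qRF q s * qRF q r * qRF q t * qRF q w) * qPoch q c1 s
    * qPoch q (1 - d - m) s * qPoch q (d - b2) r * qPoch q (f - c2) t
    * qPoch q (1 - b1 - c1 - m - n) t * qPoch q c2 w * qPoch q b1 (r + w)
    * q ^ (m * b2 + n * c1 - m * c1 - n * (f - c2) + s * (b1 + c1 - b2 + n) + t * (f - c1)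
        - s * t)

def polyF (s r t w : ℕ) : ℂ :=
  (qRF q s * qRF q r * qRF q t * qRF q w) * qPoch q b1 (s + t) * qPoch q (d - b2) s
    * qPoch q (d + s) r * qPoch q c1 r * qPoch q c2 t * qPoch q (b1 + c1 + m + t) w
    * qPoch q (f - c2) w
    * q ^ (m * b1 + n * c2 - s * (b1 + c1 - b2) - t * (f - c1 - m) - s * t)

variable {q}

/-- For fixed t the sum over s has numerator parameters b2, b1 and denominator parameters d,
b1+c1+t. The difference (b1+c1+t) - b1 = c1 + t lets the new symbol merge with (c1)_t into
(c1)_{s+t}. -/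
lemma polyA_eq_polyX (h : QAdm q) :
    qDouble m n (polyA q b1 c1 b2 c2 d f m n) = qDouble m n (polyX q b1 c1 b2 c2 d f m n) := by
  refine qDouble_transform_left h (Or.inr rfl) (fun _ _ => b2) (fun _ _ => b1) (fun _ _ => d) (fun t _ => b1 + c1 + t)
      (fun t w => (-1) ^ t * qRF q t * qRF q w * qPoch q c1 t * qPoch q c2 t * qPoch q (f + t) w
      * qPoch q (b1 + c1 + t + m) w * q ^ (t * (c2 - b1 - f - n + 1))) ?_ ?_
  · rintro t w htw s r rfl
    have hE : q ^ ((s : ℂ) * (b2 - c1 - d - (s + r : ℕ) + 1) + t * (c2 - b1 - f - n + 1) - s * t)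
        = q ^ (t * (c2 - b1 - f - n + 1))
          * q ^ (-1 * s * ((s : ℂ) + r + d + (b1 + c1 + t) - b2 - b1 - 1)) := by
      rw [← h.cpow_add]; congr 1; push_cast; ring
    simp only [polyA, qTerm]
    rw [hE, qPoch_add (b1 + c1 + (s + t : ℕ)),
      show b1 + c1 + ((s + t : ℕ) : ℂ) = b1 + c1 + t + s by push_cast; ring,
      show b1 + c1 + (t : ℂ) + s + r = b1 + c1 + t + (s + r : ℕ) by push_cast; ring]
    ring
  · rintro t w htw s r rfl
    have hE : q ^ (((s + r : ℕ) : ℂ) * b2 - s * (d - b1) + t * (c2 - b1 - f - n + 1))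
        = q ^ (t * (c2 - b1 - f - n + 1)) * q ^ (-(-1 * ((s + r : ℕ) : ℂ) * b2))
          * q ^ (-1 * s * (d - b1)) := by
      rw [← h.cpow_add, ← h.cpow_add]; congr 1; push_cast; ring
    simp only [polyX]
    rw [hE, qPoch_add (b1 + c1 + (s + t : ℕ)), qPoch_add' c1,
      show b1 + c1 + ((s + t : ℕ) : ℂ) = b1 + c1 + t + s by push_cast; ring,
      show b1 + c1 + (t : ℂ) + s + r = b1 + c1 + t + (s + r : ℕ) by push_cast; ring,
      show b1 + c1 + (t : ℂ) - b1 = c1 + t by ring]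
    ring

/-- Now t varies, with numerator parameters c2 and c1 + s; from (b1+c1+s) - (c1+s) = b1 the symbol
(b1)_t reappears. -/
lemma polyX_eq_polyJ (h : QAdm q) :
    qDouble m n (polyX q b1 c1 b2 c2 d f m n) = qDouble m n (polyJ q b1 c1 b2 c2 d f m n) := by
  refine qDouble_transform_right h (Or.inr rfl) (fun _ _ => c2) (fun s _ => c1 + s) (fun _ _ => f) (fun s _ => b1 + c1 + s)
      (fun s r => qRF q s * qRF q r * qPoch q c1 s * qPoch q b2 s * qPoch q (d - b2) r
      * qPoch q (b1 + c1 + s + n) r * q ^ (m * b2 - s * (d - b1))) ?_ ?_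
  · rintro s r hsr t w rfl
    have hE : q ^ (m * b2 - s * (d - b1) + t * (c2 - b1 - f - (t + w : ℕ) + 1))
        = q ^ (m * b2 - s * (d - b1))
          * q ^ (-1 * t * ((t : ℂ) + w + f + (b1 + c1 + s) - c2 - (c1 + s) - 1)) := by
      rw [← h.cpow_add]; congr 1; push_cast; ring
    simp only [polyX, qTerm]
    rw [hE, qPoch_add' (b1 + c1 + (s + t : ℕ)), qPoch_add c1,
      show b1 + c1 + ((s + t : ℕ) : ℂ) = b1 + c1 + s + t by push_cast; ring,
      show b1 + c1 + (s : ℂ) + t + w = b1 + c1 + s + (t + w : ℕ) by push_cast; ring]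
    ring
  · rintro s r hsr t w rfl
    have hE : q ^ (m * b2 + ((t + w : ℕ) : ℂ) * c2 - s * (d - b1) - t * (f - c1) + s * t)
        = q ^ (m * b2 - s * (d - b1)) * q ^ (-(-1 * ((t + w : ℕ) : ℂ) * c2))
          * q ^ (-1 * t * (f - (c1 + s))) := by
      rw [← h.cpow_add, ← h.cpow_add]; congr 1; push_cast; ring
    simp only [polyJ]
    rw [hE, qPoch_add' (b1 + c1 + (s + t : ℕ)),
      show b1 + c1 + ((s + t : ℕ) : ℂ) = b1 + c1 + s + t by push_cast; ring,
      show b1 + c1 + (s : ℂ) + t + w = b1 + c1 + s + (t + w : ℕ) by push_cast; ring,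
      show b1 + c1 + (s : ℂ) - (c1 + s) = b1 by ring]
    ring

/-- The same sum over t as for `polyJ`, with the roles of both the numerator and the denominator
parameters exchanged. -/
lemma polyX_eq_polyY (h : QAdm q) :
    qDouble m n (polyX q b1 c1 b2 c2 d f m n) = qDouble m n (polyY q b1 c1 b2 c2 d f m n) := by
  refine qDouble_transform_right h (Or.inr rfl) (fun s _ => c1 + s) (fun _ _ => c2) (fun s _ => b1 + c1 + s) (fun _ _ => f)
      (fun s r => qRF q s * qRF q r * qPoch q c1 s * qPoch q b2 s * qPoch q (d - b2) r
      * qPoch q (b1 + c1 + s + n) r * q ^ (m * b2 - s * (d - b1))) ?_ ?_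
  · rintro s r hsr t w rfl
    have hE : q ^ (m * b2 - s * (d - b1) + t * (c2 - b1 - f - (t + w : ℕ) + 1))
        = q ^ (m * b2 - s * (d - b1))
          * q ^ (-1 * t * ((t : ℂ) + w + (b1 + c1 + s) + f - (c1 + s) - c2 - 1)) := by
      rw [← h.cpow_add]; congr 1; push_cast; ring
    simp only [polyX, qTerm]
    rw [hE, qPoch_add' (b1 + c1 + (s + t : ℕ)), qPoch_add c1,
      show b1 + c1 + ((s + t : ℕ) : ℂ) = b1 + c1 + s + t by push_cast; ring,
      show b1 + c1 + (s : ℂ) + t + w = b1 + c1 + s + (t + w : ℕ) by push_cast; ring]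
    ring
  · rintro s r hsr t w rfl
    have hE : q ^ (m * b2 + ((t + w : ℕ) : ℂ) * c1 + ((t + w : ℕ) : ℂ) * s - s * (d - b1)
          - t * (b1 + c1 + s - c2))
        = q ^ (m * b2 - s * (d - b1)) * q ^ (-(-1 * ((t + w : ℕ) : ℂ) * (c1 + s)))
          * q ^ (-1 * t * (b1 + c1 + s - c2)) := by
      rw [← h.cpow_add, ← h.cpow_add]; congr 1; push_cast; ring
    simp only [polyY]
    rw [hE, qPoch_add c1,
      show b1 + c1 + ((t + w : ℕ) : ℂ) + s = b1 + c1 + s + (t + w : ℕ) by ring,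
      show b1 + c1 + (s : ℂ) - (c1 + s) = b1 by ring]
    ring

/-- Here G is the 3φ2 side: (d-b2)_r and the tail of b1 are reflected into denominator parameters
1+b2-d-m and 1-b1-n-m+t, and transforming the sum over s gives Y. -/
lemma polyG_eq_polyY (h : QAdm q) :
    qDouble m n (polyG q b1 c1 b2 c2 d f m n) = qDouble m n (polyY q b1 c1 b2 c2 d f m n) := by
  refine qDouble_transform_left h (Or.inr rfl) (fun t _ => c1 + t) (fun _ _ => 1 - d - m)
      (fun t _ => 1 - b1 - n - m + t) (fun _ _ => 1 + b2 - d - m)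
      (fun t w => qRF q t * qRF q w * qPoch q c1 t * qPoch q (f - c2) t * qPoch q (f + t) w
        * qPoch q b1 w * q ^ (m * b2 + n * c1 - m * c1 - t * (b1 + c1 - c2 + m))) ?_ ?_
  · rintro t w htw s r rfl
    have hE : q ^ (((s + r : ℕ) : ℂ) * b2 + n * c1 - ((s + r : ℕ) : ℂ) * c1
          + s * (b1 + c1 - b2 + n) - t * (b1 + c1 - c2 + ((s + r : ℕ) : ℂ)))
        = q ^ (((s + r : ℕ) : ℂ) * b2 + n * c1 - ((s + r : ℕ) : ℂ) * c1
            - t * (b1 + c1 - c2 + ((s + r : ℕ) : ℂ)))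
          * q ^ (-1 * s * ((s : ℂ) + r + (1 - b1 - n - ((s + r : ℕ) : ℂ) + t)
            + (1 + b2 - d - ((s + r : ℕ) : ℂ)) - (c1 + t) - (1 - d - ((s + r : ℕ) : ℂ)) - 1)) := by
      rw [← h.cpow_add]; congr 1; push_cast; ring
    simp only [polyG, qTerm]
    rw [hE, qPoch_add' b1, qPoch_add' c1,
      qPoch_reflect (d - b2) (1 + b2 - d - ((s + r : ℕ) : ℂ) + s) r (by push_cast; ring),
      qPoch_reflect (b1 + w) (1 - b1 - n - ((s + r : ℕ) : ℂ) + t + s) r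
        (by rw [← htw]; push_cast; ring)]
    rcases neg_one_pow_eq_or ℂ r with hr | hr <;> rw [hr] <;> ring
  · rintro t w htw s r rfl
    have hE : q ^ (((s + r : ℕ) : ℂ) * b2 + n * c1 + n * s - s * (d - b1)
          - t * (b1 + c1 + s - c2))
        = q ^ (((s + r : ℕ) : ℂ) * b2 + n * c1 - ((s + r : ℕ) : ℂ) * c1
            - t * (b1 + c1 - c2 + ((s + r : ℕ) : ℂ)))
          * q ^ (-(-1 * ((s + r : ℕ) : ℂ) * (c1 + t)))
          * q ^ (-1 * s * (1 - b1 - n - ((s + r : ℕ) : ℂ) + t - (1 - d - ((s + r : ℕ) : ℂ)))) := by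
      rw [← h.cpow_add, ← h.cpow_add]; congr 1; push_cast; ring
    simp only [polyY]
    rw [hE, qPoch_add' c1,
      qPoch_reflect (d - b2) (1 + b2 - d - ((s + r : ℕ) : ℂ) + s) r (by push_cast; ring),
      qPoch_reflect (b1 + c1 + n + s) (1 - b1 - n - ((s + r : ℕ) : ℂ) + t - (c1 + t)) r
        (by push_cast; ring),
      show 1 + b2 - d - ((s + r : ℕ) : ℂ) - (1 - d - ((s + r : ℕ) : ℂ)) = b2 by ring]
    rcases neg_one_pow_eq_or ℂ r with hr | hr <;> rw [hr] <;> ring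

lemma polyG_eq_polyE (h : QAdm q) :
    qDouble m n (polyG q b1 c1 b2 c2 d f m n) = qDouble m n (polyE q b1 c1 b2 c2 d f m n) := by
  refine qDouble_transform_right h (Or.inl rfl) (fun _ _ => f - c2) (fun s _ => c1 + s)
      (fun _ _ => f) (fun s _ => 1 - b1 - m - n + s)
      (fun s r => (-1) ^ s * (-1) ^ n * qRF q s * qRF q r * qPoch q c1 s * qPoch q (1 - d - m) s
        * qPoch q (d - b2) r * qPoch q b1 r
        * q ^ (m * b2 + n * c1 - m * c1 + s * (b1 + c1 - b2 + n))) ?_ ?_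
  · rintro s r hsr t w rfl
    have hE : q ^ (m * b2 + ((t + w : ℕ) : ℂ) * c1 - m * c1
          + s * (b1 + c1 - b2 + ((t + w : ℕ) : ℂ)) - t * (b1 + c1 - c2 + m))
        = q ^ (m * b2 + ((t + w : ℕ) : ℂ) * c1 - m * c1
            + s * (b1 + c1 - b2 + ((t + w : ℕ) : ℂ)))
          * q ^ (1 * t * ((t : ℂ) + w + f + (1 - b1 - m - ((t + w : ℕ) : ℂ) + s) - (f - c2)
            - (c1 + s) - 1)) := by
      rw [← h.cpow_add]; congr 1; push_cast; ring
    simp only [polyG, qTerm]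
    rw [hE, qPoch_add b1, qPoch_add c1,
      qPoch_reflect (b1 + r) (1 - b1 - m - ((t + w : ℕ) : ℂ) + s + t) w
        (by rw [← hsr]; push_cast; ring), pow_add]
    rcases neg_one_pow_eq_or ℂ w with hw | hw <;> rcases neg_one_pow_eq_or ℂ t with ht | ht <;>
      rw [hw, ht] <;> ring
  · rintro s r hsr t w rfl
    have hE : q ^ (m * b2 + ((t + w : ℕ) : ℂ) * c1 - m * c1 - ((t + w : ℕ) : ℂ) * (f - c2)
          + s * (b1 + c1 - b2 + ((t + w : ℕ) : ℂ)) + t * (f - c1) - s * t)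
        = q ^ (m * b2 + ((t + w : ℕ) : ℂ) * c1 - m * c1
            + s * (b1 + c1 - b2 + ((t + w : ℕ) : ℂ)))
          * q ^ (-(1 * ((t + w : ℕ) : ℂ) * (f - c2)))
          * q ^ (1 * t * (f - (c1 + s))) := by
      rw [← h.cpow_add, ← h.cpow_add]; congr 1; push_cast; ring
    simp only [polyE]
    rw [hE, qPoch_add b1,
      qPoch_reflect (b1 + r) (1 - b1 - m - ((t + w : ℕ) : ℂ) + s + t) w
        (by rw [← hsr]; push_cast; ring), pow_add, pow_add,
      show 1 - b1 - m - ((t + w : ℕ) : ℂ) + s - (c1 + s)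
        = 1 - b1 - c1 - m - ((t + w : ℕ) : ℂ) by ring, sub_sub_cancel]
    rcases neg_one_pow_eq_or ℂ w with hw | hw <;> rw [hw] <;> ring

/-- The first transformation, in s with b1 as distinguished parameter, produces (c1)_{r+t}. It
splits as (c1)_r (c1+r)_t, which makes c1 + r a numerator parameter for the second one, in t. -/
lemma polyA_eq_polyF (h : QAdm q) :
    qDouble m n (polyA q b1 c1 b2 c2 d f m n) = qDouble m n (polyF q b1 c1 b2 c2 d f m n) := by
  trans qDouble m n fun s r t w =>
    (-1) ^ t * (qRF q s * qRF q r * qRF q t * qRF q w) * qPoch q b1 s * qPoch q (d - b2) s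
      * qPoch q (d + s) r * qPoch q c1 (r + t) * qPoch q c2 t * qPoch q (f + t) w
      * qPoch q (b1 + c1 + t + m) w
      * q ^ (m * b1 - s * (b1 + c1 + t - b2) + t * (c2 - b1 - f - n + 1))
  · refine qDouble_transform_left h (Or.inr rfl) (fun _ _ => b1) (fun _ _ => b2) (fun t _ => b1 + c1 + t) (fun _ _ => d)
      (fun t w => (-1) ^ t * qRF q t * qRF q w * qPoch q c1 t * qPoch q c2 t * qPoch q (f + t) w
        * qPoch q (b1 + c1 + t + m) w * q ^ (t * (c2 - b1 - f - n + 1))) ?_ ?_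
    · rintro t w htw s r rfl
      have hE : q ^ ((s : ℂ) * (b2 - c1 - d - (s + r : ℕ) + 1) + t * (c2 - b1 - f - n + 1)
            - s * t)
          = q ^ (t * (c2 - b1 - f - n + 1))
            * q ^ (-1 * s * ((s : ℂ) + r + (b1 + c1 + t) + d - b1 - b2 - 1)) := by
        rw [← h.cpow_add]; congr 1; push_cast; ring
      simp only [polyA, qTerm]
      rw [hE, qPoch_add (b1 + c1 + (s + t : ℕ)),
        show b1 + c1 + ((s + t : ℕ) : ℂ) = b1 + c1 + t + s by push_cast; ring,
        show b1 + c1 + (t : ℂ) + s + r = b1 + c1 + t + (s + r : ℕ) by push_cast; ring]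
      ring
    · rintro t w htw s r rfl
      have hE : q ^ (((s + r : ℕ) : ℂ) * b1 - s * (b1 + c1 + t - b2)
            + t * (c2 - b1 - f - n + 1))
          = q ^ (t * (c2 - b1 - f - n + 1)) * q ^ (-(-1 * ((s + r : ℕ) : ℂ) * b1))
            * q ^ (-1 * s * (b1 + c1 + t - b2)) := by
        rw [← h.cpow_add, ← h.cpow_add]; congr 1; push_cast; ring
      rw [hE, qPoch_add' c1, show b1 + c1 + (t : ℂ) - b1 = c1 + t by ring]
      ring
  · refine qDouble_transform_right h (Or.inr rfl) (fun _ _ => c2) (fun _ r => c1 + r) (fun _ _ => f) (fun _ _ => b1 + c1 + m)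
      (fun s r => qRF q s * qRF q r * qPoch q b1 s * qPoch q (d - b2) s * qPoch q (d + s) r * qPoch q c1 r
        * q ^ (m * b1 - s * (b1 + c1 - b2))) ?_ ?_
    · rintro s r hsr t w rfl
      have hE : q ^ (m * b1 - s * (b1 + c1 + t - b2) + t * (c2 - b1 - f - (t + w : ℕ) + 1))
          = q ^ (m * b1 - s * (b1 + c1 - b2))
            * q ^ (-1 * t * ((t : ℂ) + w + f + (b1 + c1 + m) - c2 - (c1 + r) - 1)) := by
        rw [← h.cpow_add, ← hsr]; congr 1; push_cast; ring
      simp only [qTerm]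
      rw [hE, qPoch_add c1, show b1 + c1 + (t : ℂ) + m = b1 + c1 + m + t by ring]
      ring
    · rintro s r hsr t w rfl
      have hE : q ^ (m * b1 + ((t + w : ℕ) : ℂ) * c2 - s * (b1 + c1 - b2) - t * (f - c1 - m)
            - s * t)
          = q ^ (m * b1 - s * (b1 + c1 - b2)) * q ^ (-(-1 * ((t + w : ℕ) : ℂ) * c2))
            * q ^ (-1 * t * (f - (c1 + r))) := by
        rw [← h.cpow_add, ← h.cpow_add, ← hsr]; congr 1; push_cast; ring
      simp only [polyF]
      rw [hE, qPoch_add b1,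
        show b1 + c1 + (m : ℂ) - (c1 + r) = b1 + s by rw [← hsr]; push_cast; ring]
      ring

end DenominatorFree

/-! ### From the series with quotients to the denominator-free double sums. -/

@[simp] lemma qPochs_nil (n : ℕ) : qPochs q [] n = 1 := by simp [qPochs]

@[simp] lemma qPochs_cons (a : ℂ) (l : List ℂ) (n : ℕ) :
    qPochs q (a :: l) n = qPoch q a n * qPochs q l n := by simp [qPochs]

/-- The general term of a `q`-Kampé de Fériet series, with `q ^ x` for all powers of `q`. -/
def qKdFTerm (q : ℂ) (a c b d b' d' : List ℂ) (s t : ℕ) (x : ℂ) : ℂ :=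
  qPochs q a (s + t) / qPochs q c (s + t)
    * ((qPochs q b s * qPochs q b' t) / (qPochs q d s * qPochs q d' t))
    * (qRF q s * qRF q t)
    * q ^ x

/-- Z is the global factor that clears denominators; Z' is what remains of it after division by the
denominators of one term. -/
lemma qKdFTerm_mul {a c b d b' d' : List ℂ} {s t : ℕ} {x Z : ℂ} (Z' : ℂ)
    (hc : qPochs q c (s + t) ≠ 0) (hd : qPochs q d s ≠ 0) (hd' : qPochs q d' t ≠ 0)
    (hZ : Z = qPochs q c (s + t) * (qPochs q d s * qPochs q d' t) * Z') :
    qKdFTerm q a c b d b' d' s t x * Z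
      = qPochs q a (s + t) * (qPochs q b s * qPochs q b' t) * (qRF q s * qRF q t) * q ^ x
        * Z' := by
  unfold qKdFTerm
  subst hZ
  generalize q ^ x = E
  field_simp

/-- Only integer powers of q^u and q^v occur, so no branch condition arises and all powers of q
combine into one exponent. -/
lemma qKdF_eq_tsum (h : QAdm q) {ε δ κ : ℤ} {a c b d b' d' : List ℂ} {u v : ℂ}
    (hδ : 1 - 2 * (if a.length = c.length then (1 : ℤ) else 0) = δ)
    (hκ : (a.length : ℤ) - c.length = κ) {x : ℕ → ℕ → ℂ}
    (hx : ∀ s t : ℕ, (ε : ℂ) * s * u + ε * δ * t * v + ε * κ * s * t = x s t) :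
    qKdF ε a c b d b' d' (q ^ u) (q ^ v) q
      = ∑' p : ℕ × ℕ, qKdFTerm q a c b d b' d' p.1 p.2 (x p.1 p.2) := by
  unfold qKdF qKdFTerm
  refine tsum_congr fun p => ?_
  rw [hδ, hκ, ← Complex.cpow_mul_int, ← Complex.cpow_mul_int, ← Complex.cpow_intCast q,
    ← hx, h.cpow_add, h.cpow_add, qRF, qRF, div_eq_mul_inv _ (qFact q p.1 * qFact q p.2),
    mul_inv]
  have e1 : u * ((ε * (p.1 : ℤ) : ℤ) : ℂ) = (ε : ℂ) * p.1 * u := by push_cast; ring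
  have e2 : v * ((ε * δ * (p.2 : ℤ) : ℤ) : ℂ) = (ε : ℂ) * δ * p.2 * v := by push_cast; ring
  have e3 : ((ε * κ * (p.1 : ℤ) * (p.2 : ℤ) : ℤ) : ℂ) = (ε : ℂ) * κ * p.1 * p.2 := by
    push_cast; ring
  rw [e1, e2, e3]
  ring

lemma tsum_eq_sum_antidiagonal_mul {m n : ℕ} {F : ℕ → ℕ → ℂ}
    (hs : ∀ s t, m < s → F s t = 0) (ht : ∀ s t, n < t → F s t = 0) :
    ∑' p : ℕ × ℕ, F p.1 p.2 = ∑ p ∈ antidiagonal m, ∑ u ∈ antidiagonal n, F p.1 u.1 := by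
  rw [tsum_eq_sum (s := range (m + 1) ×ˢ range (n + 1))]
  · rw [sum_product]
    rw [Nat.sum_antidiagonal_eq_sum_range_succ_mk]
    refine sum_congr rfl fun s _ => ?_
    rw [Nat.sum_antidiagonal_eq_sum_range_succ_mk]
  · rintro ⟨s, t⟩ hp
    simp only [mem_product, mem_range, not_and_or, not_lt] at hp
    rcases hp with hp | hp
    · exact hs _ _ (by omega)
    · exact ht _ _ (by omega)

lemma qKdF_eq_qDouble (h : QAdm q) {ε : ℤ} (δ κ : ℤ) {a c b d b' d' : List ℂ} {u v : ℂ}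
    (m n : ℕ) (x : ℕ → ℕ → ℂ)
    (hδ : 1 - 2 * (if a.length = c.length then (1 : ℤ) else 0) = δ)
    (hκ : (a.length : ℤ) - c.length = κ)
    (hx : ∀ s t : ℕ, (ε : ℂ) * s * u + ε * δ * t * v + ε * κ * s * t = x s t)
    (hs : ∀ s, m < s → qPochs q b s = 0) (ht : ∀ t, n < t → qPochs q b' t = 0) :
    qKdF ε a c b d b' d' (q ^ u) (q ^ v) q
      = qDouble m n fun s _ t _ => qKdFTerm q a c b d b' d' s t (x s t) := by
  rw [qKdF_eq_tsum h hδ hκ hx, qDouble]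
  refine tsum_eq_sum_antidiagonal_mul (F := fun s t => qKdFTerm q a c b d b' d' s t (x s t)) ?_ ?_
  · intro s t hst; simp [qKdFTerm, hs s hst]
  · intro s t hst; simp [qKdFTerm, ht t hst]

lemma qPoch_neg_nat (h : QAdm q) {m s r : ℕ} (hm : s + r = m) :
    qPoch q (-(m : ℂ)) s = (-1) ^ s * qFact q m * qRF q r :=
  qPoch_neg_eq_fact h (y := m) (by push_cast; ring) (by omega) (by omega)

lemma qPoch_split_ne {x : ℂ} {s r m : ℕ} (hm : s + r = m) (hx : qPoch q x m ≠ 0) :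
    qPoch q x m = qPoch q x s * qPoch q (x + s) r ∧ qPoch q x s ≠ 0 ∧
      qPoch q (x + s) r ≠ 0 := by
  subst hm
  rw [qPoch_add] at hx ⊢
  exact ⟨rfl, left_ne_zero_of_mul hx, right_ne_zero_of_mul hx⟩

section Conversion

variable {b1 c1 b2 c2 d f : ℂ} {m n : ℕ}

/-- The factorials [m]! and [n]! come from (-m)_s = (-1)^s [m]!/[r]! and its analogue in t; the
symbols multiplied in on the left leave the tails of `polyA`. -/
lemma kdfA_eq (h : QAdm q) (h0 : qPoch q (b1 + c1) (m + n) ≠ 0) (hd : qPoch q d m ≠ 0)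
    (hf : qPoch q f n ≠ 0) :
    kdfA q b1 c1 b2 c2 d f m n * (qPoch q (b1 + c1) (m + n) * qPoch q d m * qPoch q f n)
      = qFact q m * qFact q n * qDouble m n (polyA q b1 c1 b2 c2 d f m n) := by
  unfold kdfA
  rw [qKdF_eq_qDouble h 1 (-1) m n
    (fun s t => s * (b2 - c1 - d - m + 1) + t * (c2 - b1 - f - n + 1) - s * t)
    (by simp) (by simp) (by intro s t; push_cast; ring)
    (by intro s hs; simp [qPoch_neg_nat_eq_zero hs])
    (by intro t ht; simp [qPoch_neg_nat_eq_zero ht])]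
  refine qDouble_mul_eq _ _ fun s r t w hs ht => ?_
  obtain ⟨e1, n1, -⟩ := qPoch_split_ne (s := s + t) (r := r + w) (by omega) h0
  obtain ⟨e2, n2, -⟩ := qPoch_split_ne hs hd
  obtain ⟨e3, n3, -⟩ := qPoch_split_ne ht hf
  rw [qKdFTerm_mul (qPoch q (b1 + c1 + (s + t : ℕ)) (r + w) * qPoch q (d + s) r
    * qPoch q (f + t) w) (by simpa using n1) (by simpa using n2) (by simpa using n3)
    (by simp only [qPochs_cons, qPochs_nil]; rw [e1, e2, e3]; ring)]
  simp only [qPochs_cons, qPochs_nil, polyA]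
  rw [qPoch_neg_nat h hs, qPoch_neg_nat h ht]
  ring

/-- Φ_B is Φ_A summed backwards in both indices, whence the initial swap of s with r and of t with
w. Its prefactor is the last term of Φ_A up to normalisation, and this is why the four symbols in it
must not vanish. -/
lemma kdfB_eq (h : QAdm q) (h0 : qPoch q (b1 + c1) (m + n) ≠ 0) (hd : qPoch q d m ≠ 0)
    (hf : qPoch q f n ≠ 0) (hb1 : qPoch q b1 m ≠ 0) (hb2 : qPoch q b2 m ≠ 0)
    (hc1 : qPoch q c1 n ≠ 0) (hc2 : qPoch q c2 n ≠ 0) :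
    kdfB q b1 c1 b2 c2 d f m n * (qPoch q (b1 + c1) (m + n) * qPoch q d m * qPoch q f n)
      = qFact q m * qFact q n * qDouble m n (polyA q b1 c1 b2 c2 d f m n) := by
  rw [← qDouble_swap]
  have : kdfB q b1 c1 b2 c2 d f m n * (qPoch q (b1 + c1) (m + n) * qPoch q d m * qPoch q f n)
      = qKdF (-1) [1 - b1 - c1 - m - n] [] [-m - d + 1, -m] [1 - b1 - m, 1 - b2 - m]
        [-f - n + 1, -n] [1 - c1 - n, 1 - c2 - n]
        (q ^ (b2 - c1 - d - m - n + 1)) (q ^ (c2 - b1 - f - m - n + 1)) q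
      * ((-1) ^ (m + n) * q ^ (m * (b2 - c1 - d - m + 1) + n * (c2 - b1 - f - m - n + 1))
        * (qPoch q b1 m * qPoch q b2 m * qPoch q c1 n * qPoch q c2 n)) := by
    unfold kdfB
    simp only [mul_assoc]
    congr 3
    field_simp
  rw [this, qKdF_eq_qDouble h 1 1 m n
    (fun s t => -s * (b2 - c1 - d - m - n + 1) - t * (c2 - b1 - f - m - n + 1) - s * t)
    (by simp) (by simp) (by intro s t; push_cast; ring)
    (by intro s hs; simp [qPoch_neg_nat_eq_zero hs])
    (by intro t ht; simp [qPoch_neg_nat_eq_zero ht])]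
  refine qDouble_mul_eq _ _ fun s r t w hs ht => ?_
  obtain ⟨e1, -, n1⟩ := qPoch_split_ne (s := r) (r := s) (by omega) hb1
  obtain ⟨e2, -, n2⟩ := qPoch_split_ne (s := r) (r := s) (by omega) hb2
  obtain ⟨e3, -, n3⟩ := qPoch_split_ne (s := w) (r := t) (by omega) hc1
  obtain ⟨e4, -, n4⟩ := qPoch_split_ne (s := w) (r := t) (by omega) hc2
  have hm : (m : ℂ) = s + r := by exact_mod_cast hs.symm
  have hn : (n : ℂ) = t + w := by exact_mod_cast ht.symm
  have r1 := qPoch_reflect (q := q) (b1 + r) (1 - b1 - m) s (by rw [hm]; ring)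
  have r2 := qPoch_reflect (q := q) (b2 + r) (1 - b2 - m) s (by rw [hm]; ring)
  have r3 := qPoch_reflect (q := q) (c1 + w) (1 - c1 - n) t (by rw [hn]; ring)
  have r4 := qPoch_reflect (q := q) (c2 + w) (1 - c2 - n) t (by rw [hn]; ring)
  have r5 := qPoch_reflect (q := q) (d + r) (-m - d + 1) s (by rw [hm]; ring)
  have r6 := qPoch_reflect (q := q) (f + w) (-f - n + 1) t (by rw [hn]; ring)
  have r7 := qPoch_reflect (q := q) (b1 + c1 + (r + w : ℕ)) (1 - b1 - c1 - m - n) (s + t)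
    (by rw [hm, hn]; push_cast; ring)
  rw [qKdFTerm_mul ((-1) ^ (m + n)
      * q ^ (m * (b2 - c1 - d - m + 1) + n * (c2 - b1 - f - m - n + 1))
      * (qPoch q b1 r * qPoch q b2 r * qPoch q c1 w * qPoch q c2 w)) (by simp)
    (by simpa [r1, r2] using ⟨n1, n2⟩) (by simpa [r3, r4] using ⟨n3, n4⟩)
    (by
      simp only [qPochs_cons, qPochs_nil]
      rw [e1, e2, e3, e4, r1, r2, r3, r4]
      rcases neg_one_pow_eq_or ℂ s with hw | hw <;> rcases neg_one_pow_eq_or ℂ t with hz | hz <;>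
      rw [hw, hz] <;> ring)]
  simp only [qPochs_cons, qPochs_nil, polyA]
  have hE : q ^ (r * (b2 - c1 - d - m + 1) + w * (c2 - b1 - f - n + 1) - r * w)
      = q ^ (-s * (b2 - c1 - d - m - n + 1) - t * (c2 - b1 - f - m - n + 1) - s * t)
        * q ^ (m * (b2 - c1 - d - m + 1) + n * (c2 - b1 - f - m - n + 1)) := by
    rw [← h.cpow_add, hm, hn]; congr 1; ring
  rw [hE, qPoch_neg_nat h hs, qPoch_neg_nat h ht, r5, r6, r7, ← hs, ← ht]
  simp only [pow_add]
  rcases neg_one_pow_eq_or ℂ s with hw | hw <;> rcases neg_one_pow_eq_or ℂ t with hz | hz <;>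
    rw [hw, hz] <;> ring

lemma kdfF_eq (h : QAdm q) (h0 : qPoch q (b1 + c1) (m + n) ≠ 0) (hd : qPoch q d m ≠ 0)
    (hf : qPoch q f n ≠ 0) (hc1 : qPoch q c1 m ≠ 0) (hfc : qPoch q (f - c2) n ≠ 0) :
    kdfF q b1 c1 b2 c2 d f m n * (qPoch q (b1 + c1) (m + n) * qPoch q d m * qPoch q f n)
      = qFact q m * qFact q n * qDouble m n (polyF q b1 c1 b2 c2 d f m n) := by
  obtain ⟨e0, n0, n0'⟩ := qPoch_split_ne (s := m) (r := n) rfl h0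
  have : kdfF q b1 c1 b2 c2 d f m n * (qPoch q (b1 + c1) (m + n) * qPoch q d m * qPoch q f n)
      = qKdF (-1) [b1] [] [d - b2, -m] [1 - c1 - m, d] [c2, -n] [c2 - f - n + 1, b1 + c1 + m]
        (q ^ (b1 + c1 - b2)) (q ^ (f - c1 - m)) q
      * (q ^ (m * b1 + n * c2) * (qPoch q c1 m * qPoch q (f - c2) n * qPoch q (b1 + c1 + m) n
          * qPoch q d m)) := by
    unfold kdfF
    rw [e0, mul_assoc, mul_assoc]
    congr 2
    field_simp
  rw [this, qKdF_eq_qDouble h 1 1 m n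
    (fun s t => -s * (b1 + c1 - b2) - t * (f - c1 - m) - s * t)
    (by simp) (by simp) (by intro s t; push_cast; ring)
    (by intro s hs; simp [qPoch_neg_nat_eq_zero hs])
    (by intro t ht; simp [qPoch_neg_nat_eq_zero ht])]
  refine qDouble_mul_eq _ _ fun s r t w hs ht => ?_
  obtain ⟨e1, -, n1⟩ := qPoch_split_ne (s := r) (r := s) (by omega) hc1
  obtain ⟨e2, -, n2⟩ := qPoch_split_ne (s := w) (r := t) (by omega) hfc
  obtain ⟨e3, n3, -⟩ := qPoch_split_ne ht n0'
  obtain ⟨e4, n4, -⟩ := qPoch_split_ne hs hd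
  have hm : (m : ℂ) = s + r := by exact_mod_cast hs.symm
  have hn : (n : ℂ) = t + w := by exact_mod_cast ht.symm
  have r1 := qPoch_reflect (q := q) (c1 + r) (1 - c1 - m) s (by rw [hm]; ring)
  have r2 := qPoch_reflect (q := q) (f - c2 + w) (c2 - f - n + 1) t (by rw [hn]; ring)
  rw [qKdFTerm_mul ((-1) ^ s * (-1) ^ t * q ^ (m * b1 + n * c2)
      * (qPoch q c1 r * qPoch q (f - c2) w * qPoch q (b1 + c1 + m + t) w * qPoch q (d + s) r))
    (by simp) (by simpa [r1] using ⟨n1, n4⟩) (by simpa [r2] using ⟨n2, n3⟩)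
    (by
      simp only [qPochs_cons, qPochs_nil]
      rw [e1, e2, e3, e4, r1, r2]
      rcases neg_one_pow_eq_or ℂ s with hw | hw <;> rcases neg_one_pow_eq_or ℂ t with hz | hz <;>
      rw [hw, hz] <;> ring)]
  simp only [qPochs_cons, qPochs_nil, polyF]
  have hE : q ^ (m * b1 + n * c2 - s * (b1 + c1 - b2) - t * (f - c1 - m) - s * t)
      = q ^ (-s * (b1 + c1 - b2) - t * (f - c1 - m) - s * t) * q ^ (m * b1 + n * c2) := by
    rw [← h.cpow_add]; congr 1; ring
  rw [hE, qPoch_neg_nat h hs, qPoch_neg_nat h ht]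
  rcases neg_one_pow_eq_or ℂ s with hw | hw <;> rcases neg_one_pow_eq_or ℂ t with hz | hz <;>
    rw [hw, hz] <;> ring

lemma kdfJ_eq (h : QAdm q) (h0 : qPoch q (b1 + c1) (m + n) ≠ 0) (hd : qPoch q d m ≠ 0)
    (hf : qPoch q f n ≠ 0) (hdb : qPoch q (d - b2) m ≠ 0) (hfc : qPoch q (f - c2) n ≠ 0) :
    kdfJ q b1 c1 b2 c2 d f m n * (qPoch q (b1 + c1) (m + n) * qPoch q d m * qPoch q f n)
      = qFact q m * qFact q n * qDouble m n (polyJ q b1 c1 b2 c2 d f m n) := by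
  -- In Φ_J the first summation index is bounded by n and the second by m.
  have hsw : qDouble m n (polyJ q b1 c1 b2 c2 d f m n)
      = qDouble n m fun t w s r => polyJ q b1 c1 b2 c2 d f m n s r t w := sum_comm
  have : kdfJ q b1 c1 b2 c2 d f m n * (qPoch q (b1 + c1) (m + n) * qPoch q d m * qPoch q f n)
      = qKdF (-1) [] [b1 + c1] [b1, c2, -n] [c2 - f - n + 1] [c1, b2, -m] [b2 - d - m + 1]
        (q ^ (f - c1)) (q ^ (d - b1)) q
      * (q ^ (m * b2 + n * c2) * (qPoch q (d - b2) m * qPoch q (f - c2) n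
        * qPoch q (b1 + c1) (m + n))) := by
    unfold kdfJ
    rw [qPoch_reflect (f - c2) (c2 - f - n + 1) n (by ring),
      qPoch_reflect f (-n - f + 1) n (by ring), mul_assoc, mul_assoc]
    congr 2
    have := neg_one_pow_ne_zero (R := ℂ) n
    field_simp
  rw [this, hsw, qKdF_eq_qDouble h 1 (-1) n m
    (fun t s => -t * (f - c1) - s * (d - b1) + t * s)
    (by simp) (by simp) (by intro s t; push_cast; ring)
    (by intro s hs; simp [qPoch_neg_nat_eq_zero hs])
    (by intro t ht; simp [qPoch_neg_nat_eq_zero ht])]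
  refine qDouble_mul_eq _ _ fun t w s r ht hs => ?_
  obtain ⟨e1, -, n1⟩ := qPoch_split_ne (s := r) (r := s) (by omega) hdb
  obtain ⟨e2, -, n2⟩ := qPoch_split_ne (s := w) (r := t) (by omega) hfc
  obtain ⟨e3, n3, -⟩ := qPoch_split_ne (s := t + s) (r := r + w) (by omega) h0
  have hm : (m : ℂ) = s + r := by exact_mod_cast hs.symm
  have hn : (n : ℂ) = t + w := by exact_mod_cast ht.symm
  have r1 := qPoch_reflect (q := q) (d - b2 + r) (b2 - d - m + 1) s (by rw [hm]; ring)
  have r2 := qPoch_reflect (q := q) (f - c2 + w) (c2 - f - n + 1) t (by rw [hn]; ring)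
  rw [qKdFTerm_mul ((-1) ^ s * (-1) ^ t * q ^ (m * b2 + n * c2)
      * (qPoch q (d - b2) r * qPoch q (f - c2) w * qPoch q (b1 + c1 + (t + s : ℕ)) (r + w)))
    (by simpa using n3) (by simpa [r2] using n2) (by simpa [r1] using n1)
    (by
      simp only [qPochs_cons, qPochs_nil]
      rw [e1, e2, e3, r1, r2]
      rcases neg_one_pow_eq_or ℂ s with hw | hw <;> rcases neg_one_pow_eq_or ℂ t with hz | hz <;>
      rw [hw, hz] <;> ring)]
  simp only [qPochs_cons, qPochs_nil, polyJ]
  have hE : q ^ (m * b2 + n * c2 - s * (d - b1) - t * (f - c1) + s * t)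
      = q ^ (-t * (f - c1) - s * (d - b1) + t * s) * q ^ (m * b2 + n * c2) := by
    rw [← h.cpow_add]; congr 1; ring
  rw [hE, qPoch_neg_nat h hs, qPoch_neg_nat h ht, add_comm t s]
  rcases neg_one_pow_eq_or ℂ s with hw | hw <;> rcases neg_one_pow_eq_or ℂ t with hz | hz <;>
    rw [hw, hz] <;> ring

/-- After reflection this is the regrouping (x-j)_N (x-j+N)_j = (x-j)_j (x)_N, or its mirror image
for positive k. The hypotheses h1 and h2 are exactly the nonvanishing of the denominator in the two
readings of the ratio. -/
lemma qPochRatio_mul_qPoch {x α β : ℂ} {k : ℤ} {N : ℕ} (hα : α = 1 - x - N) (hβ : β = 1 - x)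
    (h1 : ∀ j : ℕ, k = -j → qPoch q (1 - x) j ≠ 0)
    (h2 : ∀ j : ℕ, k = j → qPoch q (1 - x - N - j) j ≠ 0) :
    qPochRatio q α β (-k) * qPoch q (x + k) N = qPoch q x N := by
  subst hα hβ
  unfold qPochRatio
  split_ifs with hk
  · obtain ⟨j, hj⟩ := Int.eq_ofNat_of_zero_le hk
    obtain rfl : k = -j := by omega
    have n1 := h1 j rfl
    rw [neg_neg, Int.toNat_natCast]
    have r1 := qPoch_reflect (q := q) (x - j) (1 - x) j (by ring)
    have r2 := qPoch_reflect (q := q) (x - j + N) (1 - x - N) j (by ring)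
    rw [r1] at n1
    have n1' := right_ne_zero_of_mul n1
    have := qPoch_swap (q := q) (x - j) N j
    rw [sub_add_cancel] at this
    rw [r1, r2, Int.cast_neg, Int.cast_natCast, ← sub_eq_add_neg, div_mul_eq_mul_div,
      div_eq_iff n1]
    linear_combination (-1) ^ j * this
  · obtain ⟨j, rfl⟩ := Int.eq_ofNat_of_zero_le (show 0 ≤ k by omega)
    have n1 := h2 j rfl
    have r1 := qPoch_reflect (q := q) x (1 - x - j) j (by ring)
    have r2 := qPoch_reflect (q := q) (x + N) (1 - x - N - j) j (by ring)
    have := qPoch_swap (q := q) x j N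
    rw [r2] at n1
    rw [neg_neg, Int.toNat_natCast, Int.cast_neg, Int.cast_natCast, ← sub_eq_add_neg,
      ← sub_eq_add_neg, r1, r2, div_mul_eq_mul_div, div_eq_iff n1]
    linear_combination (-1) ^ j * this

lemma kdfG_eq (h : QAdm q) {k : ℤ} (h0 : qPoch q (b1 + k) (m + n) ≠ 0) (hd : qPoch q d m ≠ 0)
    (hf : qPoch q f n ≠ 0) (hb1 : qPoch q b1 (m + n) ≠ 0) (hdb : qPoch q (d - b2) m ≠ 0)
    (h1 : ∀ j : ℕ, k = -j → qPoch q (1 - b1) j ≠ 0)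
    (h2 : ∀ j : ℕ, k = j → qPoch q (1 - b1 - m - n - j) j ≠ 0) :
    kdfG q b1 k b2 c2 d f m n * (qPoch q (b1 + k) (m + n) * qPoch q d m * qPoch q f n)
      = qFact q m * qFact q n * qDouble m n (polyG q b1 k b2 c2 d f m n) := by
  -- The ratio in the prefactor converts (b1+k)_{m+n} into (b1)_{m+n}, which is what clears the
  -- denominator (1-b1-m-n)_{s+t}.
  have hR := qPochRatio_mul_qPoch (q := q) (x := b1) (α := -b1 - m - n + 1) (β := -b1 + 1)
    (k := k) (N := m + n) (by push_cast; ring) (by ring) h1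
    (by intro j hj; convert h2 j hj using 2; push_cast; ring)
  have : kdfG q b1 k b2 c2 d f m n * (qPoch q (b1 + k) (m + n) * qPoch q d m * qPoch q f n)
      = qKdF 1 [(k : ℂ)] [1 - b1 - m - n] [1 - d - m, -m] [b2 - d - m + 1] [f - c2, -n] [f]
        (q ^ (b1 + k - b2 + n)) (q ^ (b1 + k - c2 + m)) q
      * (q ^ (m * (b2 - k) + k * n) * (qPoch q (d - b2) m * qPoch q f n
        * qPoch q b1 (m + n))) := by
    unfold kdfG
    rw [← hR, mul_assoc, mul_assoc, mul_assoc]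
    congr 2
    field_simp
  rw [this, qKdF_eq_qDouble h (-1) 0 m n
    (fun s t => s * (b1 + k - b2 + n) - t * (b1 + k - c2 + m))
    (by simp) (by simp) (by intro s t; push_cast; ring)
    (by intro s hs; simp [qPoch_neg_nat_eq_zero hs])
    (by intro t ht; simp [qPoch_neg_nat_eq_zero ht])]
  refine qDouble_mul_eq _ _ fun s r t w hs ht => ?_
  obtain ⟨e1, -, n1⟩ := qPoch_split_ne (s := r) (r := s) (by omega) hdb
  obtain ⟨e2, n2, -⟩ := qPoch_split_ne ht hf
  obtain ⟨e3, -, n3⟩ := qPoch_split_ne (s := r + w) (r := s + t) (by omega) hb1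
  have hm : (m : ℂ) = s + r := by exact_mod_cast hs.symm
  have hn : (n : ℂ) = t + w := by exact_mod_cast ht.symm
  have r1 := qPoch_reflect (q := q) (d - b2 + r) (b2 - d - m + 1) s (by rw [hm]; ring)
  have r2 := qPoch_reflect (q := q) (b1 + (r + w : ℕ)) (1 - b1 - m - n) (s + t)
    (by rw [hm, hn]; push_cast; ring)
  rw [qKdFTerm_mul ((-1) ^ s * (-1) ^ (s + t) * q ^ (m * (b2 - k) + k * n)
      * (qPoch q (d - b2) r * qPoch q (f + t) w * qPoch q b1 (r + w)))
    (by simpa [r2] using n3) (by simpa [r1] using n1) (by simpa using n2)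
    (by
      simp only [qPochs_cons, qPochs_nil]
      rw [e1, e2, e3, r1, r2, pow_add]
      rcases neg_one_pow_eq_or ℂ s with hw | hw <;> rcases neg_one_pow_eq_or ℂ t with hz | hz <;>
      rw [hw, hz] <;> ring)]
  simp only [qPochs_cons, qPochs_nil, polyG]
  have hE : q ^ (m * b2 + n * k - m * k + s * (b1 + k - b2 + n) - t * (b1 + k - c2 + m))
      = q ^ (s * (b1 + k - b2 + n) - t * (b1 + k - c2 + m)) * q ^ (m * (b2 - k) + k * n) := by
    rw [← h.cpow_add]; congr 1; ring
  rw [hE, qPoch_neg_nat h hs, qPoch_neg_nat h ht, pow_add]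
  rcases neg_one_pow_eq_or ℂ s with hw | hw <;> rcases neg_one_pow_eq_or ℂ t with hz | hz <;>
    rw [hw, hz] <;> ring

lemma kdfE_eq (h : QAdm q) {k : ℤ} (h0 : qPoch q (b1 + k) (m + n) ≠ 0) (hd : qPoch q d m ≠ 0)
    (hf : qPoch q f n ≠ 0) (hb1 : qPoch q b1 (m + n) ≠ 0) (hdb : qPoch q (d - b2) m ≠ 0)
    (h1 : ∀ j : ℕ, k = -j → qPoch q (1 - b1) j ≠ 0)
    (h2 : ∀ j : ℕ, k = j → qPoch q (1 - b1 - m - n - j) j ≠ 0) (hc2 : qPoch q c2 n ≠ 0) :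
    kdfE q b1 k b2 c2 d f m n * (qPoch q (b1 + k) (m + n) * qPoch q d m * qPoch q f n)
      = qFact q m * qFact q n * qDouble m n (polyE q b1 k b2 c2 d f m n) := by
  have hR := qPochRatio_mul_qPoch (q := q) (x := b1) (α := 1 - b1 - m - n) (β := -b1 + 1)
    (k := k) (N := m + n) (by push_cast; ring) (by ring) h1
    (by intro j hj; convert h2 j hj using 2; push_cast; ring)
  have : kdfE q b1 k b2 c2 d f m n * (qPoch q (b1 + k) (m + n) * qPoch q d m * qPoch q f n)
      = qKdF 1 [] [1 - b1 - m - n] [(k : ℂ), 1 - d - m, -m] [b2 - d - m + 1]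
        [f - c2, 1 - b1 - k - m - n, -n] [1 - c2 - n]
        (q ^ (b1 + k - b2 + n)) (q ^ (f - k)) q
      * (q ^ (m * (b2 - k) + n * (k + c2 - f)) * (qPoch q (d - b2) m * qPoch q c2 n
        * qPoch q b1 (m + n))) := by
    unfold kdfE
    rw [← hR, mul_assoc, mul_assoc, mul_assoc]
    congr 2
    field_simp
  rw [this, qKdF_eq_qDouble h 1 (-1) m n
    (fun s t => s * (b1 + k - b2 + n) + t * (f - k) - s * t)
    (by simp) (by simp) (by intro s t; push_cast; ring)
    (by intro s hs; simp [qPoch_neg_nat_eq_zero hs])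
    (by intro t ht; simp [qPoch_neg_nat_eq_zero ht])]
  refine qDouble_mul_eq _ _ fun s r t w hs ht => ?_
  obtain ⟨e1, -, n1⟩ := qPoch_split_ne (s := r) (r := s) (by omega) hdb
  obtain ⟨e2, -, n2⟩ := qPoch_split_ne (s := w) (r := t) (by omega) hc2
  obtain ⟨e3, -, n3⟩ := qPoch_split_ne (s := r + w) (r := s + t) (by omega) hb1
  have hm : (m : ℂ) = s + r := by exact_mod_cast hs.symm
  have hn : (n : ℂ) = t + w := by exact_mod_cast ht.symm
  have r1 := qPoch_reflect (q := q) (d - b2 + r) (b2 - d - m + 1) s (by rw [hm]; ring)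
  have r2 := qPoch_reflect (q := q) (b1 + (r + w : ℕ)) (1 - b1 - m - n) (s + t)
    (by rw [hm, hn]; push_cast; ring)
  have r3 := qPoch_reflect (q := q) (c2 + w) (1 - c2 - n) t (by rw [hn]; ring)
  rw [qKdFTerm_mul ((-1) ^ s * (-1) ^ t * (-1) ^ (s + t) * q ^ (m * (b2 - k) + n * (k + c2 - f))
      * (qPoch q (d - b2) r * qPoch q c2 w * qPoch q b1 (r + w)))
    (by simpa [r2] using n3) (by simpa [r1] using n1) (by simpa [r3] using n2)
    (by
      simp only [qPochs_cons, qPochs_nil]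
      rw [e1, e2, e3, r1, r2, r3, pow_add]
      rcases neg_one_pow_eq_or ℂ s with hw | hw <;> rcases neg_one_pow_eq_or ℂ t with hz | hz <;>
      rw [hw, hz] <;> ring)]
  simp only [qPochs_cons, qPochs_nil, polyE]
  have hE : q ^ (m * b2 + n * k - m * k - n * (f - c2) + s * (b1 + k - b2 + n) + t * (f - k)
        - s * t)
      = q ^ (s * (b1 + k - b2 + n) + t * (f - k) - s * t)
        * q ^ (m * (b2 - k) + n * (k + c2 - f)) := by
    rw [← h.cpow_add]; congr 1; ring
  rw [hE, qPoch_neg_nat h hs, qPoch_neg_nat h ht, pow_add]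
  rcases neg_one_pow_eq_or ℂ s with hw | hw <;> rcases neg_one_pow_eq_or ℂ t with hz | hz <;>
    rw [hw, hz] <;> ring

lemma kdfA_comm (h : QAdm q) (h0 : qPoch q (b1 + c1) (m + n) ≠ 0) (hd : qPoch q d m ≠ 0)
    (hf : qPoch q f n ≠ 0) :
    kdfA q b1 c1 b2 c2 d f m n = kdfA q c1 b1 c2 b2 f d n m := by
  have h0' : qPoch q (c1 + b1) (n + m) ≠ 0 := by rwa [add_comm c1, add_comm n]
  have e1 := kdfA_eq (b2 := b2) (c2 := c2) h h0 hd hf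
  have e2 := kdfA_eq (b2 := c2) (c2 := b2) h h0' hf hd
  have hsw : qDouble n m (polyA q c1 b1 c2 b2 f d n m)
      = qDouble m n (polyA q b1 c1 b2 c2 d f m n) := by
    unfold qDouble
    rw [sum_comm]
    refine sum_congr rfl fun p _ => sum_congr rfl fun u _ => ?_
    simp only [polyA]
    rw [add_comm u.1 p.1, add_comm u.2 p.2, add_comm c1 b1]
    rw [show (u.1 : ℂ) * (c2 - b1 - f - n + 1) + p.1 * (b2 - c1 - d - m + 1) - u.1 * p.1
      = p.1 * (b2 - c1 - d - m + 1) + u.1 * (c2 - b1 - f - n + 1) - p.1 * u.1 by ring]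
    ring
  rw [hsw, add_comm c1, add_comm n] at e2
  apply mul_right_cancel₀ (mul_ne_zero (mul_ne_zero h0 hd) hf)
  rw [e1]
  linear_combination -e2

lemma kdfA_eq_of_poly (h0 : qPoch q (b1 + c1) (m + n) ≠ 0) (hd : qPoch q d m ≠ 0)
    (hf : qPoch q f n ≠ 0) {x y K : ℂ}
    (e1 : x * (qPoch q (b1 + c1) (m + n) * qPoch q d m * qPoch q f n) = K)
    (e2 : y * (qPoch q (b1 + c1) (m + n) * qPoch q d m * qPoch q f n) = K) : x = y :=
  mul_right_cancel₀ (mul_ne_zero (mul_ne_zero h0 hd) hf) (e1.trans e2.symm)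

/-- In `polyX` the factor (0)_{s+t} leaves only the term s = t = 0. -/
lemma kdfA_of_c1_eq_zero (h : QAdm q) (h0 : qPoch q (b1 + c1) (m + n) ≠ 0)
    (hd : qPoch q d m ≠ 0) (hf : qPoch q f n ≠ 0) (hc1 : c1 = 0) :
    kdfA q b1 c1 b2 c2 d f m n = q ^ (m * b2) * (qPoch q (d - b2) m / qPoch q d m) := by
  have e1 := kdfA_eq (b2 := b2) (c2 := c2) h h0 hd hf
  rw [polyA_eq_polyX _ _ _ _ _ _ _ _ h] at e1
  subst hc1
  have hX : qDouble m n (polyX q b1 0 b2 c2 d f m n)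
      = qRF q m * qRF q n * qPoch q (d - b2) m * qPoch q f n * qPoch q (b1 + 0) (m + n)
        * q ^ (m * b2) := by
    have hz : ∀ s r t w, (s, t) ≠ (0, 0) → polyX q b1 0 b2 c2 d f m n s r t w = 0 := by
      intro s r t w hst
      have : qPoch q 0 (s + t) = 0 := by
        have := qPoch_neg_nat_eq_zero (q := q) (m := 0) (s := s + t)
          (Nat.pos_of_ne_zero fun h => hst (by simp; omega))
        simpa using this
      simp [polyX, this]
    unfold qDouble
    rw [sum_eq_single (0, m), sum_eq_single (0, n)]
    · simp [polyX, qRF_zero]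
    · intro u hu hne
      apply hz
      intro h0
      apply hne
      simp only [HasAntidiagonal.mem_antidiagonal, Prod.mk.injEq] at hu h0
      ext <;> simp <;> omega
    · intro hu; simp at hu
    · intro p hp hne
      refine sum_eq_zero fun u _ => hz _ _ _ _ fun h0 => hne ?_
      simp only [HasAntidiagonal.mem_antidiagonal, Prod.mk.injEq] at hp h0
      ext <;> simp <;> omega
    · intro hp; simp at hp
  rw [hX] at e1
  have hm := qFact_mul_qRF h (n := m) (by omega)
  have hn := qFact_mul_qRF h (n := n) (by omega)
  rw [← mul_div_assoc, eq_div_iff hd]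
  apply mul_right_cancel₀ (mul_ne_zero h0 hf)
  linear_combination e1 + qPoch q (d - b2) m * qPoch q f n * qPoch q (b1 + 0) (m + n)
        * q ^ (m * b2) * (qFact q n * qRF q n * hm + hn)

theorem kdfA_identities (h : QAdm q) (b1 c1 b2 c2 d f : ℂ) (m n : ℕ)
    (h0 : qPoch q (b1 + c1) (m + n) ≠ 0) (hd : qPoch q d m ≠ 0) (hf : qPoch q f n ≠ 0) :
    (qPoch q b1 m ≠ 0 → qPoch q b2 m ≠ 0 → qPoch q c1 n ≠ 0 → qPoch q c2 n ≠ 0 →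
      kdfA q b1 c1 b2 c2 d f m n = kdfB q b1 c1 b2 c2 d f m n) ∧
    (qPoch q c1 m ≠ 0 → qPoch q (f - c2) n ≠ 0 →
      kdfA q b1 c1 b2 c2 d f m n = kdfF q b1 c1 b2 c2 d f m n) ∧
    (qPoch q (d - b2) m ≠ 0 → qPoch q (f - c2) n ≠ 0 →
      kdfA q b1 c1 b2 c2 d f m n = kdfJ q b1 c1 b2 c2 d f m n) ∧
    kdfA q b1 c1 b2 c2 d f m n = kdfA q c1 b1 c2 b2 f d n m ∧
    (b1 = 0 → kdfA q b1 c1 b2 c2 d f m n =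
      q ^ (n * c2) * (qPoch q (f - c2) n / qPoch q f n)) ∧
    (c1 = 0 → kdfA q b1 c1 b2 c2 d f m n =
      q ^ (m * b2) * (qPoch q (d - b2) m / qPoch q d m)) := by
  have eA := kdfA_eq (b2 := b2) (c2 := c2) h h0 hd hf
  refine ⟨fun k1 k2 k3 k4 => ?_, fun k1 k2 => ?_, fun k1 k2 => ?_, kdfA_comm h h0 hd hf,
    fun hb => ?_, kdfA_of_c1_eq_zero h h0 hd hf⟩
  · exact kdfA_eq_of_poly h0 hd hf eA (kdfB_eq h h0 hd hf k1 k2 k3 k4)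
  · refine kdfA_eq_of_poly h0 hd hf eA ?_
    rw [kdfF_eq h h0 hd hf k1 k2, polyA_eq_polyF _ _ _ _ _ _ _ _ h]
  · refine kdfA_eq_of_poly h0 hd hf eA ?_
    rw [kdfJ_eq h h0 hd hf k1 k2, polyA_eq_polyX _ _ _ _ _ _ _ _ h,
      polyX_eq_polyJ _ _ _ _ _ _ _ _ h]
  -- The case b1 = 0 is the case c1 = 0 after the interchange.
  · rw [kdfA_comm h h0 hd hf]
    refine kdfA_of_c1_eq_zero h ?_ hf hd hb
    rwa [add_comm c1, add_comm n]

theorem kdfA_identities_int (h : QAdm q) (b1 : ℂ) (k : ℤ) (b2 c2 d f : ℂ) (m n : ℕ)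
    (h0 : qPoch q (b1 + k) (m + n) ≠ 0) (hd : qPoch q d m ≠ 0)
    (hf : qPoch q f n ≠ 0) (hb1 : qPoch q b1 (m + n) ≠ 0) (hdb : qPoch q (d - b2) m ≠ 0)
    (h1 : ∀ j : ℕ, k = -j → qPoch q (1 - b1) j ≠ 0)
    (h2 : ∀ j : ℕ, k = j → qPoch q (1 - b1 - m - n - j) j ≠ 0) :
    kdfA q b1 k b2 c2 d f m n = kdfG q b1 k b2 c2 d f m n ∧
    (qPoch q c2 n ≠ 0 → kdfA q b1 k b2 c2 d f m n = kdfE q b1 k b2 c2 d f m n) := by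
  have eA := kdfA_eq (b2 := b2) (c2 := c2) h h0 hd hf
  rw [polyA_eq_polyX _ _ _ _ _ _ _ _ h, polyX_eq_polyY _ _ _ _ _ _ _ _ h,
    ← polyG_eq_polyY _ _ _ _ _ _ _ _ h] at eA
  refine ⟨kdfA_eq_of_poly h0 hd hf eA (kdfG_eq h h0 hd hf hb1 hdb h1 h2), fun k1 => ?_⟩
  refine kdfA_eq_of_poly h0 hd hf eA ?_
  rw [kdfE_eq h h0 hd hf hb1 hdb h1 h2 k1, polyG_eq_polyE _ _ _ _ _ _ _ _ h]

end Conversion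

/-! ### The case b1' = -k, with n natural or complex. -/

/-- A series with two terminating parameters may be cut at either bound. The choice decides which of
them acts as the length in a 3φ2 transformation. -/
lemma sum_antidiagonal_switch {g : ℕ → ℂ} {m n : ℕ} (hm : ∀ s, m < s → g s = 0)
    (hn : ∀ s, n < s → g s = 0) :
    ∑ p ∈ antidiagonal m, g p.1 = ∑ p ∈ antidiagonal n, g p.1 := by
  have key : ∀ N, m ≤ N → n ≤ N → ∑ p ∈ antidiagonal m, g p.1 = ∑ s ∈ range (N + 1), g s ∧
      ∑ p ∈ antidiagonal n, g p.1 = ∑ s ∈ range (N + 1), g s := by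
    intro N h1 h2
    rw [Nat.sum_antidiagonal_eq_sum_range_succ_mk, Nat.sum_antidiagonal_eq_sum_range_succ_mk]
    constructor
    · refine sum_subset (range_mono (by omega)) fun s _ hs => hm s ?_
      simp only [mem_range, not_lt] at hs; omega
    · refine sum_subset (range_mono (by omega)) fun s _ hs => hn s ?_
      simp only [mem_range, not_lt] at hs; omega
  obtain ⟨e1, e2⟩ := key (max m n) (le_max_left _ _) (le_max_right _ _)
  rw [e1, e2]

lemma sum_antidiagonal_triple_swap (k : ℕ) (g : ℕ → ℕ → ℕ → ℂ) :
    ∑ u ∈ antidiagonal k, ∑ p ∈ antidiagonal u.2, g p.1 u.1 p.2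
      = ∑ p ∈ antidiagonal k, ∑ u ∈ antidiagonal p.2, g p.1 u.1 u.2 := by
  rw [sum_sigma', sum_sigma']
  refine sum_bij' (fun x _ => ⟨(x.2.1, x.1.1 + x.2.2), (x.1.1, x.2.2)⟩)
    (fun x _ => ⟨(x.2.1, x.1.1 + x.2.2), (x.1.1, x.2.2)⟩) ?_ ?_ ?_ ?_ ?_
  · rintro ⟨⟨s, r⟩, ⟨j, i⟩⟩ hx
    simp only [mem_sigma, HasAntidiagonal.mem_antidiagonal] at hx ⊢
    exact ⟨by omega, by trivial⟩
  · rintro ⟨⟨s, r⟩, ⟨j, i⟩⟩ hx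
    simp only [mem_sigma, HasAntidiagonal.mem_antidiagonal] at hx ⊢
    exact ⟨by omega, by trivial⟩
  · rintro ⟨⟨s, r⟩, ⟨j, i⟩⟩ hx
    simp only [mem_sigma, HasAntidiagonal.mem_antidiagonal] at hx ⊢
    obtain ⟨h1, rfl⟩ := hx
    rfl
  · rintro ⟨⟨s, r⟩, ⟨j, i⟩⟩ hx
    simp only [mem_sigma, HasAntidiagonal.mem_antidiagonal] at hx ⊢
    obtain ⟨h1, rfl⟩ := hx
    rfl
  · rintro ⟨⟨s, r⟩, ⟨j, i⟩⟩ hx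
    rfl

/-- Used for numerators (-k)_{s+t}, which bound only the sum s + t; the complementary index is u
with s + t + u = k. -/
lemma tsum_eq_sum_antidiagonal_triple {k : ℕ} {F : ℕ → ℕ → ℂ}
    (hF : ∀ s t, k < s + t → F s t = 0) :
    ∑' p : ℕ × ℕ, F p.1 p.2 = ∑ u ∈ antidiagonal k, ∑ p ∈ antidiagonal u.2, F p.1 u.1 := by
  rw [tsum_eq_sum_antidiagonal_mul (m := k) (n := k) (fun s t _ => hF s t (by omega))
    (fun s t _ => hF s t (by omega)), sum_comm]
  refine sum_congr rfl ?_
  rintro ⟨t, K⟩ hu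
  have hu : t + K = k := HasAntidiagonal.mem_antidiagonal.mp hu
  exact sum_antidiagonal_switch (fun s _ => hF s t (by omega)) (fun s _ => hF s t (by omega))

lemma qRF_sub (h : QAdm q) (m s : ℕ) :
    qRF q ((m : ℤ) - s) = (-1) ^ s * qPoch q (-(m : ℂ)) s * qRF q m := by
  have := qPoch_neg_mul_qRF h (x := -(m : ℂ)) (y := m) (z := (m : ℤ) - s) (k := s) (by simp) rfl
  rw [mul_assoc, this, ← mul_assoc, neg_one_sq_pow, one_mul]

/-- A transformation of a series with two terminating parameters `-K`, `-m`. -/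
lemma sum_two_terminators (h : QAdm q) (x b d : ℂ) (K m : ℕ) :
    ∑ p ∈ antidiagonal K, (-1) ^ p.1 * qRF q p.1 * qRF q ((K : ℤ) - p.1) * qRF q ((m : ℤ) - p.1)
        * qPoch q b p.1 * qPoch q (d - b) (m - p.1) * qPoch q (x + p.1) (K - p.1)
        * q ^ (p.1 * (x + K - d))
      = q ^ ((m : ℂ) * K) * ∑ p ∈ antidiagonal K, qRF q p.1 * qRF q ((K : ℤ) - p.1)
        * qRF q ((m : ℤ) - p.1) * qPoch q (1 - d - m) p.1 * qPoch q (d - b) (m - p.1)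
        * qPoch q (x + m) (K - p.1) * q ^ (p.1 * (x - b)) := by
  -- The smaller of K and m has to be the length of the 3φ2. For K ≤ m the other terminator -m is
  -- the distinguished numerator parameter. For m ≤ K the length is m, the parameter is -K, and the
  -- transformation is read from right to left with the sign -1.
  rcases le_total K m with hKm | hKm
  · obtain ⟨j, rfl⟩ := Nat.exists_eq_add_of_le hKm
    trans (-1) ^ K * qRF q (K + j : ℕ) * qPoch q (d - b) j
      * qSer q 1 (-((K + j : ℕ) : ℂ)) b x (1 + b - d - (K + j : ℕ)) K
    · rw [qSer, mul_sum]
      refine sum_congr rfl ?_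
      rintro ⟨s, u⟩ hp
      have hp : s + u = K := HasAntidiagonal.mem_antidiagonal.mp hp
      have hK : (K : ℂ) = s + u := by exact_mod_cast hp.symm
      have r1 := qPoch_reflect (q := q) (d - b + j) (1 + b - d - (K + j : ℕ) + s) u
        (by push_cast; rw [hK]; ring)
      have hE : q ^ ((s : ℂ) * (x + K - d)) = q ^ ((1 : ℂ) * s * (s + u + x
          + (1 + b - d - (K + j : ℕ)) - (-((K + j : ℕ) : ℂ)) - b - 1)) := by
        congr 1; rw [hK]; push_cast; ring
      simp only [qTerm]
      rw [← hE, r1, qRF_sub h (K + j), show K + j - s = j + u by omega, show K - s = u by omega,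
        qPoch_add, show (K : ℤ) - s = (u : ℕ) by omega]
      have : ((-1 : ℂ)) ^ K = (-1) ^ s * (-1) ^ u := by rw [← pow_add, hp]
      rw [this]
      rcases neg_one_pow_eq_or ℂ s with hw | hw <;> rcases neg_one_pow_eq_or ℂ u with hz | hz <;>
        rw [hw, hz] <;> ring
    · rw [qSer_transform h (Or.inl rfl), mul_sum, mul_sum, mul_sum]
      refine sum_congr rfl ?_
      rintro ⟨s, u⟩ hp
      have hp : s + u = K := HasAntidiagonal.mem_antidiagonal.mp hp
      have hK : (K : ℂ) = s + u := by exact_mod_cast hp.symm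
      have r1 := qPoch_reflect (q := q) (d - b + j) (1 + b - d - (K + j : ℕ) + s) u
        (by push_cast; rw [hK]; ring)
      simp only
      rw [r1, qRF_sub h (K + j), show K + j - s = j + u by omega, show K - s = u by omega,
        qPoch_add (d - b), show (K : ℤ) - s = (u : ℕ) by omega, sub_neg_eq_add,
        show 1 + b - d - ((K + j : ℕ) : ℂ) - b = 1 - d - ((K + j : ℕ) : ℂ) by ring,
        show -(1 * (K : ℂ) * -((K + j : ℕ) : ℂ)) = ((K + j : ℕ) : ℂ) * K by ring, one_mul]
      have : ((-1 : ℂ)) ^ K = (-1) ^ s * (-1) ^ u := by rw [← pow_add, hp]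
      rw [this]
      rcases neg_one_pow_eq_or ℂ s with hw | hw <;> rcases neg_one_pow_eq_or ℂ u with hz | hz <;>
        rw [hw, hz] <;> ring
  · obtain ⟨j, rfl⟩ := Nat.exists_eq_add_of_le hKm
    have hsw : ∀ a b' c : ℕ → ℂ,
        ∑ p ∈ antidiagonal (m + j), a p.1 * qRF q p.1 * qRF q (((m + j : ℕ) : ℤ) - p.1)
          * qRF q ((m : ℤ) - p.1) * b' p.1 * c p.1
        = ∑ p ∈ antidiagonal m, a p.1 * qRF q p.1 * qRF q (((m + j : ℕ) : ℤ) - p.1)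
          * qRF q ((m : ℤ) - p.1) * b' p.1 * c p.1 := by
      intro a b' c
      refine sum_antidiagonal_switch (g := fun s => a s * qRF q s * qRF q (((m + j : ℕ) : ℤ) - s)
          * qRF q ((m : ℤ) - s) * b' s * c s) (fun s hs => ?_) (fun s hs => ?_)
      · simp [qRF_neg (q := q) (n := (m : ℤ) - s) (by omega)]
      · simp [qRF_neg (q := q) (n := (m : ℤ) - s) (by omega)]
    have h1 := hsw (fun s => (-1) ^ s) (fun s => qPoch q b s)
      (fun s => qPoch q (d - b) (m - s) * qPoch q (x + s) (m + j - s)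
        * q ^ (s * (x + (m + j : ℕ) - d)))
    have h2 := hsw (fun s => 1) (fun s => qPoch q (1 - d - m) s)
      (fun s => qPoch q (d - b) (m - s) * qPoch q (x + m) (m + j - s) * q ^ (s * (x - b)))
    simp only [← mul_assoc, one_mul] at h1 h2
    rw [h1, h2]
    have hT := qSer_transform h (Or.inr rfl) (-((m + j : ℕ) : ℂ)) (1 - d - m)
      (1 - x - (m + j : ℕ) - m) (1 + b - d - m) m
    rw [qSer] at hT
    have hcol : ∀ s r : ℕ, s + r = m → m - s = r ∧ m + j - s = r + j ∧ (m : ℤ) - s = r ∧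
        (m : ℂ) = s + r := by
      intro s r hp
      refine ⟨by omega, by omega, by omega, by exact_mod_cast hp.symm⟩
    have hE0 : q ^ ((m : ℂ) * ((m + j : ℕ) : ℂ)) * q ^ (-(-1 * (m : ℂ) * -((m + j : ℕ) : ℂ)))
        = 1 := by
      rw [← h.cpow_add, show (m : ℂ) * ((m + j : ℕ) : ℂ) + -(-1 * (m : ℂ) * -((m + j : ℕ) : ℂ)) = 0
        by ring, Complex.cpow_zero]
    trans qRF q (m + j : ℕ) * qPoch q (x + m) j * (q ^ ((m : ℂ) * ((m + j : ℕ) : ℂ))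
      * ∑ p ∈ antidiagonal m, qTerm q (-1) (-((m + j : ℕ) : ℂ)) (1 - d - m)
          (1 - x - (m + j : ℕ) - m) (1 + b - d - m) p.1 p.2)
    · rw [hT, ← mul_assoc (q ^ _), hE0, one_mul, mul_sum]
      refine sum_congr rfl ?_
      rintro ⟨s, r⟩ hp
      have hp : s + r = m := HasAntidiagonal.mem_antidiagonal.mp hp
      obtain ⟨c1, c2, c3, c4⟩ := hcol s r hp
      have r1 := qPoch_reflect (q := q) (d - b) (1 + b - d - m + s) r (by rw [c4]; ring)
      have r2 := qPoch_reflect (q := q) (x + s) (1 - x - (m + j : ℕ) - m - -((m + j : ℕ) : ℂ)) r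
        (by rw [c4]; ring)
      have hE : q ^ (-1 * (s : ℂ) * (1 - x - (m + j : ℕ) - m - (1 - d - m)))
          = q ^ ((s : ℂ) * (x + (m + j : ℕ) - d)) := by congr 1; ring
      simp only
      rw [c1, c2, c3, hE, r1, r2, qRF_sub h (m + j), qPoch_add (x + s),
        show x + (s : ℂ) + r = x + m by rw [c4]; ring,
        show 1 + b - d - (m : ℂ) - (1 - d - m) = b by ring]
      rcases neg_one_pow_eq_or ℂ s with hw | hw <;> rcases neg_one_pow_eq_or ℂ r with hz | hz <;>
        rw [hw, hz] <;> ring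
    · rw [mul_left_comm, mul_sum]
      congr 1
      refine sum_congr rfl ?_
      rintro ⟨s, r⟩ hp
      have hp : s + r = m := HasAntidiagonal.mem_antidiagonal.mp hp
      obtain ⟨c1, c2, c3, c4⟩ := hcol s r hp
      have r1 := qPoch_reflect (q := q) (d - b) (1 + b - d - m + s) r (by rw [c4]; ring)
      have r2 := qPoch_reflect (q := q) (x + m + j) (1 - x - (m + j : ℕ) - m + s) r
        (by push_cast; rw [c4]; ring)
      have hE : q ^ (-1 * (s : ℂ) * (s + r + (1 - x - (m + j : ℕ) - m) + (1 + b - d - m)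
          - (-((m + j : ℕ) : ℂ)) - (1 - d - m) - 1)) = q ^ ((s : ℂ) * (x - b)) := by
        congr 1; rw [c4]; ring
      simp only [qTerm]
      rw [c1, c2, c3, hE, r1, r2, qRF_sub h (m + j), add_comm r j, qPoch_add (x + m)]
      rcases neg_one_pow_eq_or ℂ s with hw | hw <;> rcases neg_one_pow_eq_or ℂ r with hz | hz <;>
        rw [hw, hz] <;> ring

section NegativeParameter

variable (q) (b1 b2 c2 d f n : ℂ) (m k : ℕ)

/-- The coefficient of the inner series in the `t`-th term of `kdfA` with `b1' = -k`. -/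
def coefA (t : ℕ) : ℂ :=
  qPoch q c2 t * qPoch q (-n) t / qPoch q f t * qRF q t * qPoch q (-(k : ℂ)) t
    * q ^ (t * (c2 - b1 - f - n + 1))

variable {q b1 b2 c2 d f n m k}

lemma kdfA_neg_eq (h : QAdm q) (hd : qPoch q d m ≠ 0) :
    kdfA q b1 (-k) b2 c2 d f m n * qPoch q d m
      = ∑ u ∈ antidiagonal k, coefA q b1 c2 f n k u.1 * ∑ p ∈ antidiagonal m,
        (-1) ^ p.1 * qFact q m * qRF q p.1 * qRF q p.2 * qPoch q b1 p.1 * qPoch q b2 p.1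
          * qPoch q (d + p.1) p.2 / qPoch q (b1 - k) (p.1 + u.1)
          * q ^ (p.1 * (b2 + k - d - m + 1 - u.1)) := by
  unfold kdfA
  rw [qKdF_eq_qDouble h 1 (-1) m k
    (fun s t => s * (b2 - -k - d - m + 1) + t * (c2 - b1 - f - n + 1) - s * t)
    (by simp) (by simp) (by intro s t; push_cast; ring)
    (by intro s hs; simp [qPoch_neg_nat_eq_zero hs])
    (by intro t ht; simp [qPoch_neg_nat_eq_zero ht]), qDouble, sum_comm, sum_mul]
  refine sum_congr rfl fun u _ => ?_
  rw [sum_mul, mul_sum]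
  refine sum_congr rfl ?_
  rintro ⟨s, r⟩ hp
  obtain ⟨t, w⟩ := u
  have hp : s + r = m := HasAntidiagonal.mem_antidiagonal.mp hp
  obtain ⟨e2, n2, -⟩ := qPoch_split_ne hp hd
  simp only [qKdFTerm, qPochs_cons, qPochs_nil, mul_one, coefA]
  have hE : q ^ ((s : ℂ) * (b2 - -k - d - m + 1) + t * (c2 - b1 - f - n + 1) - s * t)
      = q ^ ((s : ℂ) * (b2 + k - d - m + 1 - t)) * q ^ (t * (c2 - b1 - f - n + 1)) := by
    rw [← h.cpow_add]; congr 1; ring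
  rw [e2, qPoch_neg_nat h hp, hE, ← sub_eq_add_neg]
  simp only [div_eq_mul_inv, mul_inv, one_mul]
  have := mul_inv_cancel₀ n2
  linear_combination ((qPoch q (b1 - k) (s + t))⁻¹ * (qPoch q b1 s * qPoch q b2 s
    * ((-1) ^ s * qFact q m * qRF q r) * (qPoch q (-(k : ℂ)) t * qPoch q c2 t * qPoch q (-n) t)
    * (qPoch q f t)⁻¹) * (qRF q s * qRF q t) * (q ^ ((s : ℂ) * (b2 + k - d - m + 1 - t))
    * q ^ (t * (c2 - b1 - f - n + 1))) * qPoch q (d + s) r) * this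

/-- The analogue of `polyA_eq_polyX`, term by term in t. The hypothesis hT covers two situations:
natural n, where (-n)_t = 0 for t > n and denominators matter only for t ≤ n, and complex n, where
(b1-k)_{m+k} must not vanish. -/
lemma kdfA_neg_eq_X (h : QAdm q) (hd : qPoch q d m ≠ 0)
    (hT : ∀ t, t ≤ k → qPoch q (-n) t = 0 ∨ qPoch q (b1 - k) (t + m) ≠ 0) :
    kdfA q b1 (-k) b2 c2 d f m n * qPoch q d m
      = ∑ u ∈ antidiagonal k, coefA q b1 c2 f n k u.1 * ∑ p ∈ antidiagonal m,
        q ^ (m * b2) * (qFact q m * qRF q p.1 * qRF q p.2 * qPoch q (-(u.2 : ℂ)) p.1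
          * qPoch q b2 p.1 * qPoch q (d - b2) p.2 / qPoch q (b1 - k) (p.1 + u.1)
          * q ^ (-(p.1 * (d - b1)))) := by
  rw [kdfA_neg_eq h hd]
  refine sum_congr rfl ?_
  rintro ⟨t, K⟩ hu
  have hu : t + K = k := HasAntidiagonal.mem_antidiagonal.mp hu
  have hk : (k : ℂ) = t + K := by exact_mod_cast hu.symm
  simp only
  rcases hT t (by omega) with h0 | h0
  · simp [coefA, h0]
  congr 1
  rw [← mul_sum]
  have key := qSer_transform h (Or.inr rfl) b2 b1 d (b1 - K) m
  rw [qSer] at key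
  have hbk : b1 - (k : ℂ) + t = b1 - K := by rw [hk]; ring
  trans qFact q m * (qPoch q (b1 - k) (t + m))⁻¹ * ∑ p ∈ antidiagonal m,
      qTerm q (-1) b2 b1 d (b1 - K) p.1 p.2
  · rw [mul_sum]
    refine sum_congr rfl ?_
    rintro ⟨s, r⟩ hp
    have hp : s + r = m := HasAntidiagonal.mem_antidiagonal.mp hp
    obtain ⟨e1, n1, n2⟩ := qPoch_split_ne (s := s + t) (r := r) (by omega) h0
    have hbk' : b1 - (k : ℂ) + (s + t : ℕ) = b1 - K + s := by rw [hk]; push_cast; ring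
    rw [hbk'] at e1 n2
    simp only [qTerm]
    have hE : q ^ (-1 * (s : ℂ) * (s + r + d + (b1 - K) - b2 - b1 - 1))
        = q ^ ((s : ℂ) * (b2 + k - d - m + 1 - t)) := by
      congr 1; rw [hk, ← hp]; push_cast; ring
    rw [hE, e1, mul_inv, div_eq_mul_inv]
    linear_combination ((-1) ^ s * qFact q m * qRF q s * qRF q r * qPoch q b1 s * qPoch q b2 s
      * qPoch q (d + s) r * (qPoch q (b1 - k) (s + t))⁻¹
      * q ^ ((s : ℂ) * (b2 + k - d - m + 1 - t))) * (-mul_inv_cancel₀ n2)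
  · rw [key, show -(-1 * (m : ℂ) * b2) = m * b2 by ring, mul_left_comm]
    congr 1
    rw [mul_sum]
    refine sum_congr rfl ?_
    rintro ⟨s, r⟩ hp
    have hp : s + r = m := HasAntidiagonal.mem_antidiagonal.mp hp
    obtain ⟨e1, n1, n2⟩ := qPoch_split_ne (s := s + t) (r := r) (by omega) h0
    have hbk' : b1 - (k : ℂ) + (s + t : ℕ) = b1 - K + s := by rw [hk]; push_cast; ring
    rw [hbk'] at e1 n2
    simp only
    rw [e1, mul_inv, div_eq_mul_inv, show b1 - (K : ℂ) - b1 = -K by ring,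
      show -1 * (s : ℂ) * (d - b1) = -(s * (d - b1)) by ring]
    linear_combination (qFact q m * qRF q s * qRF q r * qPoch q (-(K : ℂ)) s * qPoch q b2 s
      * qPoch q (d - b2) r * (qPoch q (b1 - k) (s + t))⁻¹
      * q ^ (-((s : ℂ) * (d - b1)))) * mul_inv_cancel₀ n2

end NegativeParameter

section NegativeParameter

variable {b1 b2 c2 d f n : ℂ} {m k : ℕ}

lemma qDouble_euler_right (h : QAdm q) {ε : ℂ} (hε : ε = 1 ∨ ε = -1) {m n : ℕ}
    {f g : ℕ → ℕ → ℕ → ℕ → ℂ} (a b d e C : ℕ → ℕ → ℂ)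
    (hf : ∀ s r, s + r = m → ∀ t w, t + w = n →
      f s r t w = C s r * qTerm q ε (a s r) (b s r) (d s r) (e s r) t w)
    (hg : ∀ s r, s + r = m → ∀ t w, t + w = n → g s r t w
      = C s r * q ^ (ε * n * (e s r - a s r - b s r))
        * qTerm q ε (e s r - a s r) (e s r - b s r) (d s r + e s r - a s r - b s r) (e s r) t w) :
    qDouble m n f = qDouble m n g := by
  refine qDouble_congr_right fun s r hsr => ?_
  rw [sum_congr rfl fun p hp => hf s r hsr p.1 p.2 (HasAntidiagonal.mem_antidiagonal.mp hp),
    sum_congr rfl fun p hp => hg s r hsr p.1 p.2 (HasAntidiagonal.mem_antidiagonal.mp hp),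
    ← mul_sum, ← mul_sum]
  have := qSer_euler h hε (a s r) (b s r) (d s r) (e s r) n
  rw [qSer, qSer] at this
  rw [this, ← mul_assoc (C s r)]

lemma kdfD_eq (h : QAdm q) (hk : qPoch q (b1 - k) k ≠ 0) (hd : qPoch q d m ≠ 0)
    (hf : qPoch q f k ≠ 0) (hZ : qPoch q (f - c2 + b1 - k + n) (m + k) ≠ 0) :
    kdfD q b1 (-k) b2 c2 d f m n * (qPoch q (b1 - k) k * qPoch q d m * qPoch q f k)
      = qFact q m * qFact q k * qDouble m k fun s r t w =>
        (-1) ^ (s + t) * (qRF q s * qRF q r * qRF q t * qRF q w) * qPoch q b2 s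
          * qPoch q (d + s) r * qPoch q (f - c2) t * qPoch q (f + n) t * qPoch q (f + t) w
          * qPoch q (f - c2 + b1 - k + n + (s + t : ℕ)) w
          * q ^ (s * (b2 + k - d - m + 1) + t * (1 - b1) - s * t - k * (f - c2 + n)) := by
  have hk' := qPoch_reflect (q := q) (b1 - k) (1 - b1) k (by ring)
  have : kdfD q b1 (-k) b2 c2 d f m n * (qPoch q (b1 - k) k * qPoch q d m * qPoch q f k)
      = qKdF 1 [] [f - c2 + b1 - k + n] [b1 - c2 + f + n, b2, -m] [d] [f - c2, -k, f + n] [f]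
        (q ^ (b2 + k - d - m + 1)) (q ^ (-b1 + 1)) q
      * (q ^ (-(k * (f - c2 + n))) * (qPoch q (f - c2 + b1 - k + n) k * qPoch q d m
        * qPoch q f k)) := by
    unfold kdfD qPochRatio
    have hs : ((-1 : ℂ)) ^ (-(k : ℤ)) = (-1) ^ k := by
      rw [zpow_neg, zpow_natCast, ← inv_pow]; norm_num
    rw [if_pos (by omega), hs]
    push_cast
    simp only [neg_neg, Int.toNat_natCast]
    rw [show -b1 + 1 = 1 - b1 by ring, hk', show (k : ℂ) * (c2 - f - n) = -(k * (f - c2 + n)) by ring,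
      show f - c2 + b1 + -(k : ℂ) + n = f - c2 + b1 - k + n by ring,
      show b2 - -(k : ℂ) - d - m + 1 = b2 + k - d - m + 1 by ring]
    simp only [mul_assoc]
    congr 1
    have := neg_one_pow_ne_zero (R := ℂ) k
    rw [mul_left_comm]
    congr 1
    generalize qPoch q (b1 - k) k = B at *
    generalize qPoch q (f - c2 + b1 - k + n) k = Z
    field_simp
  rw [this, qKdF_eq_qDouble h 1 (-1) m k
    (fun s t => s * (b2 + k - d - m + 1) + t * (-b1 + 1) - s * t)
    (by simp) (by simp) (by intro s t; push_cast; ring)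
    (by intro s hs; simp [qPoch_neg_nat_eq_zero hs])
    (by intro t ht; simp [qPoch_neg_nat_eq_zero ht])]
  refine qDouble_mul_eq _ _ fun s r t w hs ht => ?_
  obtain ⟨e1, n1, -⟩ := qPoch_split_ne (s := s + t) (r := r + w) (by omega) hZ
  obtain ⟨e2, n2, -⟩ := qPoch_split_ne hs hd
  obtain ⟨e3, n3, -⟩ := qPoch_split_ne ht hf
  -- With Z = f - c2 + b1 - k + n, the prefactor (Z)_k and the numerator (Z+k)_s join to (Z)_{k+s},
  -- which contains the denominator (Z)_{s+t}.
  have e4 : qPoch q (f - c2 + b1 - k + n) k * qPoch q (b1 - c2 + f + n) s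
      = qPoch q (f - c2 + b1 - k + n) (s + t)
        * qPoch q (f - c2 + b1 - k + n + (s + t : ℕ)) w := by
    rw [show b1 - c2 + f + n = f - c2 + b1 - k + n + k by ring, ← qPoch_add, ← qPoch_add]
    congr 1; omega
  unfold qKdFTerm
  simp only [qPochs_cons, qPochs_nil, mul_one]
  have hE : q ^ (s * (b2 + k - d - m + 1) + t * (1 - b1) - s * t - k * (f - c2 + n))
      = q ^ (s * (b2 + k - d - m + 1) + t * (-b1 + 1) - s * t) * q ^ (-(k * (f - c2 + n))) := by
    rw [← h.cpow_add]; congr 1; ring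
  rw [hE, qPoch_neg_nat h hs, qPoch_neg_nat h ht, e2, e3]
  generalize q ^ ((s : ℂ) * (b2 + k - d - m + 1) + t * (-b1 + 1) - s * t) = E1
  generalize q ^ (-(k * (f - c2 + n))) = E2
  generalize qPoch q (f - c2 + b1 - k + n + (s + t : ℕ)) w = A4 at *
  generalize qPoch q (f - c2 + b1 - k + n) (s + t) = A1 at *
  generalize qPoch q (f - c2 + b1 - k + n) k = A2 at *
  generalize qPoch q (b1 - c2 + f + n) s = A3 at *
  generalize qPoch q d s = A5 at *
  generalize qPoch q f t = A6 at *
  simp only [div_eq_mul_inv, mul_inv, one_mul]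
  have i1 := mul_inv_cancel₀ n1
  have i2 := mul_inv_cancel₀ n2
  have i3 := mul_inv_cancel₀ n3
  rw [pow_add]
  trans (A2 * A3 * A1⁻¹) * (A5 * A5⁻¹) * (A6 * A6⁻¹) * ((-1) ^ s * (-1) ^ t * qFact q m * qFact q k
    * (qRF q s * qRF q r * qRF q t * qRF q w) * qPoch q b2 s
    * qPoch q (d + s) r * qPoch q (f - c2) t * qPoch q (f + n) t * qPoch q (f + t) w * E1 * E2)
  · ring
  · rw [e4, mul_right_comm A1, i1, i2, i3]; ring

lemma kdfA_neg_eq_qDouble (h : QAdm q) (hd : qPoch q d m ≠ 0)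
    (hf : qPoch q f k ≠ 0)
    (hT : ∀ t, t ≤ k → qPoch q (-n) t = 0 ∨ qPoch q (b1 - k) (t + m) ≠ 0) :
    kdfA q b1 (-k) b2 c2 d f m n * (qPoch q (b1 - k) k * qPoch q d m * qPoch q f k)
      = qFact q m * qFact q k * qDouble m k fun s r t w =>
        (-1) ^ (s + t) * (qRF q s * qRF q r * qRF q t * qRF q w) * qPoch q b2 s
          * qPoch q (d + s) r * qPoch q c2 t * qPoch q (-n) t * qPoch q (f + t) w
          * qPoch q (b1 - k + (s + t : ℕ)) w
          * q ^ (s * (b2 + k - d - m + 1) + t * (c2 - b1 - f - n + 1) - s * t) := by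
  rw [show kdfA q b1 (-k) b2 c2 d f m n * (qPoch q (b1 - k) k * qPoch q d m * qPoch q f k)
    = kdfA q b1 (-k) b2 c2 d f m n * qPoch q d m * (qPoch q (b1 - k) k * qPoch q f k) by ring,
    kdfA_neg_eq h hd, qDouble, sum_comm, sum_mul, mul_sum]
  refine sum_congr rfl ?_
  rintro ⟨t, w⟩ hu
  have hu : t + w = k := HasAntidiagonal.mem_antidiagonal.mp hu
  rw [mul_sum, sum_mul, mul_sum]
  refine sum_congr rfl ?_
  rintro ⟨s, r⟩ hp
  have hp : s + r = m := HasAntidiagonal.mem_antidiagonal.mp hp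
  simp only [coefA]
  rcases hT t (by omega) with h0 | h0
  · simp [h0]
  have n1 := qPoch_ne_of_le (m := s + t) (by omega) h0
  obtain ⟨e3, n3, -⟩ := qPoch_split_ne hu hf
  -- Since (b1-k)_k (b1)_s = (b1-k)_{k+s} contains (b1-k)_{s+t}, the factor (b1-k)_k alone clears
  -- the joint denominator.
  have e4 : qPoch q (b1 - k) k * qPoch q b1 s
      = qPoch q (b1 - k) (s + t) * qPoch q (b1 - k + (s + t : ℕ)) w := by
    nth_rw 2 [show b1 = b1 - k + k by ring]
    rw [← qPoch_add, ← qPoch_add]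
    congr 1; omega
  have hE : q ^ ((s : ℂ) * (b2 + k - d - m + 1) + t * (c2 - b1 - f - n + 1) - s * t)
      = q ^ ((s : ℂ) * (b2 + k - d - m + 1 - t)) * q ^ (t * (c2 - b1 - f - n + 1)) := by
    rw [← h.cpow_add]; congr 1; ring
  rw [hE, e3, qPoch_neg_nat h hu, pow_add]
  simp only [div_eq_mul_inv]
  have i1 := mul_inv_cancel₀ n1
  have i3 := mul_inv_cancel₀ n3
  trans (qPoch q (b1 - k) k * qPoch q b1 s * (qPoch q (b1 - k) (s + t))⁻¹)
    * (qPoch q f t * (qPoch q f t)⁻¹) * ((-1) ^ s * (-1) ^ t * qFact q m * qFact q k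
    * (qRF q s * qRF q r * qRF q t * qRF q w) * qPoch q b2 s
    * qPoch q (d + s) r * qPoch q c2 t * qPoch q (-n) t * qPoch q (f + t) w
    * (q ^ ((s : ℂ) * (b2 + k - d - m + 1 - t)) * q ^ (t * (c2 - b1 - f - n + 1))))
  · ring
  · rw [e4, mul_right_comm (qPoch q (b1 - k) (s + t)), i1, i3]; ring

/-- For fixed s the sum over t is a 3φ2 of length k in which -n is an ordinary numerator parameter
beside c2; `qSer_euler` turns these into f + n and f - c2. This is why n may be complex. -/
lemma kdfA_eq_kdfD (h : QAdm q) (hk : qPoch q (b1 - k) k ≠ 0) (hd : qPoch q d m ≠ 0)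
    (hf : qPoch q f k ≠ 0) (hZ : qPoch q (f - c2 + b1 - k + n) (m + k) ≠ 0)
    (hT : ∀ t, t ≤ k → qPoch q (-n) t = 0 ∨ qPoch q (b1 - k) (t + m) ≠ 0) :
    kdfA q b1 (-k) b2 c2 d f m n = kdfD q b1 (-k) b2 c2 d f m n := by
  apply mul_right_cancel₀ (mul_ne_zero (mul_ne_zero hk hd) hf)
  rw [kdfA_neg_eq_qDouble h hd hf hT, kdfD_eq h hk hd hf hZ]
  congr 1
  refine qDouble_euler_right h (Or.inr rfl) (fun _ _ => c2) (fun _ _ => -n)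
    (fun s _ => b1 - k + s) (fun _ _ => f)
    (fun s r => (-1) ^ s * qRF q s * qRF q r * qPoch q b2 s * qPoch q (d + s) r
      * q ^ (s * (b2 + k - d - m + 1))) ?_ ?_
  · rintro s r hsr t w rfl
    have hE : q ^ (s * (b2 + (t + w : ℕ) - d - m + 1) + t * (c2 - b1 - f - n + 1) - s * t)
        = q ^ (s * (b2 + (t + w : ℕ) - d - m + 1)) * q ^ (-1 * (t : ℂ) * (t + w
          + (b1 - (t + w : ℕ) + s) + f - c2 - -n - 1)) := by
      rw [← h.cpow_add]; congr 1; push_cast; ring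
    simp only [qTerm]
    rw [hE, show b1 - ((t + w : ℕ) : ℂ) + (s + t : ℕ) = b1 - (t + w : ℕ) + s + t by
      push_cast; ring]
    ring
  · rintro s r hsr t w rfl
    have hE : q ^ (s * (b2 + (t + w : ℕ) - d - m + 1) + t * (1 - b1) - s * t
          - (t + w : ℕ) * (f - c2 + n))
        = q ^ (s * (b2 + (t + w : ℕ) - d - m + 1)) * q ^ (-1 * ((t + w : ℕ) : ℂ) * (f - c2 - -n))
          * q ^ (-1 * (t : ℂ) * (t + w
          + (b1 - (t + w : ℕ) + s + f - c2 - -n) + f - (f - c2) - (f - -n) - 1)) := by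
      rw [← h.cpow_add, ← h.cpow_add]; congr 1; push_cast; ring
    simp only [qTerm]
    rw [hE, show f - c2 + b1 - ((t + w : ℕ) : ℂ) + n + (s + t : ℕ)
      = b1 - (t + w : ℕ) + s + f - c2 - -n + t by push_cast; ring, sub_neg_eq_add f]
    ring

end NegativeParameter

lemma qKdF_eq_triple (h : QAdm q) {ε : ℤ} (δ κ : ℤ) {a c b d b' d' : List ℂ} {u v : ℂ} (k : ℕ)
    (x : ℕ → ℕ → ℂ) (hδ : 1 - 2 * (if a.length = c.length then (1 : ℤ) else 0) = δ)
    (hκ : (a.length : ℤ) - c.length = κ)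
    (hx : ∀ s t : ℕ, (ε : ℂ) * s * u + ε * δ * t * v + ε * κ * s * t = x s t)
    (ha : ∀ s, k < s → qPochs q a s = 0) :
    qKdF ε a c b d b' d' (q ^ u) (q ^ v) q = ∑ u ∈ antidiagonal k, ∑ p ∈ antidiagonal u.2,
      qKdFTerm q a c b d b' d' p.1 u.1 (x p.1 u.1) := by
  rw [qKdF_eq_tsum h hδ hκ hx]
  exact tsum_eq_sum_antidiagonal_triple (F := fun s t => qKdFTerm q a c b d b' d' s t (x s t))
    (by intro s t hst; simp [qKdFTerm, ha _ hst])

section NegativeParameter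

variable {b1 b2 c2 d f n : ℂ} {m k : ℕ}

lemma kdfA_neg_eq_triple (h : QAdm q) (hd : qPoch q d m ≠ 0) (hk : qPoch q (b1 - k) k ≠ 0)
    (hT : ∀ t, t ≤ k → qPoch q (-n) t = 0 ∨ qPoch q (b1 - k) (t + m) ≠ 0) :
    kdfA q b1 (-k) b2 c2 d f m n * (qPoch q d m * qPoch q (b1 - k) k)
      = qFact q m * qFact q k * ∑ u ∈ antidiagonal k, ∑ p ∈ antidiagonal u.2,
        (-1) ^ (p.1 + u.1) * (qRF q p.1 * qRF q u.1 * qRF q p.2) * qRF q ((m : ℤ) - p.1)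
          * qPoch q (d - b2) (m - p.1) * qPoch q b2 p.1
          * (qPoch q c2 u.1 * qPoch q (-n) u.1 / qPoch q f u.1)
          * qPoch q (b1 - k + (p.1 + u.1 : ℕ)) p.2
          * q ^ (m * b2 + u.1 * (c2 - b1 - f - n + 1) - p.1 * (d - b1)) := by
  rw [← mul_assoc, kdfA_neg_eq_X h hd hT, sum_mul, mul_sum]
  refine sum_congr rfl ?_
  rintro ⟨t, K⟩ hu
  have hu : t + K = k := HasAntidiagonal.mem_antidiagonal.mp hu
  simp only
  -- After the transformation (-K)_s and 1/[m-s]! both terminate, so s may be cut at K = k - t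
  -- instead of m; this gives the triangle s + t ≤ k.
  have hsw := sum_antidiagonal_switch (m := m) (n := K) (g := fun s => q ^ (m * b2)
    * (qFact q m * qRF q s * qRF q ((m : ℤ) - s) * qPoch q (-(K : ℂ)) s
      * qPoch q b2 s * qPoch q (d - b2) (m - s) / qPoch q (b1 - k) (s + t)
      * q ^ (-(s * (d - b1))))) (fun s hs => ?_) (fun s hs => ?_)
  rotate_left
  · simp [qRF_neg (q := q) (n := (m : ℤ) - s) (by omega)]
  · simp [qPoch_neg_nat_eq_zero (q := q) hs]
  have hL : ∑ p ∈ antidiagonal m, q ^ (m * b2) * (qFact q m * qRF q p.1 * qRF q p.2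
        * qPoch q (-(K : ℂ)) p.1 * qPoch q b2 p.1 * qPoch q (d - b2) p.2
        / qPoch q (b1 - k) (p.1 + t) * q ^ (-(p.1 * (d - b1))))
      = ∑ p ∈ antidiagonal m, q ^ (m * b2) * (qFact q m * qRF q p.1 * qRF q ((m : ℤ) - p.1)
        * qPoch q (-(K : ℂ)) p.1 * qPoch q b2 p.1 * qPoch q (d - b2) (m - p.1)
        / qPoch q (b1 - k) (p.1 + t) * q ^ (-(p.1 * (d - b1)))) := by
    refine sum_congr rfl ?_
    rintro ⟨s, r⟩ hp
    have hp : s + r = m := HasAntidiagonal.mem_antidiagonal.mp hp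
    simp only
    rw [show m - s = r by omega, show (m : ℤ) - s = r by omega]
  rw [hL, hsw, mul_sum, sum_mul, mul_sum]
  refine sum_congr rfl ?_
  rintro ⟨s, u⟩ hp
  have hp : s + u = K := HasAntidiagonal.mem_antidiagonal.mp hp
  obtain ⟨e1, n1, -⟩ := qPoch_split_ne (s := s + t) (r := u) (by omega) hk
  have hE : q ^ ((m : ℂ) * b2 + t * (c2 - b1 - f - n + 1) - s * (d - b1))
      = q ^ (m * b2) * q ^ (t * (c2 - b1 - f - n + 1)) * q ^ (-(s * (d - b1))) := by
    rw [← h.cpow_add, ← h.cpow_add]; congr 1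
  simp only [coefA]
  rw [hE, e1, qPoch_neg_nat h hp, qPoch_neg_nat h hu, pow_add]
  simp only [div_eq_mul_inv]
  have i1 := mul_inv_cancel₀ n1
  have i2 := qFact_mul_qRF h (n := K) (by omega)
  linear_combination ((-1) ^ s * (-1) ^ t * qFact q m * qFact q k * qRF q s * qRF q t * qRF q u
    * qRF q ((m : ℤ) - s) * qPoch q (d - b2) (m - s) * qPoch q b2 s * qPoch q c2 t
    * qPoch q (-n) t * (qPoch q f t)⁻¹ * qPoch q (b1 - k + (s + t : ℕ)) u * (q ^ (m * b2)
    * q ^ (t * (c2 - b1 - f - n + 1)) * q ^ (-(s * (d - b1))))) * (qPoch q (b1 - k) (s + t)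
    * (qPoch q (b1 - k) (s + t))⁻¹ * i2 + i1)

lemma qPoch_sub_mul_qPoch (x y : ℂ) {m s : ℕ} (hs : s ≤ m) (hy : y = 1 - x - m) :
    qPoch q x (m - s) * qPoch q y s = (-1) ^ s * qPoch q x m := by
  rw [qPoch_reflect (x + (m - s : ℕ)) y s (by rw [hy, Nat.cast_sub hs]; ring), mul_left_comm,
    ← qPoch_add, Nat.sub_add_cancel hs]

/-- For fixed t the sum over s has length K = k - t, numerator parameters b2, -m and denominator
parameters b1-K, b2-d-m+1. The Euler formula replaces the numerators by 1-d-m and b2-d+1, and b1-K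
by b1-K-d+1. -/
lemma kdfA_eq_kdfH (h : QAdm q) (hd : qPoch q d m ≠ 0) (hk : qPoch q (b1 - k) k ≠ 0)
    (hT : ∀ t, t ≤ k → qPoch q (-n) t = 0 ∨ qPoch q (b1 - k) (t + m) ≠ 0)
    (hZ : qPoch q (d - b1) k ≠ 0) (hD : qPoch q (b2 - d - m + 1) k ≠ 0) :
    kdfA q b1 (-k) b2 c2 d f m n = kdfH q b1 (-k) b2 c2 d f m n := by
  have hk' := qPoch_reflect (q := q) (b1 - k) (1 - b1) k (by ring)
  have hZ' := qPoch_reflect (q := q) (b1 - k - d + 1) (d - b1) k (by ring)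
  have hZ0 : qPoch q (b1 - k - d + 1) k ≠ 0 := fun h0 => hZ (by rw [hZ', h0, mul_zero])
  apply mul_right_cancel₀ (mul_ne_zero hd hk)
  have hH : kdfH q b1 (-k) b2 c2 d f m n * (qPoch q d m * qPoch q (b1 - k) k)
      = qKdF (-1) [(-k : ℂ)] [b1 - k - d + 1] [b2 - d + 1, 1 - d - m] [b2 - d - m + 1]
      [c2, -n] [f] (q ^ (-b1 + 1)) (q ^ (d - f - b1 + c2 - n)) q
      * (q ^ (-k * (d - 1) + m * b2) * qPoch q (d - b2) m * qPoch q (b1 - k - d + 1) k) := by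
    unfold kdfH qPochRatio
    rw [if_pos (by omega)]
    push_cast
    simp only [neg_neg, Int.toNat_natCast]
    rw [show -b1 + 1 = 1 - b1 by ring, hk', hZ', show b1 + -(k : ℂ) - d + 1 = b1 - k - d + 1 by ring]
    have := neg_one_pow_ne_zero (R := ℂ) k
    generalize q ^ (-k * (d - 1) + m * b2) = E
    generalize qKdF _ _ _ _ _ _ _ _ _ _ = Z
    generalize qPoch q (b1 - k) k = B at *
    field_simp
  rw [hH, kdfA_neg_eq_triple h hd hk hT, qKdF_eq_triple h (-1) 0 k
    (fun s t => s * (b1 - 1) + t * (d - f - b1 + c2 - n)) (by simp) (by simp)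
    (by intro s t; push_cast; ring) (by intro s hs; simp [qPoch_neg_nat_eq_zero hs]),
    sum_mul, mul_sum]
  refine sum_congr rfl ?_
  rintro ⟨t, K⟩ hu
  have hu : t + K = k := HasAntidiagonal.mem_antidiagonal.mp hu
  have hkc : (k : ℂ) = t + K := by exact_mod_cast hu.symm
  have hDK := qPoch_ne_of_le (m := K) (by omega) hD
  simp only
  have key := qSer_euler h (Or.inl rfl) b2 (-m) (b1 - K) (b2 - d - m + 1) K
  rw [qSer, qSer] at key
  let C := qFact q K * qFact q k * (qPoch q (b2 - d - m + 1) K)⁻¹ * qPoch q (d - b2) m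
    * ((-1) ^ t * qRF q t * qRF q K * (qPoch q c2 t * qPoch q (-n) t * (qPoch q f t)⁻¹)
    * q ^ (m * b2 + t * (c2 - b1 - f - n + 1)))
  have iK := qFact_mul_qRF h (n := K) (by omega)
  have im := qFact_mul_qRF h (n := m) (by omega)
  trans C * ∑ p ∈ antidiagonal K, qTerm q 1 b2 (-m) (b1 - K) (b2 - d - m + 1) p.1 p.2
  · rw [mul_sum, mul_sum]
    refine sum_congr rfl ?_
    rintro ⟨s, u⟩ hp
    have hp : s + u = K := HasAntidiagonal.mem_antidiagonal.mp hp
    have hKc : (K : ℂ) = s + u := by exact_mod_cast hp.symm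
    obtain ⟨e1, n1, n2⟩ := qPoch_split_ne hp hDK
    have hE : q ^ ((m : ℂ) * b2 + t * (c2 - b1 - f - n + 1) - s * (d - b1))
        = q ^ (m * b2 + t * (c2 - b1 - f - n + 1)) * q ^ (1 * (s : ℂ) * (s + u + (b1 - K)
          + (b2 - d - m + 1) - b2 - -m - 1)) := by
      rw [← h.cpow_add]; congr 1; rw [hKc]; ring
    simp only [qTerm, C]
    rw [hE, e1, qRF_sub h m s, mul_inv, show b1 - (k : ℂ) + (s + t : ℕ) = b1 - K + s by
      rw [hkc]; push_cast; ring, pow_add]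
    rcases lt_or_ge m s with hms | hms
    · simp [qPoch_neg_nat_eq_zero (q := q) hms]
    have e2 := qPoch_sub_mul_qPoch (q := q) (d - b2) (b2 - d - m + 1) hms (by ring)
    have i1 := mul_inv_cancel₀ n1
    have i2 := mul_inv_cancel₀ n2
    generalize q ^ ((m : ℂ) * b2 + t * (c2 - b1 - f - n + 1)) = E1
    generalize q ^ (1 * (s : ℂ) * (s + u + (b1 - K) + (b2 - d - m + 1) - b2 - -m - 1)) = E2
    trans (qFact q m * qRF q m) * (qPoch q (d - b2) (m - s) * qPoch q (b2 - d - m + 1) s)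
      * (qPoch q (b2 - d - m + 1) s)⁻¹ * ((-1) ^ s * (-1) ^ s) * (-1) ^ t * qFact q k * (qRF q s
      * qRF q t * qRF q u) * qPoch q (-m) s * qPoch q b2 s * (qPoch q c2 t * qPoch q (-n) t
      / qPoch q f t) * qPoch q (b1 - K + s) u * (E1 * E2)
    · rw [div_eq_mul_inv]
      linear_combination (-(qFact q m * qRF q m) * qPoch q (d - b2) (m - s)
        * ((-1) ^ s * (-1) ^ s) * (-1) ^ t * qFact q k * (qRF q s
        * qRF q t * qRF q u) * qPoch q (-m) s * qPoch q b2 s * (qPoch q c2 t * qPoch q (-n) t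
        * (qPoch q f t)⁻¹) * qPoch q (b1 - K + s) u * (E1 * E2)) * i1
    · rw [im, e2, neg_one_sq_pow, div_eq_mul_inv]
      trans (qFact q K * qRF q K) * (qPoch q (b2 - d - m + 1 + s) u
        * (qPoch q (b2 - d - m + 1 + s) u)⁻¹) * ((-1) ^ s * qPoch q (d - b2) m
        * (qPoch q (b2 - d - m + 1) s)⁻¹ * (-1) ^ t * qFact q k * (qRF q s
        * qRF q t * qRF q u) * qPoch q (-m) s * qPoch q b2 s * (qPoch q c2 t * qPoch q (-n) t
        * (qPoch q f t)⁻¹) * qPoch q (b1 - K + s) u * (E1 * E2))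
      · rw [iK, i2]; ring
      · ring
  · rw [key, ← mul_assoc, mul_sum, sum_mul]
    refine sum_congr rfl ?_
    rintro ⟨s, u⟩ hp
    have hp : s + u = K := HasAntidiagonal.mem_antidiagonal.mp hp
    have hKc : (K : ℂ) = s + u := by exact_mod_cast hp.symm
    obtain ⟨e1, n1, n2⟩ := qPoch_split_ne hp hDK
    obtain ⟨e3, n3, n4⟩ := qPoch_split_ne (s := s + t) (r := u) (by omega) hZ0
    have hE : q ^ ((m : ℂ) * b2 + t * (c2 - b1 - f - n + 1)) * q ^ (1 * (K : ℂ)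
          * (b2 - d - m + 1 - b2 - -m)) * q ^ (1 * (s : ℂ) * (s + u + (b1 - K
          + (b2 - d - m + 1) - b2 - -m) + (b2 - d - m + 1) - (b2 - d - m + 1 - b2)
          - (b2 - d - m + 1 - -m) - 1))
        = q ^ (s * (b1 - 1) + t * (d - f - b1 + c2 - n)) * q ^ (-k * (d - 1) + m * b2) := by
      rw [← h.cpow_add, ← h.cpow_add, ← h.cpow_add]; congr 1; rw [hkc, hKc]; ring
    simp only [qTerm, C, qKdFTerm, qPochs_cons, qPochs_nil, mul_one]
    rw [e1, e3, qPoch_neg_nat h (s := s + t) (r := u) (m := k) (by omega), pow_add,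
      show b2 - d - m + 1 - b2 = 1 - d - m by ring, show b2 - d - m + 1 - -m = b2 - d + 1 by ring,
      show b1 - K + (b2 - d - m + 1) - b2 - -m + s = b1 - k - d + 1 + (s + t : ℕ) by
        rw [hkc]; push_cast; ring]
    rw [show b2 - d - m + 1 - b2 = 1 - d - m by ring,
      show b2 - d - m + 1 - -m = b2 - d + 1 by ring] at hE
    have i2 := mul_inv_cancel₀ n2
    have i3 := mul_inv_cancel₀ n3
    simp only [div_eq_mul_inv, mul_inv]
    trans (qFact q K * qRF q K) * (qPoch q (b2 - d - m + 1 + s) u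
      * (qPoch q (b2 - d - m + 1 + s) u)⁻¹) * ((-1) ^ s * (-1) ^ t * qFact q k
      * (qPoch q (b2 - d - m + 1) s)⁻¹ * qPoch q (d - b2) m * qRF q s * qRF q t * qRF q u
      * qPoch q c2 t * qPoch q (-n) t * (qPoch q f t)⁻¹ * qPoch q (1 - d - m) s
      * qPoch q (b2 - d + 1) s * qPoch q (b1 - k - d + 1 + (s + t : ℕ)) u
      * (q ^ (s * (b1 - 1) + t * (d - f - b1 + c2 - n)) * q ^ (-k * (d - 1) + m * b2)))
    · rw [← hE]; ring
    · rw [iK, i2]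
      linear_combination (-((-1) ^ s * (-1) ^ t * qFact q k
      * (qPoch q (b2 - d - m + 1) s)⁻¹ * qPoch q (d - b2) m * qRF q s * qRF q t * qRF q u
      * qPoch q c2 t * qPoch q (-n) t * (qPoch q f t)⁻¹ * qPoch q (1 - d - m) s
      * qPoch q (b2 - d + 1) s * qPoch q (b1 - k - d + 1 + (s + t : ℕ)) u
      * (q ^ (s * (b1 - 1) + t * (d - f - b1 + c2 - n)) * q ^ (-k * (d - 1) + m * b2)))) * i3

/-- The passage X–Y–G repeated on the triangle s + t + u = k. The weight W collects the factors that
neither step touches. -/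
lemma kdfA_eq_kdfG (h : QAdm q) (hd : qPoch q d m ≠ 0) (hk : qPoch q (b1 - k) k ≠ 0)
    (hf : qPoch q f k ≠ 0)
    (hT : ∀ t, t ≤ k → qPoch q (-n) t = 0 ∨ qPoch q (b1 - k) (t + m) ≠ 0)
    (hZ : qPoch q (1 - b1 - m - n) k ≠ 0) (hD : qPoch q (d - b2) m ≠ 0) :
    kdfA q b1 (-k) b2 c2 d f m n = kdfG q b1 (-k) b2 c2 d f m n := by
  have hk' := qPoch_reflect (q := q) (b1 - k) (1 - b1) k (by ring)
  have hZ' := qPoch_reflect (q := q) (b1 + m + n - k) (1 - b1 - m - n) k (by ring)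
  apply mul_right_cancel₀ (mul_ne_zero (mul_ne_zero hd hk) hf)
  have im := qFact_mul_qRF h (n := m) (by omega)
  have ik := qFact_mul_qRF h (n := k) (by omega)
  let W : ℕ → ℕ → ℕ → ℂ := fun s t u => qRF q s * qRF q t * qRF q u * qRF q ((m : ℤ) - s)
    * qPoch q (d - b2) (m - s)
  have hA : kdfA q b1 (-k) b2 c2 d f m n * (qPoch q d m * qPoch q (b1 - k) k * qPoch q f k)
      = qFact q m * qFact q k * ∑ p ∈ antidiagonal k, ∑ u ∈ antidiagonal p.2,
        (-1) ^ (p.1 + u.1) * W p.1 u.1 u.2 * qPoch q b2 p.1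
          * (qPoch q c2 u.1 * qPoch q (-n) u.1 * qPoch q (f + u.1) (u.2 + p.1))
          * qPoch q (b1 - k + (p.1 + u.1 : ℕ)) u.2
          * q ^ (m * b2 + u.1 * (c2 - b1 - f - n + 1) - p.1 * (d - b1)) := by
    rw [← mul_assoc, kdfA_neg_eq_triple h hd hk hT, mul_assoc, ← sum_antidiagonal_triple_swap k
      (g := fun s t u => (-1) ^ (s + t) * W s t u * qPoch q b2 s
          * (qPoch q c2 t * qPoch q (-n) t * qPoch q (f + t) (u + s))
          * qPoch q (b1 - k + (s + t : ℕ)) u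
          * q ^ (m * b2 + t * (c2 - b1 - f - n + 1) - s * (d - b1)))]
    congr 1
    rw [sum_mul]
    refine sum_congr rfl ?_
    rintro ⟨t, K⟩ hu
    have hu : t + K = k := HasAntidiagonal.mem_antidiagonal.mp hu
    rw [sum_mul]
    refine sum_congr rfl ?_
    rintro ⟨s, u⟩ hp
    have hp : s + u = K := HasAntidiagonal.mem_antidiagonal.mp hp
    obtain ⟨e1, n1, -⟩ := qPoch_split_ne (s := t) (r := u + s) (by omega) hf
    simp only [W, div_eq_mul_inv]
    have i1 := mul_inv_cancel₀ n1
    rw [e1]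
    linear_combination ((-1) ^ (s + t) * (qRF q s * qRF q t * qRF q u) * qRF q ((m : ℤ) - s)
          * qPoch q (d - b2) (m - s) * qPoch q b2 s
          * (qPoch q c2 t * qPoch q (-n) t * qPoch q (f + t) (u + s))
          * qPoch q (b1 - k + (s + t : ℕ)) u
          * q ^ (m * b2 + t * (c2 - b1 - f - n + 1) - s * (d - b1))) * i1
  -- Step X–Y: for fixed s the index t is transformed with -n as distinguished parameter, the length
  -- being k - s.
  have hY : ∑ p ∈ antidiagonal k, ∑ u ∈ antidiagonal p.2,
        (-1) ^ (p.1 + u.1) * W p.1 u.1 u.2 * qPoch q b2 p.1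
          * (qPoch q c2 u.1 * qPoch q (-n) u.1 * qPoch q (f + u.1) (u.2 + p.1))
          * qPoch q (b1 - k + (p.1 + u.1 : ℕ)) u.2
          * q ^ (m * b2 + u.1 * (c2 - b1 - f - n + 1) - p.1 * (d - b1))
      = ∑ p ∈ antidiagonal k, ∑ u ∈ antidiagonal p.2,
        (-1) ^ p.1 * W p.1 u.1 u.2 * qPoch q b2 p.1
          * (qPoch q (f - c2) u.1 * qPoch q (-n) u.1 * qPoch q (f + u.1) (u.2 + p.1))
          * qPoch q (b1 - k + n + p.1) u.2
          * q ^ (m * b2 - k * n + p.1 * n - u.1 * (b1 - k + p.1 - c2) - p.1 * (d - b1)) := by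
    refine sum_congr rfl ?_
    rintro ⟨s, K⟩ hp
    have hp : s + K = k := HasAntidiagonal.mem_antidiagonal.mp hp
    have hkc : (k : ℂ) = s + K := by exact_mod_cast hp.symm
    simp only
    have key := qSer_transform h (Or.inr rfl) (-n) c2 (b1 - k + s) f K
    rw [qSer] at key
    let C := (-1) ^ s * qRF q s * qRF q ((m : ℤ) - s) * qPoch q (d - b2) (m - s) * qPoch q b2 s
      * qPoch q (f + K) s * q ^ (m * b2 - s * (d - b1))
    trans C * ∑ u ∈ antidiagonal K, qTerm q (-1) (-n) c2 (b1 - k + s) f u.1 u.2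
    · rw [mul_sum]
      refine sum_congr rfl ?_
      rintro ⟨t, u⟩ hu
      have hu : t + u = K := HasAntidiagonal.mem_antidiagonal.mp hu
      have hKc : (K : ℂ) = t + u := by exact_mod_cast hu.symm
      have hE : q ^ (m * b2 + t * (c2 - b1 - f - n + 1) - s * (d - b1))
          = q ^ (m * b2 - s * (d - b1)) * q ^ (-1 * (t : ℂ) * (t + u + (b1 - k + s) + f
            - -n - c2 - 1)) := by
        rw [← h.cpow_add]; congr 1; rw [hkc, hKc]; ring
      simp only [qTerm, C, W]
      rw [hE, qPoch_add (f + t) u s, hKc, show f + (t + u : ℂ) = f + t + u by ring, pow_add,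
        show b1 - k + ((s + t : ℕ) : ℂ) = b1 - k + s + t by push_cast; ring]
      ring
    · rw [key, ← mul_assoc, mul_sum]
      refine sum_congr rfl ?_
      rintro ⟨t, u⟩ hu
      have hu : t + u = K := HasAntidiagonal.mem_antidiagonal.mp hu
      have hKc : (K : ℂ) = t + u := by exact_mod_cast hu.symm
      have hE : q ^ (m * b2 - k * n + s * n - t * (b1 - k + s - c2) - s * (d - b1))
          = q ^ (m * b2 - s * (d - b1)) * q ^ (-(-1 * (K : ℂ) * -n))
            * q ^ (-1 * (t : ℂ) * (b1 - k + s - c2)) := by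
        rw [← h.cpow_add, ← h.cpow_add]; congr 1; rw [hkc, hKc]; ring
      simp only [C, W]
      rw [hE, qPoch_add (f + t) u s, show f + (K : ℂ) = f + t + u by rw [hKc]; ring,
        show b1 - k + s - -n = b1 - k + n + s by ring]
      ring
  -- Step Y–G: for fixed t the index s has the two terminators k - t and m, in either order, whence
  -- `sum_two_terminators`.
  have hG : ∑ u ∈ antidiagonal k, ∑ p ∈ antidiagonal u.2,
        (-1) ^ p.1 * W p.1 u.1 p.2 * qPoch q b2 p.1
          * (qPoch q (f - c2) u.1 * qPoch q (-n) u.1 * qPoch q (f + u.1) (p.2 + p.1))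
          * qPoch q (b1 - k + n + p.1) p.2
          * q ^ (m * b2 - k * n + p.1 * n - u.1 * (b1 - k + p.1 - c2) - p.1 * (d - b1))
      = ∑ u ∈ antidiagonal k, ∑ p ∈ antidiagonal u.2,
        W p.1 u.1 p.2 * qPoch q (1 - d - m) p.1
          * (qPoch q (f - c2) u.1 * qPoch q (-n) u.1 * qPoch q (f + u.1) (p.2 + p.1))
          * qPoch q (b1 + m + n - k) p.2
          * q ^ (m * b2 - k * n + m * k + p.1 * (b1 - k - b2 + n) - u.1 * (b1 - k - c2 + m)) := by
    refine sum_congr rfl ?_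
    rintro ⟨t, K⟩ hu
    have hu : t + K = k := HasAntidiagonal.mem_antidiagonal.mp hu
    have hkc : (k : ℂ) = t + K := by exact_mod_cast hu.symm
    simp only
    have key := sum_two_terminators h (b1 - k + n) b2 d K m
    let C := qRF q t * (qPoch q (f - c2) t * qPoch q (-n) t * qPoch q (f + t) K)
      * q ^ (m * b2 - k * n - t * (b1 - k - c2))
    trans C * ∑ p ∈ antidiagonal K, (-1) ^ p.1 * qRF q p.1 * qRF q ((K : ℤ) - p.1)
        * qRF q ((m : ℤ) - p.1) * qPoch q b2 p.1 * qPoch q (d - b2) (m - p.1)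
        * qPoch q (b1 - k + n + p.1) (K - p.1) * q ^ (p.1 * (b1 - k + n + K - d))
    · rw [mul_sum]
      refine sum_congr rfl ?_
      rintro ⟨s, u⟩ hp
      have hp : s + u = K := HasAntidiagonal.mem_antidiagonal.mp hp
      have hE : q ^ (m * b2 - k * n + s * n - t * (b1 - k + s - c2) - s * (d - b1))
          = q ^ (m * b2 - k * n - t * (b1 - k - c2)) * q ^ (s * (b1 - k + n + K - d)) := by
        rw [← h.cpow_add]; congr 1; rw [hkc]; ring
      simp only [C, W]
      rw [hE, show u + s = K by omega, show K - s = u by omega,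
        show (K : ℤ) - s = u by omega]
      ring
    · rw [key, ← mul_assoc, mul_sum]
      refine sum_congr rfl ?_
      rintro ⟨s, u⟩ hp
      have hp : s + u = K := HasAntidiagonal.mem_antidiagonal.mp hp
      have hE : q ^ (m * b2 - k * n + m * k + s * (b1 - k - b2 + n) - t * (b1 - k - c2 + m))
          = q ^ (m * b2 - k * n - t * (b1 - k - c2)) * q ^ ((m : ℂ) * K)
            * q ^ (s * (b1 - k + n - b2)) := by
        rw [← h.cpow_add, ← h.cpow_add]; congr 1; rw [hkc]; ring
      simp only [C, W]
      rw [hE, show u + s = K by omega, show K - s = u by omega,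
        show (K : ℤ) - s = u by omega, show b1 - k + n + m = b1 + m + n - k by ring]
      ring
  have hK : kdfG q b1 (-k) b2 c2 d f m n * (qPoch q d m * qPoch q (b1 - k) k * qPoch q f k)
      = qKdF 1 [(-k : ℂ)] [1 - b1 - m - n] [1 - d - m, -m] [b2 - d - m + 1] [f - c2, -n] [f]
      (q ^ (b1 - k - b2 + n)) (q ^ (b1 - k - c2 + m)) q
      * (q ^ (m * (b2 + k) - k * n) * qPoch q (d - b2) m * qPoch q (b1 + m + n - k) k
        * qPoch q f k) := by
    unfold kdfG qPochRatio
    rw [if_pos (by omega)]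
    push_cast
    simp only [neg_neg, Int.toNat_natCast]
    rw [show -b1 + 1 = 1 - b1 by ring, show -b1 - m - n + 1 = 1 - b1 - m - n by ring, hk', hZ',
      ← sub_eq_add_neg b1, sub_neg_eq_add, show m * (b2 + k) + -(k : ℂ) * n = m * (b2 + k) - k * n
        by ring]
    have := neg_one_pow_ne_zero (R := ℂ) k
    generalize q ^ (m * (b2 + k) - k * n) = E
    generalize qKdF _ _ _ _ _ _ _ _ _ _ = Z
    generalize qPoch q (b1 - k) k = B at *
    field_simp
  rw [hA, hY, ← sum_antidiagonal_triple_swap k (g := fun s t u =>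
        (-1) ^ s * W s t u * qPoch q b2 s
          * (qPoch q (f - c2) t * qPoch q (-n) t * qPoch q (f + t) (u + s))
          * qPoch q (b1 - k + n + s) u
          * q ^ (m * b2 - k * n + s * n - t * (b1 - k + s - c2) - s * (d - b1))), hG, hK,
    qKdF_eq_triple h (-1) 0 k
    (fun s t => s * (b1 - k - b2 + n) - t * (b1 - k - c2 + m)) (by simp) (by simp)
    (by intro s t; push_cast; ring) (by intro s hs; simp [qPoch_neg_nat_eq_zero hs]),
    sum_mul, mul_sum]
  refine sum_congr rfl ?_
  rintro ⟨t, K⟩ hu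
  have hu : t + K = k := HasAntidiagonal.mem_antidiagonal.mp hu
  rw [sum_mul, mul_sum]
  refine sum_congr rfl ?_
  rintro ⟨s, u⟩ hp
  have hp : s + u = K := HasAntidiagonal.mem_antidiagonal.mp hp
  have hkc : (k : ℂ) = s + t + u := by exact_mod_cast (by omega : k = s + t + u)
  simp only [W, qKdFTerm, qPochs_cons, qPochs_nil, mul_one]
  rw [qRF_sub h m s]
  rcases lt_or_ge m s with hms | hms
  · simp [qPoch_neg_nat_eq_zero (q := q) hms]
  have e2 := qPoch_sub_mul_qPoch (q := q) (d - b2) (b2 - d - m + 1) hms (by ring)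
  have n2 : qPoch q (b2 - d - m + 1) s ≠ 0 := by
    intro h0
    rw [h0, mul_zero] at e2
    exact mul_ne_zero (neg_one_pow_ne_zero (R := ℂ) s) hD e2.symm
  have n3 := qPoch_ne_of_le (m := s + t) (by omega) hZ
  have r3 := qPoch_reflect (q := q) (b1 + m + n - k + u) (1 - b1 - m - n) (s + t)
    (by rw [hkc]; push_cast; ring)
  have e3 : qPoch q (b1 + m + n - k) k = qPoch q (b1 + m + n - k) u
      * qPoch q (b1 + m + n - k + u) (s + t) := by
    rw [← qPoch_add]; congr 1; omega
  obtain ⟨e1, n1, -⟩ := qPoch_split_ne (s := t) (r := u + s) (by omega) hf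
  have hE : q ^ (m * b2 - k * n + m * k + s * (b1 - k - b2 + n) - t * (b1 - k - c2 + m))
      = q ^ (s * (b1 - k - b2 + n) - t * (b1 - k - c2 + m)) * q ^ (m * (b2 + k) - k * n) := by
    rw [← h.cpow_add]; congr 1; ring
  rw [hE, e1, e3, qPoch_neg_nat h (s := s + t) (r := u) (m := k) (by omega)]
  have e2' : qPoch q (d - b2) m = (-1) ^ s * (qPoch q (d - b2) (m - s)
      * qPoch q (b2 - d - m + 1) s) := by
    rw [e2, ← mul_assoc, neg_one_sq_pow, one_mul]
  have r3' : qPoch q (b1 + m + n - k + u) (s + t) = (-1) ^ (s + t)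
      * qPoch q (1 - b1 - m - n) (s + t) := by
    rw [r3, ← mul_assoc, neg_one_sq_pow, one_mul]
  rw [e2', r3']
  have i1 := mul_inv_cancel₀ n1
  have i2 := mul_inv_cancel₀ n2
  have i3 := mul_inv_cancel₀ n3
  have hs := neg_one_sq_pow (s + t)
  generalize q ^ (s * (b1 - k - b2 + n) - t * (b1 - k - c2 + m)) = E1
  generalize q ^ (m * (b2 + k) - k * n) = E2
  simp only [div_eq_mul_inv, mul_inv]
  trans (qFact q m * qRF q m) * ((-1) ^ s * qFact q k * (qRF q s * qRF q t * qRF q u)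
    * qPoch q (d - b2) (m - s) * qPoch q (-m) s * qPoch q (1 - d - m) s
    * (qPoch q (f - c2) t * qPoch q (-n) t * qPoch q (f + t) (u + s))
    * qPoch q (b1 + m + n - k) u * (E1 * E2))
  · ring
  rw [im]
  symm
  trans ((-1) ^ (s + t) * (-1) ^ (s + t)) * (qPoch q f t * (qPoch q f t)⁻¹)
    * (qPoch q (b2 - d - m + 1) s * (qPoch q (b2 - d - m + 1) s)⁻¹)
    * (qPoch q (1 - b1 - m - n) (s + t) * (qPoch q (1 - b1 - m - n) (s + t))⁻¹)
    * ((-1) ^ s * qFact q k * (qRF q s * qRF q t * qRF q u)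
    * qPoch q (d - b2) (m - s) * qPoch q (-m) s * qPoch q (1 - d - m) s
    * (qPoch q (f - c2) t * qPoch q (-n) t * qPoch q (f + t) (u + s))
    * qPoch q (b1 + m + n - k) u * (E1 * E2))
  · ring
  · rw [hs, i1, i2, i3]; ring

lemma qPoch_sub_ne_of_one_sub (hk : qPoch q (1 - b1) k ≠ 0) : qPoch q (b1 - k) k ≠ 0 := by
  intro h0
  rw [qPoch_reflect (b1 - k) (1 - b1) k (by ring), h0, mul_zero] at hk
  exact hk rfl

theorem kdfA_identities_neg (h : QAdm q) (b1 : ℂ) (k : ℕ) (b2 c2 d f : ℂ) (m n : ℕ)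
    (h0 : qPoch q (b1 - k) (m + n) ≠ 0) (hd : qPoch q d m ≠ 0) (hk : qPoch q (1 - b1) k ≠ 0) :
    (qPoch q f k ≠ 0 → qPoch q (f - c2 + b1 - k + n) (m + k) ≠ 0 →
        kdfA q b1 (-k) b2 c2 d f m n = kdfD q b1 (-k) b2 c2 d f m n) ∧
      (qPoch q (d - b1) k ≠ 0 → qPoch q (b2 - d - m + 1) k ≠ 0 →
        kdfA q b1 (-k) b2 c2 d f m n = kdfH q b1 (-k) b2 c2 d f m n) := by
  -- For natural n the terms with t > n vanish, and (b1-k)_{m+n} ≠ 0 controls the others.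
  have hT : ∀ t, t ≤ k → qPoch q (-(n : ℂ)) t = 0 ∨ qPoch q (b1 - k) (t + m) ≠ 0 := by
    intro t _
    rcases lt_or_ge n t with ht | ht
    · exact Or.inl (qPoch_neg_nat_eq_zero ht)
    · exact Or.inr (qPoch_ne_of_le (by omega) h0)
  have hk' := qPoch_sub_ne_of_one_sub hk
  exact ⟨fun hf hZ => kdfA_eq_kdfD h hk' hd hf hZ hT,
    fun hZ hD => kdfA_eq_kdfH h hd hk' hT hZ hD⟩

theorem kdfA_identities_neg_complex (h : QAdm q) (b1 : ℂ) (k : ℕ) (b2 c2 d f : ℂ) (m : ℕ) (n : ℂ)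
    (h0 : qPoch q (b1 - k) (m + k) ≠ 0) (hd : qPoch q d m ≠ 0) (hf : qPoch q f k ≠ 0)
    (hk : qPoch q (1 - b1) k ≠ 0) :
    (qPoch q (f - c2 + b1 - k + n) (m + k) ≠ 0 →
        kdfA q b1 (-k) b2 c2 d f m n = kdfD q b1 (-k) b2 c2 d f m n) ∧
      (qPoch q (d - b2) m ≠ 0 → qPoch q (1 - b1 - m - n) k ≠ 0 →
        kdfA q b1 (-k) b2 c2 d f m n = kdfG q b1 (-k) b2 c2 d f m n) ∧
      (qPoch q (d - b1) k ≠ 0 → qPoch q (b2 - d - m + 1) k ≠ 0 →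
        kdfA q b1 (-k) b2 c2 d f m n = kdfH q b1 (-k) b2 c2 d f m n) := by
  have hT : ∀ t, t ≤ k → qPoch q (-n) t = 0 ∨ qPoch q (b1 - k) (t + m) ≠ 0 :=
    fun t _ => Or.inr (qPoch_ne_of_le (by omega) h0)
  have hk' := qPoch_sub_ne_of_one_sub hk
  exact ⟨fun hZ => kdfA_eq_kdfD h hk' hd hf hZ hT,
    fun hD hZ => kdfA_eq_kdfG h hd hk' hf hT hZ hD,
    fun hZ hD => kdfA_eq_kdfH h hd hk' hT hZ hD⟩

end NegativeParameter

/-! ### One-variable transformations of q-factorial sums. -/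

section Factorials

variable {x : ℂ} {y z : ℤ} {k : ℕ}

lemma qFact_eq_mul_qPoch (h : QAdm q) (hx : x = y + 1) (hz : z = y + k) (hy : 0 ≤ y) :
    qFact q z = qFact q y * qPoch q x k := by
  rw [qPoch_eq_fact h hx hz (by omega)]
  linear_combination -qFact q z * qFact_mul_qRF h hy

lemma qFact_eq_mul_qPoch_neg (h : QAdm q) (hx : x = -z) (hz : z = y + k) (hy : 0 ≤ y) :
    qFact q z = (-1) ^ k * qFact q y * qPoch q x k := by
  rw [qPoch_neg_eq_fact h hx (z := y) (by omega) (by omega)]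
  linear_combination -qFact q z * qFact_mul_qRF h hy
    - qFact q y * qRF q y * qFact q z * neg_one_sq_pow k

lemma qRF_sub_eq (h : QAdm q) (hx : x = -y) (hz : z = y - k) :
    qRF q z = (-1) ^ k * qPoch q x k * qRF q y := by
  rw [mul_assoc, qPoch_neg_mul_qRF h hx hz, ← mul_assoc, neg_one_sq_pow, one_mul]

end Factorials

section FactorialSums

/-- Besides a, and L on the right, the factor 1/[n-s]! also terminates. Taking n as the length, the
numerator parameters are c+1, -a and the denominator ones m+1, -e; the transformation replaces -a by
-e + a = -L, so the range of length a becomes one of length e - a. -/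
lemma sum_fact_transform_cut (h : QAdm q) {c e m n : ℤ} {a L : ℕ} (hc : 0 ≤ c)
    (he : e = a + L) (hn : n ≤ e) (hm : m ≤ c) :
    ∑ p ∈ antidiagonal a, (-1) ^ p.1 * (qFact q (c + p.1) * qFact q (e - p.1))
        * (qRF q p.1 * qRF q p.2 * qRF q (n - p.1) * qRF q (m + p.1))
        * q ^ (p.1 * ((c : ℂ) + e - m - n - a + 1))
      = (-1) ^ n * (qFact q L * qRF q a * qRF q (m + n) * qFact q (c - m))
        * ∑ p ∈ antidiagonal L, (-1) ^ p.1 * (qFact q (c + p.1) * qFact q (e - p.1))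
          * (qRF q p.1 * qRF q p.2 * qRF q (n - p.1) * qRF q (c - m - n + p.1))
          * q ^ (n * ((c : ℂ) + 1) - p.1 * ((m : ℂ) + a + 1)) := by
  rcases lt_or_ge n 0 with hn0 | hn0
  · rw [sum_eq_zero, sum_eq_zero, mul_zero] <;>
    · intro p _
      simp [qRF_neg (q := q) (n := n - p.1) (by omega)]
  obtain ⟨n, rfl⟩ := Int.eq_ofNat_of_zero_le hn0
  -- The product 1/([K-s]! [n-s]!) vanishes beyond either bound, so a sum up to K may be cut at n.
  have hsw : ∀ (K : ℕ) (g : ℕ → ℂ), ∑ p ∈ antidiagonal K, g p.1 * qRF q p.2 * qRF q (n - p.1 : ℤ)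
      = ∑ p ∈ antidiagonal n, g p.1 * qRF q (K - p.1 : ℤ) * qRF q p.2 := by
    intro K g
    trans ∑ p ∈ antidiagonal K, g p.1 * qRF q (K - p.1 : ℤ) * qRF q (n - p.1 : ℤ)
    · refine sum_congr rfl ?_
      rintro ⟨s, r⟩ hp
      have hp : s + r = K := HasAntidiagonal.mem_antidiagonal.mp hp
      rw [show (K : ℤ) - s = r by omega]
    · rw [sum_antidiagonal_switch
        (g := fun s => g s * qRF q (K - s : ℤ) * qRF q (n - s : ℤ)) (n := n)]
      · refine sum_congr rfl ?_
        rintro ⟨s, r⟩ hp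
        have hp : s + r = n := HasAntidiagonal.mem_antidiagonal.mp hp
        simp only
        rw [show (n : ℤ) - s = r by omega]
      · intro s hs
        simp [qRF_neg (q := q) (n := K - s) (by omega)]
      · intro s hs
        simp [qRF_neg (q := q) (n := n - s) (by omega)]
  have h1 := hsw a fun s => (-1) ^ s * (qFact q (c + s) * qFact q (e - s)) * qRF q s
    * qRF q (m + s) * q ^ (s * ((c : ℂ) + e - m - (n : ℤ) - a + 1))
  have h2 := hsw L fun s => (-1) ^ s * (qFact q (c + s) * qFact q (e - s)) * qRF q s
    * qRF q (c - m - n + s) * q ^ ((n : ℤ) * ((c : ℂ) + 1) - s * ((m : ℂ) + a + 1))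
  have key := qSer_transform h (Or.inr rfl) (c + 1) (-a) (m + 1) (-e) n
  rw [qSer] at key
  trans ((-1) ^ n * qFact q c * qFact q (e - n) * qRF q a * qRF q (m + n))
    * ∑ p ∈ antidiagonal n, qTerm q (-1) (c + 1) (-a) (m + 1) (-e) p.1 p.2
  · trans
    · refine Eq.trans (sum_congr rfl fun p _ => ?_) h1
      ring
    rw [mul_sum]
    refine sum_congr rfl ?_
    rintro ⟨s, r⟩ hp
    have hp : s + r = n := HasAntidiagonal.mem_antidiagonal.mp hp
    have hnc : (n : ℂ) = s + r := by exact_mod_cast hp.symm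
    simp only [qTerm]
    rw [qFact_eq_mul_qPoch h (x := c + 1) (y := c) (z := c + s) (k := s) rfl rfl hc,
      qFact_eq_mul_qPoch_neg h (x := -e + s) (y := e - n) (z := e - s) (k := r)
        (by push_cast; ring) (by omega) (by omega), qRF_sub h a s,
      ← qPoch_mul_qRF h (x := m + 1 + s) (y := m + s) (z := m + n) (k := r) (by push_cast; ring)
        (by omega)]
    rw [show (s : ℂ) * ((c : ℂ) + e - m - (n : ℤ) - a + 1)
      = -1 * s * (s + r + (m + 1) + -e - (c + 1) - -a - 1) by push_cast; rw [hnc]; ring,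
      show ((-1 : ℂ)) ^ n = (-1) ^ s * (-1) ^ r by rw [← pow_add, hp]]
    rcases neg_one_pow_eq_or ℂ s with hs | hs <;> rw [hs] <;> ring
  · rw [key]
    symm
    trans
    · refine congrArg _ (Eq.trans (sum_congr rfl fun p _ => ?_) h2)
      ring
    rw [zpow_natCast, mul_sum, mul_sum, mul_sum]
    refine sum_congr rfl ?_
    rintro ⟨s, r⟩ hp
    have hp : s + r = n := HasAntidiagonal.mem_antidiagonal.mp hp
    have hnc : (n : ℂ) = s + r := by exact_mod_cast hp.symm
    simp only
    rw [qFact_eq_mul_qPoch h (x := c + 1) (y := c) (z := c + s) (k := s) rfl rfl hc,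
      qFact_eq_mul_qPoch_neg h (x := -e + s) (y := e - n) (z := e - s) (k := r)
        (by push_cast; ring) (by omega) (by omega), qRF_sub h L s,
      qRF_sub_eq h (x := m + 1 - (c + 1)) (y := c - m) (z := c - m - n + s) (k := r)
        (by push_cast; ring) (by omega),
      show q ^ ((n : ℤ) * ((c : ℂ) + 1) - s * ((m : ℂ) + a + 1))
        = q ^ (-(-1 * (n : ℂ) * (c + 1))) * q ^ (-1 * (s : ℂ) * (m + 1 - -a)) by
        rw [← h.cpow_add]; congr 1; push_cast; ring,
      show -(e : ℂ) - -a = -L by rw [he]; push_cast; ring]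
    have i1 := qFact_mul_qRF h (n := L) (by omega)
    have i2 := qFact_mul_qRF h (n := c - m) (by omega)
    trans (qFact q L * qRF q L) * (qFact q (c - m) * qRF q (c - m)) * ((-1) ^ n * qRF q a
      * qRF q (m + n) * ((-1) ^ s * (-1) ^ s * ((-1) ^ r * (-1) ^ r)) * qFact q c
      * qPoch q (c + 1) s * qFact q (e - n) * qPoch q (-e + s) r * qRF q s * qRF q r
      * qPoch q (-L) s * qPoch q (m + 1 - (c + 1)) r
      * (q ^ (-(-1 * (n : ℂ) * (c + 1))) * q ^ (-1 * (s : ℂ) * (m + 1 - -a))))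
    · ring
    · rw [i1, i2, neg_one_sq_pow, neg_one_sq_pow]; ring

variable {c d : ℂ} {g n : ℤ} {b : ℕ}

lemma sum_fact_eq_qSer (h : QAdm q) (hg : b ≤ g) :
    ∑ p ∈ antidiagonal b, (-1) ^ p.1 * qFact q (g - p.1) * (qRF q p.1 * qRF q p.2)
        * qRF q (n - p.1) * qPoch q c p.1 * qPoch q (d + p.1) p.2
        * q ^ (p.1 * (b + d - g - c + n - 1))
      = (-1) ^ b * qFact q (g - b) * qRF q n * qSer q 1 c (-n) d (-g) b := by
  rw [qSer, mul_sum]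
  refine sum_congr rfl ?_
  rintro ⟨s, r⟩ hp
  have hp : s + r = b := HasAntidiagonal.mem_antidiagonal.mp hp
  have hnc : (b : ℂ) = s + r := by exact_mod_cast hp.symm
  simp only [qTerm]
  rw [qFact_eq_mul_qPoch_neg h (x := -g + s) (y := g - b) (z := g - s) (k := r)
      (by push_cast; ring) (by omega) (by omega),
    qRF_sub_eq h (x := -n) (y := n) (z := n - s) (k := s) rfl rfl,
    show (s : ℂ) * (b + d - g - c + n - 1) = 1 * s * (s + r + d + -g - c - -n - 1) by
      rw [hnc]; ring,
    show ((-1 : ℂ)) ^ b = (-1) ^ s * (-1) ^ r by rw [← pow_add, hp]]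
  ring

/-- In the series of `sum_fact_eq_qSer` the distinguished parameter is -n; in
`sum_fact_transform_den` it is c. The factor 1/[g-n]! stays on the left so that n > g, where both
sides vanish, needs no separate treatment. -/
lemma sum_fact_transform_num (h : QAdm q) (hg : b ≤ g) :
    qRF q (g - n) * ∑ p ∈ antidiagonal b, (-1) ^ p.1 * qFact q (g - p.1) * (qRF q p.1 * qRF q p.2)
        * qRF q (n - p.1) * qPoch q c p.1 * qPoch q (d + p.1) p.2
        * q ^ (p.1 * (b + d - g - c + n - 1))
      = qFact q (g - b) * ∑ p ∈ antidiagonal b, qRF q p.1 * qRF q p.2 * qRF q (n - p.1)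
        * qRF q (g - n - b + p.1) * qPoch q (d - c) p.1 * qPoch q (d + p.1) p.2
        * q ^ (b * n - p.1 * (g + c)) := by
  rw [sum_fact_eq_qSer h hg, qSer_comm_num, qSer_comm_den, qSer_transform h (Or.inl rfl),
    mul_sum, mul_sum, mul_sum, mul_sum]
  refine sum_congr rfl ?_
  rintro ⟨s, r⟩ hp
  have hp : s + r = b := HasAntidiagonal.mem_antidiagonal.mp hp
  simp only
  rw [qRF_sub_eq h (x := -n) (y := n) (z := n - s) (k := s) rfl rfl,
    qRF_sub_eq h (x := -g - -n) (y := g - n) (z := g - n - b + s) (k := r) (by push_cast; ring)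
      (by omega),
    show q ^ ((b : ℂ) * n - s * (g + c)) = q ^ (-(1 * (b : ℂ) * -n)) * q ^ (1 * (s : ℂ) * (-g - c))
      by rw [← h.cpow_add]; congr 1; ring,
    show ((-1 : ℂ)) ^ b = (-1) ^ s * (-1) ^ r by rw [← pow_add, hp]]
  ring

lemma sum_fact_transform_den (h : QAdm q) (hg : b ≤ g) :
    qRF q (g - n) * ∑ p ∈ antidiagonal b, (-1) ^ p.1 * qFact q (g - p.1) * (qRF q p.1 * qRF q p.2)
        * qRF q (n - p.1) * qPoch q c p.1 * qPoch q (d + p.1) p.2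
        * q ^ (p.1 * (b + d - g - c + n - 1))
      = qRF q n * ∑ p ∈ antidiagonal b, qRF q p.1 * qRF q p.2 * qFact q (g - p.1)
        * qRF q (g - n - p.1) * qPoch q c p.1 * qPoch q (d - c) p.2
        * q ^ (p.1 * (d + n) - b * c) := by
  rw [sum_fact_eq_qSer h hg, qSer_transform h (Or.inl rfl), mul_sum, mul_sum, mul_sum, mul_sum]
  refine sum_congr rfl ?_
  rintro ⟨s, r⟩ hp
  have hp : s + r = b := HasAntidiagonal.mem_antidiagonal.mp hp
  simp only
  rw [qFact_eq_mul_qPoch_neg h (x := -g + s) (y := g - b) (z := g - s) (k := r)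
      (by push_cast; ring) (by omega) (by omega),
    qRF_sub_eq h (x := -g - -n) (y := g - n) (z := g - n - s) (k := s) (by push_cast; ring) rfl,
    show q ^ ((s : ℂ) * (d + n) - b * c) = q ^ (-(1 * (b : ℂ) * c)) * q ^ (1 * (s : ℂ) * (d - -n))
      by rw [← h.cpow_add]; congr 1; ring,
    show ((-1 : ℂ)) ^ b = (-1) ^ s * (-1) ^ r by rw [← pow_add, hp]]
  ring

end FactorialSums

section FactorialSums

variable {a c e n k : ℤ} {L : ℕ}

/-- The length is L, the numerator parameters are c+1, -n and the denominator ones -e, k+1. In the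
application k + n does not depend on the other summation index, so the prefactors in k + n come out
of the double sum. -/
lemma sum_fact_transform_succ (h : QAdm q) (hc : 0 ≤ c) (ha : 0 ≤ a) (he : e = a + L)
    (hk : 0 ≤ k + n) :
    ∑ p ∈ antidiagonal L, (-1) ^ p.1 * (qFact q (c + p.1) * qFact q (e - p.1))
        * (qRF q p.1 * qRF q p.2 * qRF q (n - p.1) * qRF q (k + p.1))
        * q ^ (p.1 * ((k : ℂ) + n - a - c - 1))
      = qFact q a * qRF q (k + n) * qFact q (c + e + 1) * qRF q n
        * ∑ p ∈ antidiagonal L, (-1) ^ p.1 * (qFact q (c + p.1) * qFact q (k + n + p.1))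
          * (qRF q p.1 * qRF q p.2 * qRF q (k + p.1) * qRF q (a + c + 1 + p.1))
          * q ^ (p.1 * ((n : ℂ) - e) - L * (c + 1)) := by
  have key := qSer_transform h (Or.inl rfl) (c + 1) (-n) (-e) (k + 1) L
  rw [qSer] at key
  trans ((-1) ^ L * qFact q c * qFact q a * qRF q n * qRF q (k + L))
    * ∑ p ∈ antidiagonal L, qTerm q 1 (c + 1) (-n) (-e) (k + 1) p.1 p.2
  · rw [mul_sum]
    refine sum_congr rfl ?_
    rintro ⟨s, r⟩ hp
    have hp : s + r = L := HasAntidiagonal.mem_antidiagonal.mp hp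
    have hnc : (L : ℂ) = s + r := by exact_mod_cast hp.symm
    have hec : (e : ℂ) = a + s + r := by rw [he]; push_cast; rw [hnc]; ring
    simp only [qTerm]
    rw [qFact_eq_mul_qPoch h (x := c + 1) (y := c) (z := c + s) (k := s) rfl rfl hc,
      qFact_eq_mul_qPoch_neg h (x := -e + s) (y := a) (z := e - s) (k := r)
        (by push_cast; ring) (by omega) (by omega),
      qRF_sub_eq h (x := -n) (y := n) (z := n - s) (k := s) rfl rfl,
      ← qPoch_mul_qRF h (x := k + 1 + s) (y := k + s) (z := k + L) (k := r) (by push_cast; ring)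
        (by omega),
      show (s : ℂ) * ((k : ℂ) + n - a - c - 1)
        = 1 * s * (s + r + -e + (k + 1) - (c + 1) - -n - 1) by rw [hec]; ring,
      show ((-1 : ℂ)) ^ L = (-1) ^ s * (-1) ^ r by rw [← pow_add, hp]]
    ring
  · rw [key, mul_sum, mul_sum, mul_sum]
    refine sum_congr rfl ?_
    rintro ⟨s, r⟩ hp
    have hp : s + r = L := HasAntidiagonal.mem_antidiagonal.mp hp
    simp only
    rw [qFact_eq_mul_qPoch h (x := c + 1) (y := c) (z := c + s) (k := s) rfl rfl hc,
      qFact_eq_mul_qPoch h (x := k + 1 - -n) (y := k + n) (z := k + n + s) (k := s)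
        (by push_cast; ring) rfl hk,
      ← qPoch_mul_qRF h (x := k + 1 + s) (y := k + s) (z := k + L) (k := r) (by push_cast; ring)
        (by omega),
      qRF_sub_eq h (x := -e - (c + 1)) (y := c + e + 1) (z := a + c + 1 + s) (k := r)
        (by push_cast; ring) (by omega),
      show q ^ ((s : ℂ) * ((n : ℂ) - e) - L * (c + 1)) = q ^ (-(1 * (L : ℂ) * (c + 1)))
        * q ^ (1 * (s : ℂ) * (-e - -n)) by rw [← h.cpow_add]; congr 1; ring,
      show ((-1 : ℂ)) ^ L = (-1) ^ s * (-1) ^ r by rw [← pow_add, hp]]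
    have i1 := qFact_mul_qRF h hk
    have i2 := qFact_mul_qRF h (n := c + e + 1) (by omega)
    generalize q ^ (-(1 * (L : ℂ) * (c + 1))) = E1
    generalize q ^ (1 * (s : ℂ) * (-e - -n)) = E2
    symm
    trans (qFact q (k + n) * qRF q (k + n)) * (qFact q (c + e + 1) * qRF q (c + e + 1))
      * (qFact q a * qRF q n * (-1) ^ s * (-1) ^ r * qFact q c * qPoch q (c + 1) s
      * qPoch q (k + 1 - -n) s * qRF q s * qRF q r * qPoch q (k + 1 + s) r * qRF q (k + L)
      * qPoch q (-e - (c + 1)) r * (E1 * E2))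
    · ring
    · rw [i1, i2]; ring

/-- The sum reached by `sum_fact_transform_succ` is transformed once more with parameters k+n+1, c+1
over k+1, a+c+2; the symbol for (a+c+2) - (c+1) creates [a+s]!. -/
lemma sum_fact_transform_last (h : QAdm q) (hc : 0 ≤ c) (ha : 0 ≤ a) (he : e = a + L)
    (hk : 0 ≤ k + n) :
    qRF q n * ∑ p ∈ antidiagonal L, (-1) ^ p.1 * (qFact q (c + p.1) * qFact q (k + n + p.1))
          * (qRF q p.1 * qRF q p.2 * qRF q (k + p.1) * qRF q (a + c + 1 + p.1))
          * q ^ (p.1 * ((n : ℂ) - e))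
      = (-1) ^ L * qFact q c * qRF q a * qRF q (k + L)
        * ∑ p ∈ antidiagonal L, (-1) ^ p.1 * (qFact q (k + n + p.1) * qFact q (a + p.1))
          * (qRF q p.1 * qRF q p.2 * qRF q (a + c + 1 + p.1) * qRF q (n - L + p.1))
          * q ^ (L * ((k : ℂ) + n + 1) - p.1 * (k - c)) := by
  have key := qSer_transform h (Or.inr rfl) (k + n + 1) (c + 1) (k + 1) (a + c + 2) L
  rw [qSer] at key
  trans (qFact q c * qFact q (k + n) * qRF q n * qRF q (k + L) * qRF q (a + c + 1 + L))
    * ∑ p ∈ antidiagonal L, qTerm q (-1) (k + n + 1) (c + 1) (k + 1) (a + c + 2) p.1 p.2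
  · rw [mul_sum, mul_sum]
    refine sum_congr rfl ?_
    rintro ⟨s, r⟩ hp
    have hp : s + r = L := HasAntidiagonal.mem_antidiagonal.mp hp
    have hnc : (L : ℂ) = s + r := by exact_mod_cast hp.symm
    have hec : (e : ℂ) = a + s + r := by rw [he]; push_cast; rw [hnc]; ring
    simp only [qTerm]
    rw [qFact_eq_mul_qPoch h (x := c + 1) (y := c) (z := c + s) (k := s) rfl rfl hc,
      qFact_eq_mul_qPoch h (x := k + n + 1) (y := k + n) (z := k + n + s) (k := s)
        (by push_cast; ring) rfl hk,
      ← qPoch_mul_qRF h (x := k + 1 + s) (y := k + s) (z := k + L) (k := r) (by push_cast; ring)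
        (by omega),
      ← qPoch_mul_qRF h (x := a + c + 2 + s) (y := a + c + 1 + s) (z := a + c + 1 + L) (k := r)
        (by push_cast; ring) (by omega),
      show (s : ℂ) * ((n : ℂ) - e)
        = -1 * s * (s + r + (k + 1) + (a + c + 2) - (k + n + 1) - (c + 1) - 1) by rw [hec]; ring]
    ring
  · rw [key, mul_sum, mul_sum, mul_sum]
    refine sum_congr rfl ?_
    rintro ⟨s, r⟩ hp
    have hp : s + r = L := HasAntidiagonal.mem_antidiagonal.mp hp
    simp only
    rw [qFact_eq_mul_qPoch h (x := a + c + 2 - (c + 1)) (y := a) (z := a + s) (k := s)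
        (by ring) rfl ha,
      qFact_eq_mul_qPoch h (x := k + n + 1) (y := k + n) (z := k + n + s) (k := s)
        (by push_cast; ring) rfl hk,
      ← qPoch_mul_qRF h (x := a + c + 2 + s) (y := a + c + 1 + s) (z := a + c + 1 + L) (k := r)
        (by push_cast; ring) (by omega),
      qRF_sub_eq h (x := k + 1 - (k + n + 1)) (y := n) (z := n - L + s) (k := r)
        (by ring) (by omega),
      show q ^ ((L : ℂ) * ((k : ℂ) + n + 1) - s * (k - c)) = q ^ (-(-1 * (L : ℂ) * (k + n + 1)))
        * q ^ (-1 * (s : ℂ) * (k + 1 - (c + 1))) by rw [← h.cpow_add]; congr 1; ring,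
      show ((-1 : ℂ)) ^ L = (-1) ^ s * (-1) ^ r by rw [← pow_add, hp]]
    have i1 := qFact_mul_qRF h ha
    generalize q ^ (-(-1 * (L : ℂ) * (k + n + 1))) = E1
    generalize q ^ (-1 * (s : ℂ) * (k + 1 - (c + 1))) = E2
    symm
    trans (qFact q a * qRF q a) * ((-1) ^ s * (-1) ^ s) * ((-1) ^ r * (-1) ^ r)
      * (qFact q c * qFact q (k + n) * qRF q n * qRF q (k + L) * qRF q (a + c + 1 + L)
      * (E1 * (qRF q s * qRF q r * qPoch q (k + n + 1) s * qPoch q (a + c + 2 - (c + 1)) s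
      * qPoch q (a + c + 2 + s) r * qPoch q (k + 1 - (k + n + 1)) r * E2)))
    · ring
    · rw [i1, neg_one_sq_pow, neg_one_sq_pow]; ring

end FactorialSums

lemma qDouble_comm (m n : ℕ) (f : ℕ → ℕ → ℕ → ℕ → ℂ) :
    qDouble m n f = qDouble n m fun s r t w => f t w s r := sum_comm

/-! ### The chain of double factorial sums with two free complex parameters. -/

section FactorialChain

variable (q) (a b : ℕ) (c e M N : ℤ) (β φ : ℂ)

/-- Only the first index is written with factorials. The second keeps complex β and φ, so that one
chain serves both S_A, S_B, ... (β = -d-f-1, φ = -f) and the triangular case (β = b2', φ = d'). -/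
def factA (s r t w : ℕ) : ℂ :=
  (-1) ^ s * (qFact q (c + s) * qFact q (e - s)) * (qRF q s * qRF q r * qRF q t * qRF q w)
    * (qRF q (N - s - t) * qRF q (M - a - b + s + t)) * (qPoch q (φ - β) t * qPoch q (φ + t) w)
    * q ^ (s * ((b : ℂ) + c + e - M - N + 1) + t * (β + M + N - a))

/-- The auxiliary sum from which the chain branches to B and K; it is reached once s runs up to L =
e - a. -/
def factQ (s r t w : ℕ) : ℂ :=
  (-1) ^ (s + t) * (qFact q (c + s) * qFact q (e - s) * qFact q (a + b + c - M - t))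
    * (qRF q s * qRF q r * qRF q t * qRF q w)
    * (qRF q (N - s - t) * qRF q (a + b + c - M - N + s))
    * (qPoch q (φ - β) t * qPoch q (φ + t) w)
    * q ^ (N * (c + 1) - s * (M - b + 1) - s * t + t * (β + M + N - a - c - 1))

def factB (s r t w : ℕ) : ℂ :=
  (-1) ^ s * (qFact q (c + s) * qFact q (e - s)) * (qRF q s * qRF q r * qRF q t * qRF q w)
    * (qRF q (N - s - t) * qRF q (a + c - M - N + s + t))
    * (qPoch q β t * qPoch q (φ + t) w)
    * q ^ (N * (b + c + 1) - s * (M + 1) - t * (a + b + c - M + φ - β))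

def factK (s r t w : ℕ) : ℂ :=
  (-1) ^ s * (qFact q (c + s) * qFact q (e - s) * qFact q (a + b + c - M - t))
    * (qRF q s * qRF q r * qRF q t * qRF q w)
    * (qRF q (N - s) * qRF q (a + b + c - M - N + s - t))
    * (qPoch q (φ - β) t * qPoch q β w)
    * q ^ (N * (c + 1) - s * (M - b + 1) - b * (φ - β) + t * (φ + N - s))

def factD (s r t w : ℕ) : ℂ :=
  (-1) ^ s * (qFact q (c + s) * qFact q (a + c - M + s))
    * (qRF q s * qRF q r * qRF q t * qRF q w)
    * (qRF q (N - t) * qRF q (a + c - M - N + s + t) * qRF q (a + c + 1 + s))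
    * (qPoch q β t * qPoch q (φ + t) w)
    * q ^ (N * (b + c + 1) - (e - a) * (c + 1) + s * (N - t - e) - t * (a + b + c - M + φ - β))

def factG (s r t w : ℕ) : ℂ :=
  (-1) ^ s * (qFact q (a + c - M + s) * qFact q (a + s))
    * (qRF q s * qRF q r * qRF q t * qRF q w)
    * (qRF q (N - t - e + a + s) * qRF q (c + e - M - N + t) * qRF q (a + c + 1 + s))
    * (qPoch q β t * qPoch q (φ + t) w)
    * q ^ (N * (b + c + 1) + (e - a) * (a - M) - s * (a - M - N + t)
        - t * (a + b + c - M + φ - β))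

variable {q a b c e M N β φ} {L : ℕ}

lemma factA_eq_factQ (h : QAdm q) (hc : 0 ≤ c) (he : e = a + L) (hN : N ≤ e) (hM : M ≤ a + c) :
    qDouble a b (factA q a b c e M N β φ)
      = (-1) ^ N * (qFact q L * qRF q a * qRF q (M + N - a - b))
        * qDouble L b (factQ q a b c e M N β φ) := by
  unfold qDouble
  rw [sum_comm, sum_comm (s := antidiagonal L), mul_sum]
  refine sum_congr rfl ?_
  rintro ⟨t, w⟩ hu
  have hu : t + w = b := HasAntidiagonal.mem_antidiagonal.mp hu
  -- The integers M - a - b + t and N - t have the sum M + N - a - b, free of t; hence the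
  -- prefactors leave the double sum apart from a sign (-1)^t.
  have key := sum_fact_transform_cut h (c := c) (e := e) (m := M - a - b + t) (n := N - t)
    (a := a) (L := L) hc he (by omega) (by omega)
  let C := qRF q t * qRF q w * (qPoch q (φ - β) t * qPoch q (φ + t) w) * q ^ (t * (β + M + N - a))
  rw [mul_sum] at key ⊢
  trans C * ∑ p ∈ antidiagonal a, (-1) ^ p.1 * (qFact q (c + p.1) * qFact q (e - p.1))
        * (qRF q p.1 * qRF q p.2 * qRF q (N - t - p.1) * qRF q (M - a - b + t + p.1))
        * q ^ (p.1 * ((c : ℂ) + e - (M - a - b + t : ℤ) - (N - t : ℤ) - a + 1))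
  · rw [mul_sum]
    refine sum_congr rfl ?_
    rintro ⟨s, r⟩ -
    simp only [factA, C]
    rw [h.cpow_add, show (b : ℂ) + c + e - M - N + 1
      = c + e - (M - a - b + t : ℤ) - (N - t : ℤ) - a + 1 by push_cast; ring,
      show N - s - t = N - t - (s : ℤ) by ring,
      show M - a - b + s + t = M - a - b + t + (s : ℤ) by ring]
    ring
  · rw [key, mul_sum]
    refine sum_congr rfl ?_
    rintro ⟨s, r⟩ -
    simp only [factQ, C]
    rw [show (N : ℂ) * (c + 1) - s * (M - b + 1) - s * t + t * (β + M + N - a - c - 1)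
      = t * (β + M + N - a) + ((N - t : ℤ) * ((c : ℂ) + 1)
        - s * ((M - a - b + t : ℤ) + a + 1)) by push_cast; ring, h.cpow_add _ ((N - t : ℤ) * _ - _),
      show N - s - t = N - t - (s : ℤ) by ring,
      show M - a - b + t + (N - t) = M + N - a - (b : ℤ) by ring,
      show c - (M - a - b + t) = a + b + c - M - (t : ℤ) by ring,
      show a + b + c - M - t - (N - t) + s = a + b + c - M - N + (s : ℤ) by ring,
      zpow_sub₀ (by norm_num : (-1 : ℂ) ≠ 0), zpow_natCast, pow_add]
    have : ((-1 : ℂ) ^ t)⁻¹ = (-1) ^ t := by rw [← inv_pow]; norm_num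
    rw [div_eq_mul_inv, this]
    ring

/-- For fixed s the index t is transformed with -(N-s) as distinguished parameter; `factQ_eq_factK`
transforms the same sum with φ - β instead. -/
lemma factQ_eq_factB (h : QAdm q) (hM : M ≤ a + c) :
    qDouble L b (factQ q a b c e M N β φ)
      = qFact q (a + c - M) * qDouble L b (factB q a b c e M N β φ) := by
  unfold qDouble
  rw [mul_sum]
  refine sum_congr rfl ?_
  rintro ⟨s, r⟩ -
  have key := sum_fact_transform_num h (c := φ - β) (d := φ) (g := a + b + c - M) (n := N - s)
    (b := b) (by omega)
  let C := (-1) ^ s * (qFact q (c + s) * qFact q (e - s)) * (qRF q s * qRF q r)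
    * q ^ (N * (c + 1) - s * ((M : ℂ) - b + 1))
  have hL : ∑ u ∈ antidiagonal b, factQ q a b c e M N β φ s r u.1 u.2
      = C * (qRF q (a + b + c - M - (N - s)) * ∑ p ∈ antidiagonal b, (-1) ^ p.1
        * qFact q (a + b + c - M - p.1) * (qRF q p.1 * qRF q p.2)
        * qRF q (N - s - p.1) * qPoch q (φ - β) p.1 * qPoch q (φ + p.1) p.2
        * q ^ (p.1 * (b + φ - (a + b + c - M : ℤ) - (φ - β) + (N - s : ℤ) - 1))) := by
    rw [mul_sum, mul_sum]
    refine sum_congr rfl ?_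
    rintro ⟨t, w⟩ -
    simp only [factQ, C]
    rw [show (N : ℂ) * (c + 1) - s * (M - b + 1) - s * t + t * (β + M + N - a - c - 1)
      = (N * (c + 1) - s * (M - b + 1)) + t * (b + φ - (a + b + c - M : ℤ) - (φ - β)
        + (N - s : ℤ) - 1) by push_cast; ring, h.cpow_add _ (t * _),
      show a + b + c - M - (N - s) = a + b + c - M - N + (s : ℤ) by ring]
    ring
  rw [hL, key, mul_sum, mul_sum, mul_sum]
  refine sum_congr rfl ?_
  rintro ⟨t, w⟩ -
  simp only [factB, C]
  rw [show (N : ℂ) * (b + c + 1) - s * (M + 1) - t * (a + b + c - M + φ - β)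
      = (N * (c + 1) - s * (M - b + 1)) + (b * (N - s : ℤ) - t * ((a + b + c - M : ℤ) + (φ - β)))
        by push_cast; ring, h.cpow_add _ (b * _ - _),
      show a + b + c - M - (N - s) - b + t = a + c - M - N + s + (t : ℤ) by ring,
      show a + b + c - M - b = a + c - (M : ℤ) by ring, show φ - (φ - β) = β by ring]
  ring

lemma factQ_eq_factK (h : QAdm q) (hM : M ≤ a + c) :
    qDouble L b (factQ q a b c e M N β φ) = qDouble L b (factK q a b c e M N β φ) := by
  refine sum_congr rfl ?_
  rintro ⟨s, r⟩ -
  have key := sum_fact_transform_den h (c := φ - β) (d := φ) (g := a + b + c - M) (n := N - s)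
    (b := b) (by omega)
  let C := (-1) ^ s * (qFact q (c + s) * qFact q (e - s)) * (qRF q s * qRF q r)
    * q ^ (N * (c + 1) - s * ((M : ℂ) - b + 1))
  have hL : ∑ u ∈ antidiagonal b, factQ q a b c e M N β φ s r u.1 u.2
      = C * (qRF q (a + b + c - M - (N - s)) * ∑ p ∈ antidiagonal b, (-1) ^ p.1
        * qFact q (a + b + c - M - p.1) * (qRF q p.1 * qRF q p.2)
        * qRF q (N - s - p.1) * qPoch q (φ - β) p.1 * qPoch q (φ + p.1) p.2
        * q ^ (p.1 * (b + φ - (a + b + c - M : ℤ) - (φ - β) + (N - s : ℤ) - 1))) := by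
    rw [mul_sum, mul_sum]
    refine sum_congr rfl ?_
    rintro ⟨t, w⟩ -
    simp only [factQ, C]
    rw [show (N : ℂ) * (c + 1) - s * (M - b + 1) - s * t + t * (β + M + N - a - c - 1)
      = (N * (c + 1) - s * (M - b + 1)) + t * (b + φ - (a + b + c - M : ℤ) - (φ - β)
        + (N - s : ℤ) - 1) by push_cast; ring, h.cpow_add _ (t * _),
      show a + b + c - M - (N - s) = a + b + c - M - N + (s : ℤ) by ring]
    ring
  rw [hL, key, mul_sum, mul_sum]
  refine sum_congr rfl ?_
  rintro ⟨t, w⟩ -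
  simp only [factK, C]
  rw [show (N : ℂ) * (c + 1) - s * (M - b + 1) - b * (φ - β) + t * (φ + N - s)
      = (N * (c + 1) - s * (M - b + 1)) + (t * (φ + (N - s : ℤ)) - b * (φ - β))
        by push_cast; ring, h.cpow_add _ (_ - b * _),
      show a + b + c - M - (N - s) - t = a + b + c - M - N + s - (t : ℤ) by ring,
      show φ - (φ - β) = β by ring]
  ring

lemma factB_eq_factD (h : QAdm q) (hc : 0 ≤ c) (he : e = a + L) (hM : M ≤ a + c) :
    qDouble L b (factB q a b c e M N β φ)
      = qFact q a * qRF q (a + c - M) * qFact q (c + e + 1)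
        * qDouble L b (factD q a b c e M N β φ) := by
  rw [qDouble_comm L b (factB q a b c e M N β φ), qDouble_comm L b (factD q a b c e M N β φ),
    qDouble, qDouble, mul_sum]
  refine sum_congr rfl ?_
  rintro ⟨t, w⟩ -
  -- With these values k + n = a + c - M, which is free of t and nonnegative by hM.
  have key := sum_fact_transform_succ h (c := c) (e := e) (a := a) (n := N - t)
    (k := a + c - M - N + t) (L := L) hc (by omega) he (by omega)
  let C := qRF q t * qRF q w * (qPoch q β t * qPoch q (φ + t) w)
    * q ^ (N * (b + c + 1) - t * ((a : ℂ) + b + c - M + φ - β))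
  trans C * ∑ p ∈ antidiagonal L, (-1) ^ p.1 * (qFact q (c + p.1) * qFact q (e - p.1))
        * (qRF q p.1 * qRF q p.2 * qRF q (N - t - p.1) * qRF q (a + c - M - N + t + p.1))
        * q ^ (p.1 * (((a + c - M - N + t : ℤ) : ℂ) + (N - t : ℤ) - (a : ℤ) - c - 1))
  · rw [mul_sum]
    refine sum_congr rfl ?_
    rintro ⟨s, r⟩ -
    simp only [factB, C]
    rw [show (N : ℂ) * (b + c + 1) - s * (M + 1) - t * (a + b + c - M + φ - β)
      = (N * (b + c + 1) - t * (a + b + c - M + φ - β))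
        + s * (((a + c - M - N + t : ℤ) : ℂ) + (N - t : ℤ) - (a : ℤ) - c - 1)
        by push_cast; ring, h.cpow_add _ (s * _),
      show N - s - t = N - t - (s : ℤ) by ring,
      show a + c - M - N + s + t = a + c - M - N + t + (s : ℤ) by ring]
    ring
  · rw [key, mul_sum, mul_sum, mul_sum]
    refine sum_congr rfl ?_
    rintro ⟨s, r⟩ -
    simp only [factD, C]
    rw [show (N : ℂ) * (b + c + 1) - (e - a) * (c + 1) + s * (N - t - e)
          - t * (a + b + c - M + φ - β)
      = (N * (b + c + 1) - t * (a + b + c - M + φ - β))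
        + (s * (((N - t : ℤ) : ℂ) - e) - L * (c + 1)) by rw [he]; push_cast; ring,
      h.cpow_add _ (_ - L * _),
      show a + c - M - N + s + t = a + c - M - N + t + (s : ℤ) by ring,
      show a + c - M - N + t + (N - t) = a + c - M by ring]
    ring

lemma factD_eq_factG (h : QAdm q) (hc : 0 ≤ c) (he : e = a + L) (hM : M ≤ a + c) :
    qDouble L b (factD q a b c e M N β φ)
      = (-1) ^ L * (qFact q c * qRF q a) * qDouble L b (factG q a b c e M N β φ) := by
  rw [qDouble_comm L b (factD q a b c e M N β φ), qDouble_comm L b (factG q a b c e M N β φ),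
    qDouble, qDouble, mul_sum]
  refine sum_congr rfl ?_
  rintro ⟨t, w⟩ -
  have key := sum_fact_transform_last h (c := c) (e := e) (a := a) (n := N - t)
    (k := a + c - M - N + t) (L := L) hc (by omega) he (by omega)
  let C := qRF q t * qRF q w * (qPoch q β t * qPoch q (φ + t) w)
    * q ^ (N * (b + c + 1) - (e - a) * (c + 1) - t * ((a : ℂ) + b + c - M + φ - β))
  trans C * (qRF q (N - t) * ∑ p ∈ antidiagonal L, (-1) ^ p.1
        * (qFact q (c + p.1) * qFact q (a + c - M - N + t + (N - t) + p.1))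
        * (qRF q p.1 * qRF q p.2 * qRF q (a + c - M - N + t + p.1) * qRF q (a + c + 1 + p.1))
        * q ^ (p.1 * (((N - t : ℤ) : ℂ) - e)))
  · rw [mul_sum, mul_sum]
    refine sum_congr rfl ?_
    rintro ⟨s, r⟩ -
    simp only [factD, C]
    rw [show (N : ℂ) * (b + c + 1) - (e - a) * (c + 1) + s * (N - t - e)
          - t * (a + b + c - M + φ - β)
      = (N * (b + c + 1) - (e - a) * (c + 1) - t * (a + b + c - M + φ - β))
        + s * (((N - t : ℤ) : ℂ) - e) by push_cast; ring,
      h.cpow_add _ (s * _),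
      show a + c - M - N + s + t = a + c - M - N + t + (s : ℤ) by ring,
      show a + c - M - N + t + (N - t) = a + c - M by ring]
    ring
  · rw [key, mul_sum, mul_sum, mul_sum]
    refine sum_congr rfl ?_
    rintro ⟨s, r⟩ -
    simp only [factG, C]
    rw [show (N : ℂ) * (b + c + 1) + (e - a) * (a - M) - s * (a - M - N + t)
          - t * (a + b + c - M + φ - β)
      = (N * (b + c + 1) - (e - a) * (c + 1) - t * (a + b + c - M + φ - β))
        + (L * (((a + c - M - N + t : ℤ) : ℂ) + (N - t : ℤ) + 1)
          - s * ((a + c - M - N + t : ℤ) - c)) by rw [he]; push_cast; ring,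
      h.cpow_add _ (L * _ - _),
      show a + c - M - N + t + L = c + e - M - N + (t : ℤ) by rw [he]; ring,
      show N - t - e + a + s = N - t - L + (s : ℤ) by rw [he]; ring,
      show a + c - M - N + t + (N - t) = a + c - M by ring]
    ring

theorem factA_eq_factB (h : QAdm q) (hc : 0 ≤ c) (he : e = a + L) (hN : N ≤ e) (hM : M ≤ a + c) :
    qDouble a b (factA q a b c e M N β φ)
      = (-1) ^ N * (qFact q L * qRF q a * qRF q (M + N - a - b)) * qFact q (a + c - M)
        * qDouble L b (factB q a b c e M N β φ) := by
  rw [factA_eq_factQ h hc he hN hM, factQ_eq_factB h hM]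
  ring

theorem factA_eq_factK (h : QAdm q) (hc : 0 ≤ c) (he : e = a + L) (hN : N ≤ e) (hM : M ≤ a + c) :
    qDouble a b (factA q a b c e M N β φ)
      = (-1) ^ N * (qFact q L * qRF q a * qRF q (M + N - a - b))
        * qDouble L b (factK q a b c e M N β φ) := by
  rw [factA_eq_factQ h hc he hN hM, factQ_eq_factK h hM]

theorem factA_eq_factD (h : QAdm q) (hc : 0 ≤ c) (he : e = a + L) (hN : N ≤ e) (hM : M ≤ a + c) :
    qDouble a b (factA q a b c e M N β φ)
      = (-1) ^ N * (qFact q L * qRF q (M + N - a - b)) * qFact q (c + e + 1)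
        * qDouble L b (factD q a b c e M N β φ) := by
  rw [factA_eq_factB h hc he hN hM, factB_eq_factD h hc he hM]
  have i1 := qFact_mul_qRF h (n := a) (by omega)
  have i2 := qFact_mul_qRF h (n := a + c - M) (by omega)
  trans (qFact q a * qRF q a) * (qFact q (a + c - M) * qRF q (a + c - M)) * ((-1) ^ N
    * (qFact q L * qRF q (M + N - a - b)) * qFact q (c + e + 1)
    * qDouble L b (factD q a b c e M N β φ))
  · ring
  · rw [i1, i2]; ring

theorem factA_eq_factG (h : QAdm q) (hc : 0 ≤ c) (he : e = a + L) (hN : N ≤ e) (hM : M ≤ a + c) :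
    qDouble a b (factA q a b c e M N β φ)
      = (-1) ^ N * (-1) ^ L * (qFact q L * qRF q (M + N - a - b)) * (qFact q (c + e + 1)
        * qFact q c * qRF q a) * qDouble L b (factG q a b c e M N β φ) := by
  rw [factA_eq_factD h hc he hN hM, factD_eq_factG h hc he hM]
  ring

end FactorialChain

/-! ### The seven double factorial sums as members of the two chains. -/

lemma sum_Icc_eq_sum_antidiagonal (a : ℕ) (g : ℤ → ℂ) :
    ∑ s ∈ Icc (0 : ℤ) a, g s = ∑ p ∈ antidiagonal a, g p.1 := by
  refine (sum_bij (fun p _ => (p.1 : ℤ)) ?_ ?_ ?_ ?_).symm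
  · rintro ⟨s, r⟩ hp
    have hp : s + r = a := HasAntidiagonal.mem_antidiagonal.mp hp
    simp only [mem_Icc]; omega
  · rintro ⟨s, r⟩ hp ⟨s', r'⟩ hp' he
    have hp : s + r = a := HasAntidiagonal.mem_antidiagonal.mp hp
    have hp' : s' + r' = a := HasAntidiagonal.mem_antidiagonal.mp hp'
    simp only [Nat.cast_inj] at he
    ext <;> simp only <;> omega
  · intro s hs
    rw [mem_Icc] at hs
    refine ⟨(s.toNat, a - s.toNat), HasAntidiagonal.mem_antidiagonal.mpr (by simp only; omega), ?_⟩
    simp only; omega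
  · intros; rfl

lemma sum_Icc_eq_qDouble (a b : ℕ) (g : ℤ → ℤ → ℂ) :
    ∑ s ∈ Icc (0 : ℤ) a, ∑ z ∈ Icc (0 : ℤ) b, g s z = qDouble a b fun s _ t _ => g s t := by
  rw [sum_Icc_eq_sum_antidiagonal]
  exact sum_congr rfl fun p _ => sum_Icc_eq_sum_antidiagonal b _

lemma inv_qFact (n : ℤ) : (qFact q n)⁻¹ = qRF q n := rfl

/-- Changes the length of the first summation. The summands f and g may use the complementary index
r, which is m - s in one and k - s in the other; the common form G avoids it. -/
lemma qDouble_switch_left {m n k : ℕ} {f g : ℕ → ℕ → ℕ → ℕ → ℂ} (G : ℕ → ℕ → ℕ → ℂ)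
    (hf : ∀ s r t w, s + r = m → f s r t w = G s t w)
    (hg : ∀ s r t w, s + r = k → g s r t w = G s t w)
    (hm : ∀ s t w, m < s → G s t w = 0) (hk : ∀ s t w, k < s → G s t w = 0) :
    qDouble m n f = qDouble k n g := by
  rw [qDouble_comm, qDouble_comm k]
  refine sum_congr rfl fun u _ => ?_
  rw [sum_congr rfl fun p hp => hf p.1 p.2 u.1 u.2 (HasAntidiagonal.mem_antidiagonal.mp hp),
    sum_congr rfl fun p hp => hg p.1 p.2 u.1 u.2 (HasAntidiagonal.mem_antidiagonal.mp hp)]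
  exact sum_antidiagonal_switch (g := fun s => G s u.1 u.2) (fun s hs => hm s _ _ hs)
    (fun s hs => hk s _ _ hs)

lemma qDouble_congr {m n : ℕ} {f g : ℕ → ℕ → ℕ → ℕ → ℂ}
    (hfg : ∀ s r t w, s + r = m → t + w = n → f s r t w = g s r t w) :
    qDouble m n f = qDouble m n g :=
  qDouble_congr_right fun s r hs => sum_congr rfl fun _ hu =>
    hfg s r _ _ hs (HasAntidiagonal.mem_antidiagonal.mp hu)

lemma mul_qDouble (c : ℂ) (m n : ℕ) (f : ℕ → ℕ → ℕ → ℕ → ℂ) :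
    c * qDouble m n f = qDouble m n fun s r t w => c * f s r t w := by
  simp only [qDouble, mul_sum]

section IntegerSpecialization

variable {a b L : ℕ} {c e M N : ℤ} {b1 c1 b2 c2 d f : ℂ}

/-- The bridge between the chains: at these integers every symbol in b1, c1, b2 and d is a quotient
of factorials, while c2 and f stay arbitrary. Both the factorial sums and the triangular case pass
through it. -/
lemma polyG_eq_factA (h : QAdm q) (hc : 0 ≤ c) (he : e = a + L) (hM : 0 ≤ M) (hN : 0 ≤ N)
    (hb1 : b1 = -M) (hc1 : c1 = -N) (hb2 : b2 = -c - e - 1) (hd : d = -a - c) :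
    qDouble a b (polyG q b1 c1 b2 c2 d f a b)
      = (-1) ^ (a + b) * (qFact q M * qFact q N * qRF q c * qRF q L)
        * q ^ (a * b2 + b * c1 - a * c1) * qDouble a b (factA q a b c e M N c2 f) := by
  rw [mul_qDouble]
  refine qDouble_congr fun s r t w hs ht => ?_
  have hac : (a : ℂ) = s + r := by exact_mod_cast hs.symm
  simp only [polyG, factA]
  rw [qFact_eq_mul_qPoch h (x := 1 - d - a) (y := c) (z := c + s) (k := s) (by rw [hd]; ring) rfl hc,
    qFact_eq_mul_qPoch h (x := d - b2) (y := L) (z := e - s) (k := r)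
      (by rw [hd, hb2, he]; push_cast; ring) (by omega) (by omega),
    qRF_sub_eq h (x := c1) (y := N) (z := N - s - t) (k := s + t) hc1 (by push_cast; ring),
    qRF_sub_eq h (x := b1) (y := M) (z := M - a - b + s + t) (k := r + w) hb1 (by omega),
    show (a : ℂ) * b2 + b * c1 - a * c1 + s * (b1 + c1 - b2 + b) - t * (b1 + c1 - c2 + a)
      = (a * b2 + b * c1 - a * c1) + (s * ((b : ℂ) + c + e - M - N + 1) + t * (c2 + M + N - a)) by
      rw [hb1, hc1, hb2]; ring, h.cpow_add (a * b2 + b * c1 - a * c1)]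
  have i1 := qFact_mul_qRF h hc
  have i2 := qFact_mul_qRF h hM
  have i3 := qFact_mul_qRF h hN
  have i4 := qFact_mul_qRF h (n := L) (by omega)
  generalize q ^ (a * b2 + b * c1 - a * c1) = E1
  generalize q ^ (s * ((b : ℂ) + c + e - M - N + 1) + t * (c2 + M + N - a)) = E2
  rw [show ((-1 : ℂ)) ^ (a + b) = (-1) ^ s * (-1) ^ r * ((-1) ^ t * (-1) ^ w) by
    rw [← pow_add, ← pow_add, ← pow_add]; congr 1; omega, pow_add, pow_add]
  symm
  trans (qFact q c * qRF q c) * (qFact q M * qRF q M) * (qFact q N * qRF q N)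
    * (qFact q L * qRF q L) * ((-1) ^ s * ((-1) ^ s * (-1) ^ s) * ((-1) ^ r * (-1) ^ r)
    * ((-1) ^ t * (-1) ^ t) * ((-1) ^ w * (-1) ^ w) * (qRF q s * qRF q r * qRF q t * qRF q w)
    * qPoch q c1 (s + t) * qPoch q (1 - d - a) s * qPoch q (d - b2) r * qPoch q (f - c2) t
    * qPoch q (f + t) w * qPoch q b1 (r + w) * (E1 * E2))
  · ring
  · rw [i1, i2, i3, i4, neg_one_sq_pow, neg_one_sq_pow, neg_one_sq_pow, neg_one_sq_pow]; ring

end IntegerSpecialization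

section FactorialSums

variable {a b : ℕ} {c d e f m n : ℤ}

lemma neg_one_zpow_sq (k : ℤ) : ((-1 : ℂ)) ^ k * (-1) ^ k = 1 := by
  rw [← mul_zpow]; norm_num

/-- With φ - β = d + 1 and φ = -f, the symbols (φ-β)_t and (φ+t)_w are [d+t]!/[d]! and, up to sign,
[f-t]!/[f-b]!. -/
lemma dsumA_eq (h : QAdm q) (hd : 0 ≤ d) (hf : b ≤ f) :
    dsumA q a b c d e f m n = (-1) ^ b * (qFact q d * qFact q (f - b))
      * qDouble a b (factA q a b c e m n (-d - f - 1) (-f)) := by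
  rw [dsumA, sum_Icc_eq_qDouble, mul_qDouble]
  refine qDouble_congr fun s r t w hs ht => ?_
  have hn : (-1 : ℂ) ≠ 0 := by norm_num
  simp only [factA, div_eq_mul_inv, mul_inv, inv_qFact]
  rw [← Complex.cpow_intCast q, zpow_add₀ hn, zpow_natCast, zpow_natCast,
    qFact_eq_mul_qPoch h (x := -f - (-d - f - 1)) (y := d) (z := d + t) (k := t) (by ring) rfl hd,
    qFact_eq_mul_qPoch_neg h (x := -f + t) (y := f - b) (z := f - t) (k := w)
        (by push_cast; ring) (by omega) (by omega),
    show (a : ℤ) - s = r by omega, show (b : ℤ) - t = w by omega,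
    show ((-1 : ℂ)) ^ b = (-1) ^ t * (-1) ^ w by rw [← pow_add, ht],
    show (((s : ℤ) * (b + c + e - m - n + 1) - t * (a + d + f - m - n + 1) : ℤ) : ℂ)
      = s * ((b : ℂ) + c + e - m - n + 1) + t * (-d - f - 1 + m + n - a) by push_cast; ring]
  ring

lemma dsumB_eq {L : ℕ} (h : QAdm q) (hd : 0 ≤ d) (hf : b ≤ f) (he : e = a + L) :
    dsumB q a b c d e f m n = (-1) ^ n * (qFact q L * qRF q a * qRF q (m + n - a - b))
      * qFact q (a + c - m) * ((-1) ^ b * (qFact q d * qFact q (f - b)))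
      * qDouble L b (factB q a b c e m n (-d - f - 1) (-f)) := by
  rw [dsumB, show e - a = (L : ℕ) by omega, sum_Icc_eq_qDouble, mul_qDouble, mul_qDouble]
  refine qDouble_congr fun s r t w hs ht => ?_
  have hn : (-1 : ℂ) ≠ 0 := by norm_num
  simp only [factB, div_eq_mul_inv, mul_inv, inv_qFact]
  rw [← Complex.cpow_intCast q, zpow_add₀ hn, zpow_natCast,
    qRF_sub_eq h (x := -d - f - 1) (y := d + f + 1) (z := d + f + 1 - t) (k := t)
      (by push_cast; ring) rfl,
    qFact_eq_mul_qPoch_neg h (x := -f + t) (y := f - b) (z := f - t) (k := w)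
        (by push_cast; ring) (by omega) (by omega),
    show (L : ℤ) - s = r by omega, show (b : ℤ) - t = w by omega,
    show ((-1 : ℂ)) ^ b = (-1) ^ t * (-1) ^ w by rw [← pow_add, ht],
    show ((n * (b + c + 1) - s * (m + 1) - t * (a + b + c + d - m + 1) : ℤ) : ℂ)
      = n * (b + c + 1) - s * (m + 1) - t * (a + b + c - m + -f - (-d - f - 1)) by
        push_cast; ring]
  have i1 := qFact_mul_qRF h (n := d + f + 1) (by omega)
  linear_combination ((-1) ^ n * (-1) ^ s * (-1) ^ t * (-1) ^ w * qFact q L * qRF q a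
    * qRF q (m + n - a - b) * qFact q (a + c - m) * qFact q d * qFact q (f - b)
    * (qFact q (c + s) * qFact q (e - s)) * (qRF q s * qRF q r * qRF q t * qRF q w)
    * (qRF q (n - s - t) * qRF q (a + c - m - n + s + t))
    * (qPoch q (-d - f - 1) t * qPoch q (-f + t) w)
    * q ^ (n * (b + c + 1) - s * (m + 1) - t * (a + b + c - m + -f - ((-d : ℂ) - f - 1)))) * i1

/-- S_D lists the terms of `factD` backwards in both indices. -/
lemma dsumD_eq {L : ℕ} (h : QAdm q) (hd : 0 ≤ d) (hf : b ≤ f) (he : e = a + L) :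
    dsumD q a b c d e f m n = (-1) ^ n * (qFact q L * qRF q (m + n - a - b))
      * qFact q (c + e + 1) * ((-1) ^ b * (qFact q d * qFact q (f - b)))
      * qDouble L b (factD q a b c e m n (-d - f - 1) (-f)) := by
  rw [dsumD, show e - a = (L : ℕ) by omega, sum_Icc_eq_qDouble, mul_qDouble, mul_qDouble,
    ← qDouble_swap]
  refine qDouble_congr fun s r t w hs ht => ?_
  have hn : (-1 : ℂ) ≠ 0 := by norm_num
  have hsg : (-1 : ℂ) ^ ((a : ℤ) + e + n + r) = (-1) ^ s * (-1) ^ n := by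
    rw [show (a : ℤ) + e + n + r = ((a + a + r + r + s : ℕ) : ℤ) + n by push_cast; omega,
      zpow_add₀ hn, zpow_natCast, pow_add, pow_add, pow_add, pow_add, neg_one_sq_pow,
      one_mul, neg_one_sq_pow, one_mul]
  have hbc : (b : ℂ) = t + w := by exact_mod_cast ht.symm
  have hec : (e : ℂ) = a + s + r := by exact_mod_cast (by omega : e = a + s + r)
  simp only [factD, div_eq_mul_inv, mul_inv, inv_qFact]
  rw [hsg, ← Complex.cpow_intCast q, ← Complex.cpow_intCast q,
    show d + f - b + 1 + w = d + f + 1 - (t : ℤ) by omega,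
    show f - b + w = f - (t : ℤ) by omega,
    show c + e - a - r = c + (s : ℤ) by omega, show c + e - m - r = a + c - m + (s : ℤ) by omega,
    show c + e + 1 - r = a + c + 1 + (s : ℤ) by omega,
    show b + c + e - m - n - r - w = a + c - m - n + s + (t : ℤ) by omega,
    show n - b + w = n - (t : ℤ) by omega,
    qRF_sub_eq h (x := -d - f - 1) (y := d + f + 1) (z := d + f + 1 - t) (k := t)
      (by push_cast; ring) rfl,
    qFact_eq_mul_qPoch_neg h (x := -f + t) (y := f - b) (z := f - t) (k := w)
        (by push_cast; ring) (by omega) (by omega),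
    show (L : ℤ) - r = s by omega, show (b : ℤ) - w = t by omega,
    show ((-1 : ℂ)) ^ b = (-1) ^ t * (-1) ^ w by rw [← pow_add, ht],
    show (n : ℂ) * (b + c + 1) - (e - a) * (c + 1) + s * (n - t - e)
        - t * (a + b + c - m + -f - (-d - f - 1))
      = ((n * (c + 1) - b * (b + d - m) - (b + e - a) * (c + e - n + 1) : ℤ) : ℂ)
        + (((r : ℤ) * (b + e - n - w) + w * (b + c + d + e - m + 1) : ℤ) : ℂ) by
        push_cast; rw [hbc, hec]; ring, h.cpow_add]
  have i1 := qFact_mul_qRF h (n := d + f + 1) (by omega)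
  generalize q ^ ((n * (c + 1) - b * (b + d - m) - (b + e - a) * (c + e - n + 1) : ℤ) : ℂ) = E1
  generalize q ^ (((r : ℤ) * (b + e - n - w) + w * (b + c + d + e - m + 1) : ℤ) : ℂ) = E2
  linear_combination ((-1) ^ n * (-1) ^ s * (-1) ^ t * (-1) ^ w * qFact q L
    * qRF q (m + n - a - b) * qFact q (c + e + 1) * qFact q d * qFact q (f - b)
    * (qFact q (c + s) * qFact q (a + c - m + s)) * (qRF q s * qRF q r * qRF q t * qRF q w)
    * (qRF q (n - t) * qRF q (a + c - m - n + s + t) * qRF q (a + c + 1 + s))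
    * (qPoch q (-d - f - 1) t * qPoch q (-f + t) w) * (E1 * E2)) * i1

end FactorialSums

section FactorialSums

variable {a b L : ℕ} {c d e f m n : ℤ}

/-- The factor on the left is the inverse of the one in `polyG_eq_factA`, up to a sign (-1)^b
absorbed by S_A. The same factor appears in `dsumF_eq`, so it can be cancelled once for both. -/
lemma dsumC_eq (h : QAdm q) (hc : 0 ≤ c) (hd : 0 ≤ d) (hf : b ≤ f) (he : e = a + L)
    (hm : 0 ≤ m) (hn : 0 ≤ n) :
    (-1) ^ a * (qFact q m * qFact q n * qRF q c * qRF q L) * q ^ (a * (-c - e - 1) - b * n + a * n : ℂ)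
        * dsumC q a b c d e f m n
      = qFact q d * qFact q (f - b)
        * qDouble a b (polyA q (-m) (-n) (-c - e - 1) (-d - f - 1) (-a - c) (-f) a b) := by
  rw [dsumC, sum_Icc_eq_qDouble, mul_qDouble, mul_qDouble, mul_qDouble]
  refine qDouble_congr fun s r t w hs ht => ?_
  have hsg : (-1 : ℂ) ^ ((a : ℤ) + s + t) = (-1) ^ a * (-1) ^ s * (-1) ^ t := by
    rw [← pow_add, ← pow_add, ← zpow_natCast]; congr 1
  have hac : (a : ℂ) = s + r := by exact_mod_cast hs.symm
  have hbc : (b : ℂ) = t + w := by exact_mod_cast ht.symm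
  simp only [polyA, div_eq_mul_inv, mul_inv, inv_qFact]
  rw [show (a : ℤ) - s = r by omega, show (b : ℤ) - t = w by omega]
  rw [qPoch_neg_eq_fact h (x := -m) (y := m) (z := m - s) (k := s) rfl rfl hm,
    qPoch_neg_eq_fact h (x := -n) (y := n) (z := n - t) (k := t) rfl rfl hn]
  -- Outside s ≤ m, t ≤ n both sides vanish; inside, m + n - s - t ≥ 0 and the last Pochhammer
  -- symbol may be written with factorials.
  rcases lt_or_ge m s with h1 | h1
  · simp [qRF_neg (q := q) (n := m - s) (by omega)]
  rcases lt_or_ge n t with h2 | h2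
  · simp [qRF_neg (q := q) (n := n - t) (by omega)]
  rw [hsg, ← Complex.cpow_intCast q, ← Complex.cpow_intCast q,
    qPoch_neg_eq_fact h (x := -c - e - 1) (y := c + e + 1) (z := c + e + 1 - s) (k := s)
      (by push_cast; ring) rfl (by omega),
    qPoch_neg_eq_fact h (x := -d - f - 1) (y := d + f + 1) (z := d + f + 1 - t) (k := t)
      (by push_cast; ring) rfl (by omega),
    qPoch_neg_eq_fact h (x := -a - c + s) (y := a + c - s) (z := c) (k := r)
      (by push_cast; ring) (by omega) (by omega),
    qPoch_neg_eq_fact h (x := -f + t) (y := f - t) (z := f - b) (k := w)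
      (by push_cast; ring) (by omega) (by omega),
    qPoch_neg_eq_fact h (x := -m + -n + (s + t : ℕ)) (y := m + n - s - t) (z := m + n - a - b)
      (k := r + w) (by push_cast; ring) (by omega) (by omega)]
  have hE : q ^ (a * (-c - e - 1) - b * n + a * n : ℂ)
      * q ^ ((a * (c + e - n + 1) + b * n : ℤ) : ℂ) = 1 := by
    rw [← h.cpow_add, show a * (-c - e - 1) - b * n + a * n + ((a * (c + e - n + 1) + b * n : ℤ) : ℂ)
      = 0 by push_cast; ring, Complex.cpow_zero]
  rw [show ((-(s : ℤ) * (e - n + t) - t * (b + d - m) : ℤ) : ℂ)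
    = s * (-c - e - 1 - -n - (-a - c) - a + 1) + t * (-d - f - 1 - -m - -f - b + 1) - s * t by
      push_cast; ring]
  have i1 := qFact_mul_qRF h (n := L) (by omega)
  have i2 := qFact_mul_qRF h (n := f - b) (by omega)
  generalize q ^ (a * (-c - e - 1) - b * n + a * n : ℂ) = E1 at *
  generalize q ^ ((a * (c + e - n + 1) + b * n : ℤ) : ℂ) = E2 at *
  generalize q ^ ((s : ℂ) * (-c - e - 1 - -n - (-a - c) - a + 1)
    + t * (-d - f - 1 - -m - -f - b + 1) - s * t) = E3 at *
  rw [show e - a = (L : ℕ) by omega, pow_add, pow_add]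
  let V := (-1) ^ s * (-1) ^ t * qFact q m * qFact q n * qRF q c * qFact q d * qFact q (d + f + 1)
    * qFact q (c + e + 1) * qRF q (m + n - a - b) * (qFact q (a + c - s) * qFact q (f - t)
    * qFact q (m + n - s - t)) * (qRF q s * qRF q r * qRF q t * qRF q w) * qRF q (m - s)
    * qRF q (c + e + 1 - s) * qRF q (n - t) * qRF q (d + f + 1 - t) * E3
  trans (E1 * E2) * (qFact q L * qRF q L) * ((-1) ^ a * (-1) ^ a) * V
  · ring
  · rw [hE, i1, neg_one_sq_pow]
    trans (qFact q (f - b) * qRF q (f - b)) * (((-1) ^ s * (-1) ^ s) * ((-1) ^ t * (-1) ^ t)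
      * ((-1) ^ r * (-1) ^ r) * ((-1) ^ w * (-1) ^ w)) * V
    · rw [i2, neg_one_sq_pow, neg_one_sq_pow, neg_one_sq_pow, neg_one_sq_pow]; ring
    · ring

lemma dsumF_eq (h : QAdm q) (hc : 0 ≤ c) (hd : 0 ≤ d) (hf : b ≤ f) (he : e = a + L)
    (hm : 0 ≤ m) (hn : 0 ≤ n) :
    (-1) ^ a * (qFact q m * qFact q n * qRF q c * qRF q L) * q ^ (a * (-c - e - 1) - b * n + a * n : ℂ)
        * dsumF q a b c d e f m n
      = qFact q d * qFact q (f - b)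
        * qDouble a b (polyF q (-m) (-n) (-c - e - 1) (-d - f - 1) (-a - c) (-f) a b) := by
  rw [dsumF, sum_Icc_eq_qDouble, mul_qDouble, mul_qDouble, mul_qDouble]
  refine qDouble_congr fun s r t w hs ht => ?_
  have hsg : (-1 : ℂ) ^ ((a : ℤ) + b + s + t) = (-1) ^ a * ((-1) ^ t * (-1) ^ w) * (-1) ^ s
      * (-1) ^ t := by
    rw [← pow_add, ← pow_add, ← pow_add, ← pow_add, ← zpow_natCast, ht]; congr 1
  have hac : (a : ℂ) = s + r := by exact_mod_cast hs.symm
  have hbc : (b : ℂ) = t + w := by exact_mod_cast ht.symm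
  simp only [polyF, div_eq_mul_inv, mul_inv, inv_qFact]
  rw [show (a : ℤ) - s = r by omega, show (b : ℤ) - t = w by omega]
  rw [qPoch_neg_eq_fact h (x := -m) (y := m) (z := m - s - t) (k := s + t) rfl
      (by push_cast; ring) hm,
    qPoch_neg_eq_fact h (x := -n) (y := n) (z := n - a + s) (k := r) rfl (by omega) hn]
  -- On the support of the summand m - s - t ≥ 0 and n - a + s ≥ 0; adding these gives m + n - a - t
  -- ≥ 0.
  rcases lt_or_ge (m - s - t) 0 with h1 | h1
  · simp [qRF_neg (q := q) h1]
  rcases lt_or_ge (n - a + s) 0 with h2 | h2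
  · simp [qRF_neg (q := q) h2]
  rw [hsg, ← Complex.cpow_intCast q, ← Complex.cpow_intCast q,
    qPoch_eq_fact h (x := -a - c - (-c - e - 1)) (y := L) (z := e - a + s) (k := s)
      (by rw [he]; push_cast; ring) (by omega) (by omega),
    qPoch_neg_eq_fact h (x := -d - f - 1) (y := d + f + 1) (z := d + f + 1 - t) (k := t)
      (by push_cast; ring) rfl (by omega),
    qPoch_neg_eq_fact h (x := -a - c + s) (y := a + c - s) (z := c) (k := r)
      (by push_cast; ring) (by omega) (by omega),
    qPoch_eq_fact h (x := -f - (-d - f - 1)) (y := d) (z := b + d - t) (k := w)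
      (by ring) (by omega) (by omega),
    qPoch_neg_eq_fact h (x := -m + -n + a + t) (y := m + n - a - t) (z := m + n - a - b)
      (k := w) (by push_cast; ring) (by omega) (by omega)]
  have hE : q ^ (a * (-c - e - 1) - b * n + a * n : ℂ)
      * q ^ ((a * (c + e - m - n + 1) - b * (d + f - n + 1) : ℤ) : ℂ)
      * q ^ (((t : ℤ) * (a + f - n - s) - s * (c + e - m - n + 1) : ℤ) : ℂ)
      = q ^ (a * -m + b * (-d - f - 1) - s * (-m + -n - (-c - e - 1)) - t * (-f - -n - a)
        - s * t : ℂ) := by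
    rw [← h.cpow_add, ← h.cpow_add]; congr 1; push_cast; ring
  rw [← hE]
  have i1 := qFact_mul_qRF h hd
  generalize q ^ (a * (-c - e - 1) - b * n + a * n : ℂ) = E1 at *
  generalize q ^ ((a * (c + e - m - n + 1) - b * (d + f - n + 1) : ℤ) : ℂ) = E2 at *
  generalize q ^ (((t : ℤ) * (a + f - n - s) - s * (c + e - m - n + 1) : ℤ) : ℂ) = E3 at *
  rw [pow_add]
  let V := qFact q m * qFact q n * qRF q c * qRF q L * qFact q (f - b) * qFact q (d + f + 1)
    * qRF q (m + n - a - b) * (qFact q (e - a + s) * qFact q (a + c - s) * qFact q (b + d - t)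
    * qFact q (m + n - a - t)) * (qRF q s * qRF q r * qRF q t * qRF q w) * qRF q (n - a + s)
    * qRF q (d + f + 1 - t) * qRF q (m - s - t) * (E1 * E2 * E3) * (-1) ^ s * (-1) ^ w
  trans ((-1) ^ a * (-1) ^ a) * ((-1) ^ t * (-1) ^ t) * V
  · ring
  · rw [neg_one_sq_pow, neg_one_sq_pow]
    trans (qFact q d * qRF q d) * (((-1) ^ t * (-1) ^ t) * ((-1) ^ r * (-1) ^ r)) * V
    · rw [i1, neg_one_sq_pow, neg_one_sq_pow]; ring
    · ring

lemma QAdm.inv (h : QAdm q) : QAdm q⁻¹ := by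
  refine ⟨inv_ne_zero h.1, fun k hk h1 => ?_⟩
  rw [inv_pow, inv_eq_one] at h1
  rw [h.2 k hk h1, inv_one]

lemma qFact_inv (n : ℤ) : qFact q⁻¹ n = qFact q n := by
  unfold qFact
  split_ifs with h0
  · rfl
  · refine prod_congr rfl fun k _ => ?_
    unfold qNum
    simp only [inv_eq_one, inv_inv]
    split_ifs with h1
    · rfl
    · rw [← Int.cast_neg, Complex.cpow_intCast, Complex.cpow_intCast, Complex.cpow_intCast,
        Complex.cpow_intCast, zpow_neg, zpow_neg, inv_zpow, inv_inv, ← neg_sub, ← neg_sub q,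
        neg_div_neg_eq]

/-- Factorials are invariant under q → 1/q, and the exponent of q is antisymmetric under the
exchange of (a,c,e,s) with (b,d,f,z). This symmetry produces S_E and S_G from the chain in the first
index. -/
lemma dsumA_inv : dsumA q⁻¹ a b c d e f m n = dsumA q b a d c f e m n := by
  unfold dsumA
  rw [sum_comm]
  refine sum_congr rfl fun z _ => sum_congr rfl fun s _ => ?_
  simp only [qFact_inv]
  rw [inv_zpow', add_comm s z, show -(s * (b + c + e - m - n + 1) - z * (a + d + f - m - n + 1))
    = z * (a + d + f - m - n + 1) - s * (b + c + e - m - n + 1) by ring,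
    show n - s - z = n - z - s by ring, show m - a - b + s + z = m - b - a + z + s by ring]
  ring

lemma qDouble_swap_left (m n : ℕ) (f : ℕ → ℕ → ℕ → ℕ → ℂ) :
    qDouble m n (fun s r t w => f r s t w) = qDouble m n f := by
  rw [qDouble, ← Nat.sum_antidiagonal_swap]
  rfl

lemma qDouble_swap_right (m n : ℕ) (f : ℕ → ℕ → ℕ → ℕ → ℂ) :
    qDouble m n (fun s r t w => f s r w t) = qDouble m n f := by
  rw [← qDouble_swap_left, qDouble_swap]

/-- The index z of S_E corresponds to N - s in `factK`, and the index s of S_E to t. -/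
lemma dsumE_inv {N : ℕ} (h : QAdm q) (hc : 0 ≤ c) (he : a ≤ e) (hf : f = b + L) :
    dsumE q⁻¹ a b c d e f m N = (-1) ^ (N : ℤ) * (qFact q L * qRF q b * qRF q (m + N - b - a))
      * ((-1) ^ a * (qFact q c * qFact q (e - a)))
      * qDouble L a (factK q b a d f m N (-c - e - 1) (-e)) := by
  -- S_E runs up to n in z, whereas `factK` has length L = f - b; the factors 1/[L-s]! and 1/[N-s]!
  -- allow the switch.
  have hK : qDouble L a (factK q b a d f m N (-c - e - 1) (-e)) = qDouble N a fun s r t w =>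
      (-1) ^ s * (qFact q (d + s) * qFact q (f - s) * qFact q (b + a + d - m - t))
      * (qRF q s * qRF q ((L : ℤ) - s) * qRF q t * qRF q w)
      * (qRF q r * qRF q (b + a + d - m - N + s - t))
      * (qPoch q (-e - (-c - e - 1)) t * qPoch q (-c - e - 1) w)
      * q ^ (N * (d + 1) - s * (m - a + 1) - a * (-e - (-c - e - 1)) + t * (-e + N - s) : ℂ) := by
    refine qDouble_switch_left (fun s t w =>
      (-1) ^ s * (qFact q (d + s) * qFact q (f - s) * qFact q (b + a + d - m - t))
      * (qRF q s * qRF q ((L : ℤ) - s) * qRF q t * qRF q w)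
      * (qRF q ((N : ℤ) - s) * qRF q (b + a + d - m - N + s - t))
      * (qPoch q (-e - (-c - e - 1)) t * qPoch q (-c - e - 1) w)
      * q ^ (N * (d + 1) - s * (m - a + 1) - a * (-e - (-c - e - 1)) + t * (-e + N - s) : ℂ))
      ?_ ?_ ?_ ?_
    · intro s r t w hs
      simp only [factK]
      rw [show (L : ℤ) - s = r by omega]
      push_cast
      rfl
    · intro s r t w hs
      rw [show (N : ℤ) - s = r by omega]
    · intro s t w hs
      simp [qRF_neg (q := q) (n := L - s) (by omega)]
    · intro s t w hs
      simp [qRF_neg (q := q) (n := N - s) (by omega)]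
  rw [hK, dsumE, sum_Icc_eq_qDouble, mul_qDouble, mul_qDouble, qDouble_comm, ← qDouble_swap_left]
  refine qDouble_congr fun s r t w hs ht => ?_
  have hsg : (-1 : ℂ) ^ ((t : ℤ) + r) = (-1) ^ t * (-1) ^ r := by
    rw [← pow_add, ← zpow_natCast]; congr 1
  have hN : (N : ℂ) = s + r := by exact_mod_cast hs.symm
  have ha : (a : ℂ) = t + w := by exact_mod_cast ht.symm
  simp only [qFact_inv, div_eq_mul_inv, mul_inv, inv_qFact, hsg, inv_zpow', zpow_natCast]
  rw [← Complex.cpow_intCast q, ← Complex.cpow_intCast q,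
    qPoch_neg_eq_fact h (x := -c - e - 1) (y := c + e + 1) (z := c + e - a + 1 + t) (k := w)
      (by push_cast; ring) (by omega) (by omega),
    qPoch_eq_fact h (x := -e - (-c - e - 1)) (y := c) (z := c + t) (k := t)
      (by ring) rfl (by omega),
    show (N : ℂ) * (d + 1) - s * (m - a + 1) - a * (-e - (-c - e - 1)) + t * (-e + N - s)
      = ((-(a * (c + 1) - N * (a + d - m)) : ℤ) : ℂ)
        + ((-(t * (e - r) - r * (m - a + 1)) : ℤ) : ℂ) by push_cast; rw [hN]; ring, h.cpow_add,
    show f - N + r = f - (s : ℤ) by omega, show d + N - r = d + (s : ℤ) by omega,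
    show f - b - N + r = L - (s : ℤ) by omega, show (N : ℤ) - r = s by omega,
    show (a : ℤ) - t = w by omega, show a + b + d - m - t - r = b + a + d - m - N + s - (t : ℤ) by omega,
    show a + b + d - m - t = b + a + d - m - (t : ℤ) by ring,
    show m + N - a - b = m + N - b - (a : ℤ) by ring, show f - b = (L : ℕ) by omega,
    show ((-1 : ℂ)) ^ a = (-1) ^ t * (-1) ^ w by rw [← pow_add, ht],
    show ((-1 : ℂ)) ^ N = (-1) ^ s * (-1) ^ r by rw [← pow_add, hs]]
  have i1 := qFact_mul_qRF h hc
  generalize q ^ ((-(a * (c + 1) - N * (a + d - m)) : ℤ) : ℂ) = E1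
  generalize q ^ ((-(t * (e - r) - r * (m - a + 1)) : ℤ) : ℂ) = E2
  symm
  trans (qFact q c * qRF q c) * (((-1) ^ s * (-1) ^ s) * ((-1) ^ w * (-1) ^ w))
    * (qFact q (e - a) * qFact q (c + e + 1) * qFact q L * qRF q b * qRF q (m + N - b - a)
    * ((-1) ^ t * (-1) ^ r) * (qFact q (c + t) * qFact q (b + a + d - m - t) * qFact q (f - s)
    * qFact q (d + s)) * (qRF q t * qRF q w * qRF q (c + e - a + 1 + t) * qRF q (b + a + d - m - N + s - t)
    * qRF q r * qRF q s * qRF q (L - s)) * (E1 * E2))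
  · ring
  · rw [i1, neg_one_sq_pow, neg_one_sq_pow]; ring

/-- The index z of S_G is the first index of `factG`, and the index s of S_G is the second one
reversed, a - t. -/
lemma dsumG_inv (h : QAdm q) (hc : 0 ≤ c) (he : a ≤ e) (hf : f = b + L) :
    dsumG q⁻¹ a b c d e f m n = (-1) ^ n * (-1) ^ L * (qFact q L * qRF q (m + n - b - a))
      * (qFact q (d + f + 1) * qFact q d * qRF q b) * ((-1) ^ a * (qFact q c * qFact q (e - a)))
      * qDouble L a (factG q b a d f m n (-c - e - 1) (-e)) := by
  rw [dsumG, show f - b = (L : ℕ) by omega, sum_Icc_eq_qDouble, mul_qDouble, mul_qDouble,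
    qDouble_comm, ← qDouble_swap_right]
  refine qDouble_congr fun s r t w hs ht => ?_
  have hsg : (-1 : ℂ) ^ ((b : ℤ) - f + n + s) = (-1) ^ n * (-1) ^ L * (-1) ^ s := by
    have hn : (-1 : ℂ) ≠ 0 := by norm_num
    rw [show (b : ℤ) - f + n + s = n + (L + s : ℕ) - (L + L : ℕ) by push_cast; omega,
      zpow_sub₀ hn, zpow_add₀ hn, zpow_natCast, zpow_natCast, pow_add, pow_add,
      neg_one_sq_pow, div_one]
    ring
  have hL : (f : ℂ) = b + s + r := by exact_mod_cast (by omega : f = b + s + r)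
  have ha : (a : ℂ) = t + w := by exact_mod_cast ht.symm
  simp only [factG, qFact_inv, div_eq_mul_inv, mul_inv, inv_qFact, hsg, inv_zpow']
  rw [← Complex.cpow_intCast q, ← Complex.cpow_intCast q,
    qPoch_neg_eq_fact h (x := -c - e - 1) (y := c + e + 1) (z := c + e - a + w + 1) (k := t)
      (by push_cast; ring) (by omega) (by omega),
    qPoch_neg_eq_fact h (x := -e + t) (y := e - a + w) (z := e - a) (k := w)
      (by push_cast; rw [ha]; ring) (by omega) (by omega),
    show (n : ℂ) * (a + d + 1) + (f - b) * (b - m) - s * (b - m - n + t)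
        - t * (b + a + d - m + -e - (-c - e - 1))
      = ((-(a * (a + c + d + 1) - n * (a + d + 1) + (a + b - f) * (b - m)) : ℤ) : ℂ)
        + ((-(-w * (a + b + c + d - m + s + 1) - s * (m + n - a - b)) : ℤ) : ℂ) by
          push_cast; rw [ha]; ring, h.cpow_add,
    show (L : ℤ) - s = r by omega, show (a : ℤ) - w = t by omega,
    show a + d + f - m - n - w = d + f - m - n + (t : ℤ) by omega,
    show b - a - f + n + w + s = n - t - f + b + (s : ℤ) by omega,
    show qRF q (m + n - a - b) = qRF q (m + n - b - a) by congr 1; ring,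
    show (b : ℤ) + d + s + 1 = b + d + 1 + s by ring,
    show ((-1 : ℂ)) ^ a = (-1) ^ t * (-1) ^ w by rw [← pow_add, ht]]
  have i1 := qFact_mul_qRF h (n := e - a) (by omega)
  generalize q ^ ((-(a * (a + c + d + 1) - n * (a + d + 1) + (a + b - f) * (b - m)) : ℤ) : ℂ) = E1
  generalize q ^ ((-(-w * (a + b + c + d - m + s + 1) - s * (m + n - a - b)) : ℤ) : ℂ) = E2
  symm
  trans (qFact q (e - a) * qRF q (e - a)) * (((-1) ^ t * (-1) ^ t) * ((-1) ^ w * (-1) ^ w))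
    * ((-1) ^ n * (-1) ^ L * (-1) ^ s * qFact q L * qRF q (m + n - b - a) * qFact q (d + f + 1)
    * qFact q d * qRF q b * qFact q c * qFact q (c + e + 1) * (qFact q (e - a + w)
    * qFact q (b + s) * qFact q (b + d - m + s)) * (qRF q s * qRF q r * qRF q t * qRF q w)
    * (qRF q (d + f - m - n + t) * qRF q (c + e - a + w + 1) * qRF q (n - t - f + b + s)
    * qRF q (b + d + 1 + s)) * (E1 * E2))
  · ring
  · rw [i1, neg_one_sq_pow, neg_one_sq_pow]; ring

end FactorialSums

/-! ### Equality of the seven sums and their closed forms. -/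

section FactorialSums

variable {a b c d e f m n : ℤ}

lemma dsumA_eq_dsumC_dsumF (h : QAdm q) (ha : 0 ≤ a) (hb : 0 ≤ b) (hc : 0 ≤ c) (hd : 0 ≤ d)
    (hm : 0 ≤ m) (hn : 0 ≤ n) (he : 0 ≤ e - a) (hf : 0 ≤ f - b) :
    dsumA q a b c d e f m n = dsumC q a b c d e f m n ∧
      dsumA q a b c d e f m n = dsumF q a b c d e f m n := by
  obtain ⟨a, rfl⟩ := Int.eq_ofNat_of_zero_le ha
  obtain ⟨b, rfl⟩ := Int.eq_ofNat_of_zero_le hb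
  obtain ⟨L, hL⟩ := Int.eq_ofNat_of_zero_le he
  have he : e = a + L := by omega
  -- The common nonzero multiplier taking S_A, S_C and S_F to the sums of `polyG`, `polyA` and
  -- `polyF`.
  let κ := (-1) ^ a * (qFact q m * qFact q n * qRF q c * qRF q L)
    * q ^ (a * (-c - e - 1) - b * n + a * n : ℂ)
  have hκ : κ ≠ 0 := by
    refine mul_ne_zero (mul_ne_zero (neg_one_pow_ne_zero _) (mul_ne_zero (mul_ne_zero (mul_ne_zero
      (qFact_ne h hm) (qFact_ne h hn)) (qRF_ne h hc)) (qRF_ne h (by omega)))) ?_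
    exact (Complex.cpow_ne_zero_iff).mpr (Or.inl h.1)
  have hA : κ * dsumA q a b c d e f m n = qFact q d * qFact q (f - b)
      * qDouble a b (polyG q (-m) (-n) (-c - e - 1) (-d - f - 1) (-a - c) (-f) a b) := by
    rw [dsumA_eq h hd (by omega), polyG_eq_factA h hc he hm hn rfl rfl rfl rfl, pow_add,
      show (a * (-c - e - 1) + b * -n - a * -n : ℂ) = a * (-c - e - 1) - b * n + a * n by ring]
    ring
  have hC := dsumC_eq h hc hd (f := f) (b := b) (by omega) he hm hn
  have hF := dsumF_eq h hc hd (f := f) (b := b) (by omega) he hm hn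
  constructor
  · refine mul_left_cancel₀ hκ (hA.trans (Eq.trans ?_ hC.symm))
    rw [polyG_eq_polyY _ _ _ _ _ _ _ _ h, ← polyX_eq_polyY _ _ _ _ _ _ _ _ h,
      ← polyA_eq_polyX _ _ _ _ _ _ _ _ h]
  · refine mul_left_cancel₀ hκ (hA.trans (Eq.trans ?_ hF.symm))
    rw [polyG_eq_polyY _ _ _ _ _ _ _ _ h, ← polyX_eq_polyY _ _ _ _ _ _ _ _ h,
      ← polyA_eq_polyX _ _ _ _ _ _ _ _ h, polyA_eq_polyF _ _ _ _ _ _ _ _ h]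

lemma dsumA_eq_dsumB_dsumD (h : QAdm q) (ha : 0 ≤ a) (hb : 0 ≤ b) (hc : 0 ≤ c) (hd : 0 ≤ d)
    (he : 0 ≤ e - a) (hf : 0 ≤ f - b) (hm : m ≤ a + c) (hn : n ≤ e) :
    dsumA q a b c d e f m n = dsumB q a b c d e f m n ∧
      dsumA q a b c d e f m n = dsumD q a b c d e f m n := by
  obtain ⟨a, rfl⟩ := Int.eq_ofNat_of_zero_le ha
  obtain ⟨b, rfl⟩ := Int.eq_ofNat_of_zero_le hb
  obtain ⟨L, hL⟩ := Int.eq_ofNat_of_zero_le he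
  have he : e = a + L := by omega
  rw [dsumA_eq h hd (by omega), dsumB_eq h hd (by omega) he, dsumD_eq h hd (by omega) he]
  constructor
  · rw [factA_eq_factB h hc he hn hm]; ring
  · rw [factA_eq_factD h hc he hn hm]; ring

lemma dsumA_eq_dsumE_dsumG (h : QAdm q) (ha : 0 ≤ a) (hb : 0 ≤ b) (hc : 0 ≤ c) (hd : 0 ≤ d)
    (hn0 : 0 ≤ n) (he : 0 ≤ e - a) (hf : 0 ≤ f - b) (hm : m ≤ b + d) (hn : n ≤ f) :
    dsumA q a b c d e f m n = dsumE q a b c d e f m n ∧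
      dsumA q a b c d e f m n = dsumG q a b c d e f m n := by
  obtain ⟨a, rfl⟩ := Int.eq_ofNat_of_zero_le ha
  obtain ⟨b, rfl⟩ := Int.eq_ofNat_of_zero_le hb
  obtain ⟨n, rfl⟩ := Int.eq_ofNat_of_zero_le hn0
  obtain ⟨L, hL⟩ := Int.eq_ofNat_of_zero_le hf
  have hf : f = b + L := by omega
  -- From here on the chain is applied with the base 1/q and the two groups of parameters exchanged.
  have hA : dsumA q a b c d e f m n = dsumA q⁻¹ b a d c f e m n := by rw [dsumA_inv]
  have hE := dsumE_inv (N := n) (m := m) (d := d) h.inv hc (a := a) (e := e) (by omega) hf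
  have hG := dsumG_inv (m := m) (n := n) (d := d) h.inv hc (a := a) (e := e) (by omega) hf
  rw [inv_inv] at hE hG
  rw [hA, hE, hG, dsumA_eq h.inv hc (by omega)]
  constructor
  · rw [factA_eq_factK h.inv hd hf hn hm]; ring
  · rw [factA_eq_factG h.inv hd hf hn hm]; ring

/-- The factor 1/[n-s-z]! leaves only s = z = 0; for m = 0 the factor 1/[m-a-b+s+z]! leaves only s =
a, z = b. -/
lemma dsumA_of_n_eq_zero (ha : 0 ≤ a) (hb : 0 ≤ b) :
    dsumA q a b c d e f m 0 = qFact q c * qFact q d * qFact q e * qFact q f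
          / (qFact q a * qFact q b * qFact q (m - a - b)) := by
  unfold dsumA
  rw [sum_eq_single 0, sum_eq_single 0]
  · simp only [zero_mul, sub_zero, zpow_zero, add_zero, qFact_zero]
    rw [show qFact q c * qFact q e * qFact q d * qFact q f
      = qFact q c * qFact q d * qFact q e * qFact q f by ring]
    simp
  · intro z hz hz0
    rw [mem_Icc] at hz
    rw [qFact_neg (q := q) (n := 0 - 0 - z) (by omega)]; simp
  · intro h0; simp [hb] at h0
  · intro s hs hs0
    rw [mem_Icc] at hs
    refine sum_eq_zero fun z hz => ?_
    rw [mem_Icc] at hz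
    rw [qFact_neg (q := q) (n := 0 - s - z) (by omega)]; simp
  · intro h0; simp [ha] at h0

lemma dsumA_of_m_eq_zero (ha : 0 ≤ a) (hb : 0 ≤ b) :
    dsumA q a b c d e f 0 n =
        (-1) ^ (a + b) * q ^ (a * (b + c + e - n + 1) - b * (a + d + f - n + 1))
          * (qFact q (a + c) * qFact q (e - a) * qFact q (b + d) * qFact q (f - b))
          / (qFact q a * qFact q b * qFact q (n - a - b)) := by
  unfold dsumA
  rw [sum_eq_single a, sum_eq_single b]
  · simp only [sub_zero, sub_self, qFact_zero]
    rw [show 0 - a - b + a + b = 0 by ring, qFact_zero, add_comm c a, add_comm d b]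
    simp
  · intro z hz hz0
    rw [mem_Icc] at hz
    rw [qFact_neg (q := q) (n := 0 - a - b + a + z) (by omega)]; simp
  · intro h0; simp [hb] at h0
  · intro s hs hs0
    rw [mem_Icc] at hs
    refine sum_eq_zero fun z hz => ?_
    rw [mem_Icc] at hz
    rw [qFact_neg (q := q) (n := 0 - a - b + s + z) (by omega)]; simp
  · intro h0; simp [ha] at h0

lemma dsumD_single (h : QAdm q) (hb : 0 ≤ b) (hc : 0 ≤ c) (ha : 0 ≤ a) (he : 0 ≤ e - a)
    (h0 : b + c + e = m + n) :
    dsumD q a b c d e f m n = (-1) ^ (a + e + n)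
          * q ^ (n * (c + 1) - b * (b + d - m) - (b + e - a) * (c + e - n + 1))
          * (qFact q d * qFact q (d + f + 1) * qFact q (c + e - a) * qFact q (c + e - m)
              * qFact q (f - b))
          / (qFact q (m + n - a - b) * qFact q b * qFact q (n - b)
              * qFact q (d + f - b + 1)) := by
  unfold dsumD
  rw [sum_eq_single 0, sum_eq_single 0]
  · simp only [zero_mul, sub_zero, zpow_zero, add_zero, qFact_zero, mul_one]
    rw [show b + c + e - m - n = 0 by omega, qFact_zero]
    have n1 := qFact_ne h he
    have n2 := qFact_ne h (n := c + e + 1) (by omega)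
    simp only [div_eq_mul_inv, mul_inv, mul_one, one_mul]
    have i1 := mul_inv_cancel₀ n1
    have i2 := mul_inv_cancel₀ n2
    generalize q ^ (n * (c + 1) - b * (b + d - m) - (b + e - a) * (c + e - n + 1)) = E
    trans (qFact q (e - a) * (qFact q (e - a))⁻¹) * (qFact q (c + e + 1) * (qFact q (c + e + 1))⁻¹)
      * ((-1) ^ (a + e + n) * E * (qFact q d * qFact q (d + f + 1) * qFact q (c + e - a)
      * qFact q (c + e - m) * qFact q (f - b)) * ((qFact q (m + n - a - b))⁻¹ * (qFact q b)⁻¹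
      * (qFact q (n - b))⁻¹ * (qFact q (d + f - b + 1))⁻¹))
    · ring
    · rw [i1, i2]; ring
  · intro z hz hz0
    rw [mem_Icc] at hz
    rw [qFact_neg (q := q) (n := b + c + e - m - n - 0 - z) (by omega)]; simp
  · intro h0; simp [hb] at h0
  · intro s hs hs0
    rw [mem_Icc] at hs
    refine sum_eq_zero fun z hz => ?_
    rw [mem_Icc] at hz
    rw [qFact_neg (q := q) (n := b + c + e - m - n - s - z) (by omega)]; simp
  · intro h0; rw [mem_Icc] at h0; omega

lemma dsumE_single (h : QAdm q) (ha : 0 ≤ a) (hf : 0 ≤ f - b) (h0 : a + d + f = m + n) :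
    dsumE q a b c d e f m n = (-1) ^ (b + n - f)
          * q ^ (a * (c + 1) - n * (a + d - m) - (b + n - f) * (m - a + 1))
          * (qFact q (e - a) * qFact q (c + e + 1) * qFact q (f - b) * qFact q c
              * qFact q b * qFact q (d + f - b) * qFact q (a + b + d - m))
          / (qFact q b * qFact q (m + n - a - b) * qFact q a * qFact q (c + e - a + 1)
              * qFact q (b + n - f) * qFact q (f - b)) := by
  unfold dsumE
  -- By h0, a + b + d - m = b + n - f, so the two constrained factorials force z ≥ b + n - f and s +
  -- z ≤ b + n - f.
  rw [sum_eq_single 0, sum_eq_single (b + n - f)]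
  · rw [show a + b + d - m - 0 - (b + n - f) = 0 by omega, qFact_zero,
      show f - n + (b + n - f) = b by ring, show d + n - (b + n - f) = d + f - b by ring,
      show n - (b + n - f) = f - b by ring, show f - b - n + (b + n - f) = 0 by ring, qFact_zero]
    simp only [zero_mul, zero_sub, sub_zero, zero_add, add_zero]
    rw [sub_eq_add_neg (a * (c + 1) - n * (a + d - m)), zpow_add₀ h.1]
    simp only [div_eq_mul_inv, mul_inv, inv_one]
    ring
  · intro z hz hz0
    rw [mem_Icc] at hz
    rcases lt_or_gt_of_ne hz0 with h1 | h1
    · rw [qFact_neg (q := q) (n := f - b - n + z) (by omega)]; simp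
    · rw [qFact_neg (q := q) (n := a + b + d - m - 0 - z) (by omega)]; simp
  -- The surviving index leaves the range only if b + n - f < 0; the closed form then contains
  -- 1/[b+n-f]! = 0 as well.
  · intro h1
    rw [mem_Icc] at h1
    rw [qFact_neg (q := q) (n := b + n - f) (by omega)]; simp
  · intro s hs hs0
    rw [mem_Icc] at hs
    refine sum_eq_zero fun z hz => ?_
    rw [mem_Icc] at hz
    rcases lt_or_ge (f - b - n + z) 0 with h1 | h1
    · rw [qFact_neg h1]; simp
    · rw [qFact_neg (q := q) (n := a + b + d - m - s - z) (by omega)]; simp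
  · intro h0; rw [mem_Icc] at h0; omega

theorem dsum_identities (h : QAdm q) (ha : 0 ≤ a) (hb : 0 ≤ b) (hc : 0 ≤ c) (hd : 0 ≤ d)
    (hm : 0 ≤ m) (hn : 0 ≤ n) (he : 0 ≤ e - a) (hf : 0 ≤ f - b) :
      dsumA q a b c d e f m n = dsumC q a b c d e f m n ∧
      dsumA q a b c d e f m n = dsumF q a b c d e f m n ∧
      (m ≤ a + c → n ≤ e →
        dsumA q a b c d e f m n = dsumB q a b c d e f m n ∧
        dsumA q a b c d e f m n = dsumD q a b c d e f m n) ∧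
      (m ≤ b + d → n ≤ f →
        dsumA q a b c d e f m n = dsumE q a b c d e f m n ∧
        dsumA q a b c d e f m n = dsumG q a b c d e f m n) ∧
      (n = 0 → dsumA q a b c d e f m n =
        qFact q c * qFact q d * qFact q e * qFact q f
          / (qFact q a * qFact q b * qFact q (m - a - b))) ∧
      (m = 0 → dsumA q a b c d e f m n =
        (-1) ^ (a + b) * q ^ (a * (b + c + e - n + 1) - b * (a + d + f - n + 1))
          * (qFact q (a + c) * qFact q (e - a) * qFact q (b + d) * qFact q (f - b))
          / (qFact q a * qFact q b * qFact q (n - a - b))) ∧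
      (m ≤ a + c → n ≤ e → b + c + e = m + n → dsumA q a b c d e f m n =
        (-1) ^ (a + e + n)
          * q ^ (n * (c + 1) - b * (b + d - m) - (b + e - a) * (c + e - n + 1))
          * (qFact q d * qFact q (d + f + 1) * qFact q (c + e - a) * qFact q (c + e - m)
              * qFact q (f - b))
          / (qFact q (m + n - a - b) * qFact q b * qFact q (n - b)
              * qFact q (d + f - b + 1))) ∧
      (m ≤ b + d → n ≤ f → a + d + f = m + n → dsumA q a b c d e f m n =
        (-1) ^ (b + n - f)
          * q ^ (a * (c + 1) - n * (a + d - m) - (b + n - f) * (m - a + 1))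
          * (qFact q (e - a) * qFact q (c + e + 1) * qFact q (f - b) * qFact q c
              * qFact q b * qFact q (d + f - b) * qFact q (a + b + d - m))
          / (qFact q b * qFact q (m + n - a - b) * qFact q a * qFact q (c + e - a + 1)
              * qFact q (b + n - f) * qFact q (f - b))) := by
  obtain ⟨hC, hF⟩ := dsumA_eq_dsumC_dsumF h ha hb hc hd hm hn he hf
  refine ⟨hC, hF, fun h1 h2 => dsumA_eq_dsumB_dsumD h ha hb hc hd he hf h1 h2,
    fun h1 h2 => dsumA_eq_dsumE_dsumG h ha hb hc hd hn he hf h1 h2, ?_, ?_,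
    fun h1 h2 h3 => ?_, fun h1 h2 h3 => ?_⟩
  · rintro rfl; exact dsumA_of_n_eq_zero ha hb
  · rintro rfl; exact dsumA_of_m_eq_zero ha hb
  · rw [(dsumA_eq_dsumB_dsumD h ha hb hc hd he hf h1 h2).2, dsumD_single h hb hc ha he h3]
  · rw [(dsumA_eq_dsumE_dsumG h ha hb hc hd hn he hf h1 h2).1, dsumE_single h ha hf h3]

end FactorialSums

/-! ### Integer parameters subject to the triangular conditions. -/

section Triangular

variable {b1 b1' b2 d : ℤ} {m n L : ℕ} {c2 f : ℂ}

/-- Φ_A enters the factorial chain with a = m, b = n, c = -d-m, e = d+m-b2-1, M = -b1, N = -b1', so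
that the new length e - a is L = d-b2-1. -/
lemma kdfA_triangular (h : QAdm q) (hb1 : b1 ≤ 0) (hb1' : b1' ≤ 0) (hL : d - b2 - 1 = L)
    (hd : d ≤ -m) (hmn : (m : ℤ) + n ≤ -b1 - b1') (hf : qPoch q f n ≠ 0) :
    kdfA q b1 b1' b2 c2 d f m n * (qFact q (-b1 - b1') * qFact q (-d) * qPoch q f n)
      = (-1) ^ m * (qFact q m * qFact q n * qFact q (-b1) * qFact q (-b1') * qRF q L
        * qFact q (-b1 - b1' - m - n)) * q ^ (m * b2 + n * b1' - m * b1' : ℂ)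
        * qDouble m n (factA q m n (-d - m) (d + m - b2 - 1) (-b1) (-b1') c2 f) := by
  have e0 := qPoch_neg_eq_fact h (x := b1 + b1') (y := -b1 - b1') (z := -b1 - b1' - m - n)
    (k := m + n) (by push_cast; ring) (by push_cast; ring) (by omega)
  have e1 := qPoch_neg_eq_fact h (x := d) (y := -d) (z := -d - m) (k := m)
    (by push_cast; ring) (by ring) (by omega)
  have n0 : qPoch q (b1 + b1') (m + n) ≠ 0 := by
    rw [e0]
    exact mul_ne_zero (mul_ne_zero (neg_one_pow_ne_zero _) (qFact_ne h (by omega)))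
      (qRF_ne h (by omega))
  have n1 : qPoch q d m ≠ 0 := by
    rw [e1]
    exact mul_ne_zero (mul_ne_zero (neg_one_pow_ne_zero _) (qFact_ne h (by omega)))
      (qRF_ne h (by omega))
  have key := kdfA_eq (b2 := b2) (c2 := c2) h n0 n1 hf
  rw [polyA_eq_polyX _ _ _ _ _ _ _ _ h, polyX_eq_polyY _ _ _ _ _ _ _ _ h,
    ← polyG_eq_polyY _ _ _ _ _ _ _ _ h, polyG_eq_factA h (c := -d - m) (e := d + m - b2 - 1)
      (M := -b1) (N := -b1') (L := L) (by omega) (by omega) (by omega) (by omega)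
      (by push_cast; ring) (by push_cast; ring) (by push_cast; ring) (by push_cast; ring),
    e0, e1] at key
  have i1 := qFact_mul_qRF h (n := -b1 - b1' - m - n) (by omega)
  have i2 := qFact_mul_qRF h (n := -d - m) (by omega)
  have s1 := neg_one_sq_pow (m + n)
  have s2 := neg_one_sq_pow m
  generalize kdfA q b1 b1' b2 c2 d f m n = K at *
  generalize q ^ (m * b2 + n * b1' - m * b1' : ℂ) = E at *
  generalize qDouble m n (factA q m n (-d - m) (d + m - b2 - 1) (-b1) (-b1') c2 f) = S at *
  trans (qFact q (-b1 - b1' - m - n) * qRF q (-b1 - b1' - m - n))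
    * (qFact q (-d - m) * qRF q (-d - m)) * ((-1) ^ (m + n) * (-1) ^ (m + n))
    * ((-1) ^ m * (-1) ^ m) * (K * (qFact q (-b1 - b1') * qFact q (-d) * qPoch q f n))
  · rw [i1, i2, s1, s2]; ring
  · trans qFact q (-b1 - b1' - m - n) * qFact q (-d - m) * (-1) ^ (m + n) * (-1) ^ m
      * (qFact q m * qFact q n * ((-1) ^ (m + n) * (qFact q (-b1) * qFact q (-b1')
        * qRF q (-d - m) * qRF q L) * E * S))
    · rw [← key]; ring
    · trans (qFact q (-d - m) * qRF q (-d - m)) * ((-1) ^ (m + n) * (-1) ^ (m + n))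
        * ((-1) ^ m * (qFact q m * qFact q n * qFact q (-b1) * qFact q (-b1') * qRF q L
        * qFact q (-b1 - b1' - m - n)) * E * S)
      · ring
      · rw [i2, s1]; ring

lemma qBinom_eq (k r : ℤ) :
    qBinom q k r = qFact q k * q ^ ((r : ℂ) * (k - r)) * (qRF q r * qRF q (k - r)) := by
  rw [qBinom, ← Complex.cpow_intCast q, div_eq_mul_inv, mul_inv]
  push_cast
  rfl

/-- The prefactors of Φ_C, Φ_I and Φ_K share a ratio of symbols with subscript -d-m and a Gaussian
binomial; both reduce to factorials here, with A, B, C standing for what differs. -/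
lemma triangular_prefactor (h : QAdm q) (hb1 : b1 ≤ 0) (hb1' : b1' ≤ 0) (hL : d - b2 - 1 = L)
    (hd : d ≤ -m) (hf : qPoch q f n ≠ 0) (A B C : ℂ) :
    A * (C / qPoch q f n * qPochRatio q (d - b2) (m + 1) (-d - m))
        * (B / qBinom q (-b1 - b1') (-b1)) * (qFact q (-b1 - b1') * qFact q (-d) * qPoch q f n)
      = A * B * C * q ^ (-(b1 * b1' : ℂ)) * (qFact q (-b2 - 1 - m) * qRF q L * qFact q m
        * qFact q (-b1) * qFact q (-b1')) := by
  obtain ⟨c, hc⟩ := Int.eq_ofNat_of_zero_le (a := -d - m) (by omega)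
  have e1 := qPoch_eq_fact h (x := (d : ℂ) - b2) (y := L) (z := -b2 - 1 - m) (k := c)
    (by rw [← hL]; push_cast; ring) (by omega) (by omega)
  have e2 := qPoch_eq_fact h (x := (m : ℂ) + 1) (y := m) (z := -d) (k := c)
    (by push_cast; ring) (by omega) (by omega)
  rw [qBinom_eq, qPochRatio, if_pos (by omega), hc, Int.toNat_natCast, e1, e2,
    show -b1 - b1' - -b1 = -b1' by ring]
  have hE : q ^ (((-b1 : ℤ) : ℂ) * ((-b1 - b1' : ℤ) - (-b1 : ℤ))) * q ^ (-(b1 * b1' : ℂ)) = 1 := by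
    rw [← h.cpow_add, show ((-b1 : ℤ) : ℂ) * ((-b1 - b1' : ℤ) - (-b1 : ℤ)) + -(b1 * b1' : ℂ) = 0 by
      push_cast; ring, Complex.cpow_zero]
  have n1 := left_ne_zero_of_mul_eq_one hE
  rw [eq_inv_of_mul_eq_one_right hE]
  generalize q ^ (((-b1 : ℤ) : ℂ) * ((-b1 - b1' : ℤ) - (-b1 : ℤ))) = E at *
  have i1 := qFact_ne h (n := m) (by omega)
  have i2 := qFact_ne h (n := -b1) (by omega)
  have i3 := qFact_ne h (n := -b1') (by omega)
  have i4 := qFact_ne h (n := -d) (by omega)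
  have i5 := qFact_ne h (n := -b1 - b1') (by omega)
  have i6 := qFact_ne h (n := L) (by omega)
  simp only [qRF]
  field_simp

/-- The parameter b2-d+1 = -L terminates the first sum, and reversing both indices gives `factD`.
The other numerator parameter b2-b1-b1'-n+1 is the negative of an integer that is nonnegative by hW.
-/
lemma kdfC_triangular (h : QAdm q) (hb1 : b1 ≤ 0) (hb1' : b1' ≤ 0) (hL : d - b2 - 1 = L)
    (hd : d ≤ -m) (hdb : d ≤ b1) (hW : 0 ≤ b1 + b1' - b2 - 1 + n) (hn : n ≤ -b1')
    (hf : qPoch q f n ≠ 0) (hc2 : qPoch q c2 n ≠ 0) :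
    kdfC q b1 b1' b2 c2 d f m n * (qFact q (-b1 - b1') * qFact q (-d) * qPoch q f n)
      = (-1) ^ (m + b1') * (qFact q m * qFact q n * qFact q (-b1) * qFact q (-b1')
        * qFact q (-b2)) * q ^ (m * b2 + n * b1' - m * b1' : ℂ)
        * qDouble L n (factD q m n (-d - m) (d + m - b2 - 1) (-b1) (-b1') c2 f) := by
  have hLc : (L : ℂ) = d - b2 - 1 := by exact_mod_cast hL.symm
  trans qKdF (-1) [-((b1 + b1' - b2 - 1 + n : ℤ) : ℂ)] [] [-L, b2] [b2 + m + 1, b2 - b1 + 1]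
      [1 - f - n, -n] [1 - b1' - n, 1 - c2 - n]
      (q ^ ((b2 : ℂ) - b1' - d - m - n + 1)) (q ^ (b2 - b1 + c2 - f - n + 1)) q
    * ((-1) ^ (b1' + b2 + d + m - 1)
      * q ^ (n * (c2 - f) + b2 * (d + m - b2 - 1) + b1' * (2 * b1 + b1' + 2 * n - 1))
      * (qFact q (b1 - b2 - 1) * q ^ (((-b1' - n : ℤ) : ℂ) * ((b1 - b2 - 1 : ℤ) - (-b1' - n : ℤ)))
        * (qRF q (-b1' - n) * qRF q (b1 + b1' - b2 - 1 + n))) * qPoch q c2 n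
      * q ^ (-(b1 * b1' : ℂ)) * (qFact q (-b2 - 1 - m) * qRF q L * qFact q m
        * qFact q (-b1) * qFact q (-b1')))
  · unfold kdfC
    rw [mul_assoc, mul_assoc, mul_assoc, ← mul_assoc (_ * _) (_ * _) _, ← mul_assoc (_ * _ * _) _ _,
      triangular_prefactor h hb1 hb1' hL hd hf, qBinom_eq,
      show b1 - b2 - 1 - (-b1' - n) = b1 + b1' - b2 - 1 + n by ring,
      show (b2 : ℂ) - b1 - b1' - n + 1 = -((b1 + b1' - b2 - 1 + n : ℤ) : ℂ) by push_cast; ring,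
      show (b2 : ℂ) - d + 1 = -L by rw [hLc]; ring]
  rw [qKdF_eq_qDouble h 1 1 L n (fun s t => -(s * (b2 - b1' - d - m - n + 1))
      - t * (b2 - b1 + c2 - f - n + 1) - s * t) (by simp) (by simp)
      (by intro s t; push_cast; ring)
      (by intro s hs; simp [qPoch_neg_nat_eq_zero hs])
      (by intro t ht; simp [qPoch_neg_nat_eq_zero ht]), mul_comm, mul_qDouble, mul_qDouble,
    ← qDouble_swap]
  refine qDouble_congr fun s r t w hs ht => ?_
  have hnc : (n : ℂ) = t + w := by exact_mod_cast ht.symm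
  have hLc' : (L : ℂ) = s + r := by exact_mod_cast hs.symm
  have f1 := qFact_eq_mul_qPoch_neg h (x := b2 + m + 1) (z := -b2 - 1 - m) (y := -d - m + s)
    (k := r) (by push_cast; ring) (by omega) (by omega)
  have f2 := qFact_eq_mul_qPoch_neg h (x := b2 - b1 + 1) (z := b1 - b2 - 1) (y := -d + b1 + s)
    (k := r) (by push_cast; ring) (by omega) (by omega)
  have f3 := qPoch_mul_qRF h (x := 1 - b1' - n) (y := -b1' - n) (z := -b1' - t) (k := w)
    (by push_cast; ring) (by omega)
  have f4 := qPoch_add (q := q) c2 t w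
  rw [ht] at f4
  have r4 := qPoch_reflect (q := q) (c2 + t) (1 - c2 - n) w (by rw [hnc]; ring)
  have r5 := qPoch_reflect (q := q) (f + t) (1 - f - n) w (by rw [hnc]; ring)
  -- Each integer denominator relates factorials of nonnegative integers and therefore cannot vanish
  -- within the range of summation.
  have n1 : qPoch q (b2 + m + 1) r ≠ 0 := by
    intro h0; rw [h0, mul_zero] at f1; exact qFact_ne h (by omega) f1
  have n2 : qPoch q (b2 - b1 + 1) r ≠ 0 := by
    intro h0; rw [h0, mul_zero] at f2; exact qFact_ne h (by omega) f2
  have n3 : qPoch q (1 - b1' - n) w ≠ 0 := by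
    intro h0; rw [h0, zero_mul] at f3; exact qRF_ne h (by omega) f3.symm
  have n4 : qPoch q (1 - c2 - n) w ≠ 0 := by
    rw [r4]
    refine mul_ne_zero (neg_one_pow_ne_zero _) ?_
    rw [f4] at hc2
    exact right_ne_zero_of_mul hc2
  have f5 : qPoch q c2 n = (-1) ^ w * qPoch q c2 t * qPoch q (1 - c2 - n) w := by
    rw [f4, r4]
    linear_combination (-(qPoch q c2 t * qPoch q (c2 + t) w)) * neg_one_sq_pow w
  have g1 := qPoch_neg_eq_fact h (x := -((b1 + b1' - b2 - 1 + n : ℤ) : ℂ))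
    (y := b1 + b1' - b2 - 1 + n) (z := -d + b1 + b1' + s + t) (k := r + w) rfl (by omega) hW
  have g2 := qPoch_neg_eq_fact h (x := b2) (y := -b2) (z := -d + 1 + s) (k := r)
    (by push_cast; ring) (by omega) (by omega)
  have hE : q ^ (n * (c2 - f) + b2 * (d + m - b2 - 1) + b1' * (2 * b1 + b1' + 2 * n - 1))
      * q ^ (((-b1' - n : ℤ) : ℂ) * ((b1 - b2 - 1 : ℤ) - (-b1' - n : ℤ))) * q ^ (-(b1 * b1' : ℂ))
      * q ^ (-(r * (b2 - b1' - d - m - n + 1)) - w * (b2 - b1 + c2 - f - n + 1) - r * w : ℂ)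
      = q ^ (m * b2 + n * b1' - m * b1' : ℂ) * q ^ ((-b1' : ℤ) * (n + (-d - m : ℤ) + 1)
        - ((d + m - b2 - 1 : ℤ) - m) * ((-d - m : ℤ) + 1) + s * ((-b1' : ℤ) - t - (d + m - b2 - 1 : ℤ))
        - t * (m + n + (-d - m : ℤ) - (-b1 : ℤ) + f - c2) : ℂ) := by
    rw [← h.cpow_add, ← h.cpow_add, ← h.cpow_add, ← h.cpow_add]
    congr 1
    rw [show (w : ℂ) = n - t by rw [hnc]; ring, show (r : ℂ) = d - b2 - 1 - s by
      rw [← hLc, hLc']; ring]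
    push_cast
    ring
  have hsg : (-1 : ℂ) ^ (b1' + b2 + d + m - 1) = (-1) ^ (m + b1') * ((-1) ^ s * (-1) ^ r) := by
    have hn : (-1 : ℂ) ≠ 0 := by norm_num
    rw [show b1' + b2 + d + m - 1 = (m + b1') + (s + r : ℕ) + (b2 + b2) by push_cast; omega,
      zpow_add₀ hn, zpow_add₀ hn, zpow_natCast, pow_add, zpow_add₀ hn b2, neg_one_zpow_sq, mul_one]
  simp only [factD]
  rw [show (m : ℤ) + (-d - m) - -b1 + s = -d + b1 + s by ring,
    show (m : ℤ) + (-d - m) - -b1 - -b1' + s + t = -d + b1 + b1' + s + t by ring,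
    show (m : ℤ) + (-d - m) + 1 + s = -d + 1 + s by ring, mul_comm]
  rw [qKdFTerm_mul ((-1) ^ (b1' + b2 + d + m - 1)
      * q ^ (n * (c2 - f) + b2 * (d + m - b2 - 1) + b1' * (2 * b1 + b1' + 2 * n - 1))
      * q ^ (((-b1' - n : ℤ) : ℂ) * ((b1 - b2 - 1 : ℤ) - (-b1' - n : ℤ)))
      * q ^ (-(b1 * b1' : ℂ)) * ((-1) ^ r * qFact q (-d - m + s)) * ((-1) ^ r * qFact q (-d + b1 + s))
      * qRF q (-b1' - t) * ((-1) ^ w * qPoch q c2 t) * qRF q (b1 + b1' - b2 - 1 + n) * qRF q L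
      * qFact q m * qFact q (-b1) * qFact q (-b1')) (by simp) (by simp [n1, n2]) (by simp [n3, n4])
      (by simp only [qPochs_cons, qPochs_nil, mul_one]; rw [f1, f2, ← f3, f5]; ring)]
  simp only [qPochs_cons, qPochs_nil, mul_one]
  rw [g1, g2, r5, qPoch_neg_nat h (s := r) (r := s) (m := L) (by omega),
    qPoch_neg_nat h (s := w) (r := t) (m := n) (by omega), hsg, pow_add]
  have i1 := qFact_mul_qRF h hW
  have i2 := qFact_mul_qRF h (n := L) (by omega)
  let V := (-1) ^ (m + b1') * (-1) ^ s * (qFact q m * qFact q n * qFact q (-b1) * qFact q (-b1')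
        * qFact q (-b2)) * (qFact q (-d - m + s) * qFact q (-d + b1 + s))
    * (qRF q s * qRF q r * qRF q t * qRF q w)
    * (qRF q (-b1' - t) * qRF q (-d + b1 + b1' + s + t) * qRF q (-d + 1 + s))
    * (qPoch q c2 t * qPoch q (f + t) w)
  trans (qFact q (b1 + b1' - b2 - 1 + n) * qRF q (b1 + b1' - b2 - 1 + n)) * (qFact q L * qRF q L)
    * (((-1) ^ r * (-1) ^ r) * ((-1) ^ r * (-1) ^ r) * ((-1) ^ r * (-1) ^ r)
    * ((-1) ^ w * (-1) ^ w) * ((-1) ^ w * (-1) ^ w)) * V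
    * (q ^ (n * (c2 - f) + b2 * (d + m - b2 - 1) + b1' * (2 * b1 + b1' + 2 * n - 1))
      * q ^ (((-b1' - n : ℤ) : ℂ) * ((b1 - b2 - 1 : ℤ) - (-b1' - n : ℤ))) * q ^ (-(b1 * b1' : ℂ))
      * q ^ (-(r * (b2 - b1' - d - m - n + 1)) - w * (b2 - b1 + c2 - f - n + 1) - r * w : ℂ))
  · ring
  · rw [hE, i1, i2, neg_one_sq_pow, neg_one_sq_pow]
    ring

end Triangular

section Triangular

variable {b1 b1' b2 d : ℤ} {m n L : ℕ} {c2 f : ℂ}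

/-- Again both indices are reversed, now giving `factB`. The joint denominator parameter is one more
than the integer in hV, so its symbol becomes the factor 1/[N-s-t]! of `factB`. -/
lemma kdfI_triangular (h : QAdm q) (hb1 : b1 ≤ 0) (hb1' : b1' ≤ 0) (hL : d - b2 - 1 = L)
    (hd : d ≤ -m) (hW : 0 ≤ b1 + b1' - b2 - 1 + n) (hV : 0 ≤ b2 - b1' - d - n + 1)
    (hf : qPoch q f n ≠ 0) (hc2 : qPoch q c2 n ≠ 0) :
    kdfI q b1 b1' b2 c2 d f m n * (qFact q (-b1 - b1') * qFact q (-d) * qPoch q f n)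
      = (-1) ^ (m + b1') * (qFact q m * qFact q n * qFact q (-b1) * qFact q (-b1')
        * (qRF q m * qFact q (b1 - d))) * q ^ (m * b2 + n * b1' - m * b1' : ℂ)
        * qDouble L n (factB q m n (-d - m) (d + m - b2 - 1) (-b1) (-b1') c2 f) := by
  have hLc : (L : ℂ) = d - b2 - 1 := by exact_mod_cast hL.symm
  trans qKdF 1 [-((b1 + b1' - b2 - 1 + n : ℤ) : ℂ)] [((b2 - b1' - d - n + 1 : ℤ) : ℂ) + 1]
      [-L, m + 1] [b2 + m + 1] [1 - f - n, -n] [1 - c2 - n]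
      (q ^ (-(b1 : ℂ) + 1)) (q ^ (d - f - b1 + c2 - n)) q
    * ((-1) ^ (b1' + b2 + d + m - 1)
      * q ^ (b2 * (2 * b1' - b2 + d + m - 1) - b1' * (b1' - 1) + n * (c2 - f)
          + 2 * (b2 - b1 - b1' - n + 1) * (b2 - b1' - d + 1))
      * (qFact q (b1 - d) * q ^ (((b1 + b1' - b2 + n - 1 : ℤ) : ℂ)
          * ((b1 - d : ℤ) - (b1 + b1' - b2 + n - 1 : ℤ)))
        * (qRF q (b1 + b1' - b2 + n - 1) * qRF q (b2 - b1' - d - n + 1))) * qPoch q c2 n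
      * q ^ (-(b1 * b1' : ℂ)) * (qFact q (-b2 - 1 - m) * qRF q L * qFact q m
        * qFact q (-b1) * qFact q (-b1')))
  · unfold kdfI
    rw [mul_assoc, mul_assoc, mul_assoc, ← mul_assoc (_ * _) (_ * _) _, ← mul_assoc (_ * _ * _) _ _,
      triangular_prefactor h hb1 hb1' hL hd hf, qBinom_eq,
      show b1 - d - (b1 + b1' - b2 + n - 1) = b2 - b1' - d - n + 1 by ring,
      show (b2 : ℂ) - b1 - b1' - n + 1 = -((b1 + b1' - b2 - 1 + n : ℤ) : ℂ) by push_cast; ring,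
      show (b2 : ℂ) - b1' - d - n + 2 = ((b2 - b1' - d - n + 1 : ℤ) : ℂ) + 1 by push_cast; ring,
      show (b2 : ℂ) - d + 1 = -L by rw [hLc]; ring]
  rw [qKdF_eq_qDouble h (-1) 0 L n (fun s t => s * (-b1 + 1) - t * (d - f - b1 + c2 - n))
      (by simp) (by simp) (by intro s t; push_cast; ring)
      (by intro s hs; simp [qPoch_neg_nat_eq_zero hs])
      (by intro t ht; simp [qPoch_neg_nat_eq_zero ht]), mul_comm, mul_qDouble, mul_qDouble,
    ← qDouble_swap]
  refine qDouble_congr fun s r t w hs ht => ?_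
  have hnc : (n : ℂ) = t + w := by exact_mod_cast ht.symm
  have hLc' : (L : ℂ) = s + r := by exact_mod_cast hs.symm
  have f1 := qFact_eq_mul_qPoch_neg h (x := b2 + m + 1) (z := -b2 - 1 - m) (y := -d - m + s)
    (k := r) (by push_cast; ring) (by omega) (by omega)
  have f3 := qPoch_mul_qRF h (x := ((b2 - b1' - d - n + 1 : ℤ) : ℂ) + 1) (y := b2 - b1' - d - n + 1)
    (z := -b1' - s - t) (k := r + w) rfl (by omega)
  have f4 := qPoch_add (q := q) c2 t w
  rw [ht] at f4
  have r4 := qPoch_reflect (q := q) (c2 + t) (1 - c2 - n) w (by rw [hnc]; ring)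
  have r5 := qPoch_reflect (q := q) (f + t) (1 - f - n) w (by rw [hnc]; ring)
  have n1 : qPoch q (b2 + m + 1) r ≠ 0 := by
    intro h0; rw [h0, mul_zero] at f1; exact qFact_ne h (by omega) f1
  have n3 : qPoch q (((b2 - b1' - d - n + 1 : ℤ) : ℂ) + 1) (r + w) ≠ 0 := by
    intro h0; rw [h0, zero_mul] at f3; exact qRF_ne h (by omega) f3.symm
  have n4 : qPoch q (1 - c2 - n) w ≠ 0 := by
    rw [r4]
    refine mul_ne_zero (neg_one_pow_ne_zero _) ?_
    rw [f4] at hc2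
    exact right_ne_zero_of_mul hc2
  have f5 : qPoch q c2 n = (-1) ^ w * qPoch q c2 t * qPoch q (1 - c2 - n) w := by
    rw [f4, r4]
    linear_combination (-(qPoch q c2 t * qPoch q (c2 + t) w)) * neg_one_sq_pow w
  have g1 := qPoch_neg_eq_fact h (x := -((b1 + b1' - b2 - 1 + n : ℤ) : ℂ))
    (y := b1 + b1' - b2 - 1 + n) (z := -d + b1 + b1' + s + t) (k := r + w) rfl (by omega) hW
  have g2 := qPoch_eq_fact h (x := m + 1) (y := m) (z := d + m - b2 - 1 - s) (k := r)
    (by push_cast; ring) (by omega) (by omega)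
  have hE : q ^ (b2 * (2 * b1' - b2 + d + m - 1) - b1' * (b1' - 1) + n * (c2 - f)
          + 2 * (b2 - b1 - b1' - n + 1) * (b2 - b1' - d + 1))
      * q ^ (((b1 + b1' - b2 + n - 1 : ℤ) : ℂ) * ((b1 - d : ℤ) - (b1 + b1' - b2 + n - 1 : ℤ)))
      * q ^ (-(b1 * b1' : ℂ))
      * q ^ (r * (-b1 + 1) - w * (d - f - b1 + c2 - n) : ℂ)
      = q ^ (m * b2 + n * b1' - m * b1' : ℂ) * q ^ ((-b1' : ℤ) * (n + (-d - m : ℤ) + 1)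
        - s * ((-b1 : ℤ) + 1) - t * (m + n + (-d - m : ℤ) - (-b1 : ℤ) + f - c2) : ℂ) := by
    rw [← h.cpow_add, ← h.cpow_add, ← h.cpow_add, ← h.cpow_add]
    congr 1
    rw [show (w : ℂ) = n - t by rw [hnc]; ring, show (r : ℂ) = d - b2 - 1 - s by
      rw [← hLc, hLc']; ring]
    push_cast
    ring
  have hsg : (-1 : ℂ) ^ (b1' + b2 + d + m - 1) = (-1) ^ (m + b1') * ((-1) ^ s * (-1) ^ r) := by
    have hn : (-1 : ℂ) ≠ 0 := by norm_num
    rw [show b1' + b2 + d + m - 1 = (m + b1') + (s + r : ℕ) + (b2 + b2) by push_cast; omega,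
      zpow_add₀ hn, zpow_add₀ hn, zpow_natCast, pow_add, zpow_add₀ hn b2, neg_one_zpow_sq, mul_one]
  simp only [factB]
  rw [show (m : ℤ) + (-d - m) - -b1 - -b1' + s + t = -d + b1 + b1' + s + t by ring, mul_comm]
  rw [qKdFTerm_mul ((-1) ^ (b1' + b2 + d + m - 1)
      * q ^ (b2 * (2 * b1' - b2 + d + m - 1) - b1' * (b1' - 1) + n * (c2 - f)
          + 2 * (b2 - b1 - b1' - n + 1) * (b2 - b1' - d + 1))
      * q ^ (((b1 + b1' - b2 + n - 1 : ℤ) : ℂ) * ((b1 - d : ℤ) - (b1 + b1' - b2 + n - 1 : ℤ)))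
      * q ^ (-(b1 * b1' : ℂ)) * ((-1) ^ r * qFact q (-d - m + s)) * qFact q (b1 - d)
      * qRF q (-b1' - s - t) * ((-1) ^ w * qPoch q c2 t) * qRF q (b1 + b1' - b2 + n - 1) * qRF q L
      * qFact q m * qFact q (-b1) * qFact q (-b1')) (by simpa using n3) (by simp [n1]) (by simp [n4])
      (by simp only [qPochs_cons, qPochs_nil, mul_one]; rw [f1, ← f3, f5]; ring)]
  simp only [qPochs_cons, qPochs_nil, mul_one]
  rw [g1, g2, r5, qPoch_neg_nat h (s := r) (r := s) (m := L) (by omega),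
    qPoch_neg_nat h (s := w) (r := t) (m := n) (by omega), hsg, pow_add,
    show qRF q (b1 + b1' - b2 + n - 1) = qRF q (b1 + b1' - b2 - 1 + n) by congr 1; ring]
  have i1 := qFact_mul_qRF h hW
  have i2 := qFact_mul_qRF h (n := L) (by omega)
  let V := (-1) ^ (m + b1') * (-1) ^ s * (qFact q m * qFact q n * qFact q (-b1) * qFact q (-b1')
        * (qRF q m * qFact q (b1 - d))) * (qFact q (-d - m + s) * qFact q (d + m - b2 - 1 - s))
    * (qRF q s * qRF q r * qRF q t * qRF q w)
    * (qRF q (-b1' - s - t) * qRF q (-d + b1 + b1' + s + t))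
    * (qPoch q c2 t * qPoch q (f + t) w)
  trans (qFact q (b1 + b1' - b2 - 1 + n) * qRF q (b1 + b1' - b2 - 1 + n)) * (qFact q L * qRF q L)
    * (((-1) ^ r * (-1) ^ r) * ((-1) ^ r * (-1) ^ r)
    * ((-1) ^ w * (-1) ^ w) * ((-1) ^ w * (-1) ^ w)) * V
    * (q ^ (b2 * (2 * b1' - b2 + d + m - 1) - b1' * (b1' - 1) + n * (c2 - f)
          + 2 * (b2 - b1 - b1' - n + 1) * (b2 - b1' - d + 1))
      * q ^ (((b1 + b1' - b2 + n - 1 : ℤ) : ℂ) * ((b1 - d : ℤ) - (b1 + b1' - b2 + n - 1 : ℤ)))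
      * q ^ (-(b1 * b1' : ℂ))
      * q ^ (r * (-b1 + 1) - w * (d - f - b1 + c2 - n) : ℂ))
  · ring
  · rw [hE, i1, i2, neg_one_sq_pow, neg_one_sq_pow]
    ring

/-- In Φ_K the first index is bounded by n and the second by L; only the latter is reversed to reach
`factK`. -/
lemma kdfK_triangular (h : QAdm q) (hb1 : b1 ≤ 0) (hb1' : b1' ≤ 0) (hL : d - b2 - 1 = L)
    (hd : d ≤ -m) (hdb : d ≤ b1) (hW : 0 ≤ b1 + b1' - b2 - 1 + n) (hV : 0 ≤ b2 - b1' - d + 1)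
    (hf : qPoch q f n ≠ 0) (hc2 : qPoch q c2 n ≠ 0) :
    kdfK q b1 b1' b2 c2 d f m n * (qFact q (-b1 - b1') * qFact q (-d) * qPoch q f n)
      = (-1) ^ (m + b1') * (qFact q m * qFact q n * qFact q (-b1) * qFact q (-b1')
        * qRF q m) * q ^ (m * b2 + n * b1' - m * b1' : ℂ)
        * qDouble L n (factK q m n (-d - m) (d + m - b2 - 1) (-b1) (-b1') c2 f) := by
  have hLc : (L : ℂ) = d - b2 - 1 := by exact_mod_cast hL.symm
  trans qKdF 1 [-((b1 + b1' - b2 - 1 + n : ℤ) : ℂ)] [] [f - c2, -n] [d - b1 - n, 1 - c2 - n]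
      [-L, m + 1] [b2 + m + 1, ((b2 - b1' - d + 1 : ℤ) : ℂ) + 1]
      (q ^ (f - d + b2 - b1' + 1)) (q ^ (-(n : ℂ) - b1 + 1)) q
    * ((-1) ^ (b1' + b2 + d + m + 1)
      * q ^ (2 * (b2 - b1 - b1' - n + 1) * (b2 - b1' - d + 1) - b2 * (b2 - d - m + 1)
          + n * (c2 - f) + b1' * (2 * b2 - b1' + 1))
      * (qFact q (b1 + n - d) * q ^ (((b2 - b1' - d + 1 : ℤ) : ℂ)
          * ((b1 + n - d : ℤ) - (b2 - b1' - d + 1 : ℤ)))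
        * (qRF q (b2 - b1' - d + 1) * qRF q (b1 + b1' - b2 - 1 + n))) * qPoch q c2 n
      * q ^ (-(b1 * b1' : ℂ)) * (qFact q (-b2 - 1 - m) * qRF q L * qFact q m
        * qFact q (-b1) * qFact q (-b1')))
  · unfold kdfK
    rw [mul_assoc, mul_assoc, mul_assoc, ← mul_assoc (_ * _) (_ * _) _, ← mul_assoc (_ * _ * _) _ _,
      triangular_prefactor h hb1 hb1' hL hd hf, qBinom_eq,
      show b1 + n - d - (b2 - b1' - d + 1) = b1 + b1' - b2 - 1 + n by ring,
      show (b2 : ℂ) - b1 - b1' - n + 1 = -((b1 + b1' - b2 - 1 + n : ℤ) : ℂ) by push_cast; ring,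
      show (b2 : ℂ) - b1' - d + 2 = ((b2 - b1' - d + 1 : ℤ) : ℂ) + 1 by push_cast; ring,
      show (b2 : ℂ) - d + 1 = -L by rw [hLc]; ring]
  rw [qKdF_eq_qDouble h 1 1 n L (fun s t => s * (f - d + b2 - b1' + 1) + t * (-n - b1 + 1) + s * t)
      (by simp) (by simp) (by intro s t; push_cast; ring)
      (by intro s hs; simp [qPoch_neg_nat_eq_zero hs])
      (by intro t ht; simp [qPoch_neg_nat_eq_zero ht]), mul_comm, mul_qDouble, mul_qDouble,
    qDouble_comm, ← qDouble_swap_left]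
  refine qDouble_congr fun s r t w hs ht => ?_
  have hnc : (n : ℂ) = t + w := by exact_mod_cast ht.symm
  have hLc' : (L : ℂ) = s + r := by exact_mod_cast hs.symm
  have f1 := qFact_eq_mul_qPoch_neg h (x := b2 + m + 1) (z := -b2 - 1 - m) (y := -d - m + s)
    (k := r) (by push_cast; ring) (by omega) (by omega)
  have f2 := qFact_eq_mul_qPoch_neg h (x := d - b1 - n) (z := b1 + n - d) (y := b1 + n - d - t)
    (k := t) (by push_cast; ring) (by omega) (by omega)
  have f3 := qPoch_mul_qRF h (x := ((b2 - b1' - d + 1 : ℤ) : ℂ) + 1) (y := b2 - b1' - d + 1)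
    (z := -b1' - s) (k := r) rfl (by omega)
  have f4 := qPoch_add' (q := q) c2 t w
  rw [ht] at f4
  have r4 := qPoch_reflect (q := q) (c2 + w) (1 - c2 - n) t (by rw [hnc]; ring)
  have n1 : qPoch q (b2 + m + 1) r ≠ 0 := by
    intro h0; rw [h0, mul_zero] at f1; exact qFact_ne h (by omega) f1
  have n2 : qPoch q (d - b1 - n) t ≠ 0 := by
    intro h0; rw [h0, mul_zero] at f2; exact qFact_ne h (by omega) f2
  have n3 : qPoch q (((b2 - b1' - d + 1 : ℤ) : ℂ) + 1) r ≠ 0 := by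
    intro h0; rw [h0, zero_mul] at f3; exact qRF_ne h (by omega) f3.symm
  have n4 : qPoch q (1 - c2 - n) t ≠ 0 := by
    rw [r4]
    refine mul_ne_zero (neg_one_pow_ne_zero _) ?_
    rw [f4] at hc2
    exact right_ne_zero_of_mul hc2
  have f5 : qPoch q c2 n = (-1) ^ t * qPoch q c2 w * qPoch q (1 - c2 - n) t := by
    rw [f4, r4]
    linear_combination (-(qPoch q c2 w * qPoch q (c2 + w) t)) * neg_one_sq_pow t
  have g1 := qPoch_neg_eq_fact h (x := -((b1 + b1' - b2 - 1 + n : ℤ) : ℂ))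
    (y := b1 + b1' - b2 - 1 + n) (z := -d + n + b1 + b1' + s - t) (k := t + r) rfl (by omega) hW
  have g2 := qPoch_eq_fact h (x := m + 1) (y := m) (z := d + m - b2 - 1 - s) (k := r)
    (by push_cast; ring) (by omega) (by omega)
  have hE : q ^ (2 * (b2 - b1 - b1' - n + 1) * (b2 - b1' - d + 1) - b2 * (b2 - d - m + 1)
          + n * (c2 - f) + b1' * (2 * b2 - b1' + 1))
      * q ^ (((b2 - b1' - d + 1 : ℤ) : ℂ) * ((b1 + n - d : ℤ) - (b2 - b1' - d + 1 : ℤ)))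
      * q ^ (-(b1 * b1' : ℂ))
      * q ^ (t * (f - d + b2 - b1' + 1) + r * (-n - b1 + 1) + t * r : ℂ)
      = q ^ (m * b2 + n * b1' - m * b1' : ℂ) * q ^ ((-b1' : ℤ) * ((-d - m : ℤ) + 1)
        - s * ((-b1 : ℤ) - n + 1) - n * (f - c2) + t * (f + (-b1' : ℤ) - s) : ℂ) := by
    rw [← h.cpow_add, ← h.cpow_add, ← h.cpow_add, ← h.cpow_add]
    congr 1
    rw [show (r : ℂ) = d - b2 - 1 - s by rw [← hLc, hLc']; ring]
    push_cast
    ring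
  have hsg : (-1 : ℂ) ^ (b1' + b2 + d + m + 1) = (-1) ^ (m + b1') * ((-1) ^ s * (-1) ^ r) := by
    have hn : (-1 : ℂ) ≠ 0 := by norm_num
    rw [show b1' + b2 + d + m + 1 = (m + b1') + (s + r : ℕ) + ((b2 + 1) + (b2 + 1)) by
      push_cast; omega,
      zpow_add₀ hn, zpow_add₀ hn, zpow_natCast, pow_add, zpow_add₀ hn (b2 + 1), neg_one_zpow_sq,
      mul_one]
  simp only [factK]
  rw [show qFact q ((m : ℤ) + n + (-d - m) - -b1 - t) = qFact q (b1 + n - d - t) by congr 1; ring,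
    show qRF q ((m : ℤ) + n + (-d - m) - -b1 - -b1' + s - t) = qRF q (-d + n + b1 + b1' + s - t) by
      congr 1; ring, mul_comm]
  rw [qKdFTerm_mul ((-1) ^ (b1' + b2 + d + m + 1)
      * q ^ (2 * (b2 - b1 - b1' - n + 1) * (b2 - b1' - d + 1) - b2 * (b2 - d - m + 1)
          + n * (c2 - f) + b1' * (2 * b2 - b1' + 1))
      * q ^ (((b2 - b1' - d + 1 : ℤ) : ℂ) * ((b1 + n - d : ℤ) - (b2 - b1' - d + 1 : ℤ)))
      * q ^ (-(b1 * b1' : ℂ)) * ((-1) ^ r * qFact q (-d - m + s))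
      * ((-1) ^ t * qFact q (b1 + n - d - t))
      * qRF q (-b1' - s) * ((-1) ^ t * qPoch q c2 w) * qRF q (b1 + b1' - b2 - 1 + n) * qRF q L
      * qFact q m * qFact q (-b1) * qFact q (-b1')) (by simp) (by simp [n2, n4])
      (by simpa [n1] using n3)
      (by simp only [qPochs_cons, qPochs_nil, mul_one]; rw [f1, f2, ← f3, f5]; ring)]
  simp only [qPochs_cons, qPochs_nil, mul_one]
  rw [g1, g2, qPoch_neg_nat h (s := r) (r := s) (m := L) (by omega),
    qPoch_neg_nat h (s := t) (r := w) (m := n) (by omega), hsg, pow_add]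
  have i1 := qFact_mul_qRF h hW
  have i2 := qFact_mul_qRF h (n := L) (by omega)
  let V := (-1) ^ (m + b1') * (-1) ^ s * (qFact q m * qFact q n * qFact q (-b1) * qFact q (-b1')
        * qRF q m) * (qFact q (-d - m + s) * qFact q (d + m - b2 - 1 - s)
          * qFact q (b1 + n - d - t))
    * (qRF q s * qRF q r * qRF q t * qRF q w)
    * (qRF q (-b1' - s) * qRF q (-d + n + b1 + b1' + s - t))
    * (qPoch q (f - c2) t * qPoch q c2 w)
  trans (qFact q (b1 + b1' - b2 - 1 + n) * qRF q (b1 + b1' - b2 - 1 + n)) * (qFact q L * qRF q L)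
    * (((-1) ^ r * (-1) ^ r) * ((-1) ^ r * (-1) ^ r)
    * ((-1) ^ t * (-1) ^ t) * ((-1) ^ t * (-1) ^ t)) * V
    * (q ^ (2 * (b2 - b1 - b1' - n + 1) * (b2 - b1' - d + 1) - b2 * (b2 - d - m + 1)
          + n * (c2 - f) + b1' * (2 * b2 - b1' + 1))
      * q ^ (((b2 - b1' - d + 1 : ℤ) : ℂ) * ((b1 + n - d : ℤ) - (b2 - b1' - d + 1 : ℤ)))
      * q ^ (-(b1 * b1' : ℂ))
      * q ^ (t * (f - d + b2 - b1' + 1) + r * (-n - b1 + 1) + t * r : ℂ))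
  · ring
  · rw [hE, i1, i2, neg_one_sq_pow, neg_one_sq_pow]
    ring

end Triangular

section Triangular

variable {b1 b1' b2 d : ℤ} {m n L : ℕ} {c2 f : ℂ}

lemma qKdF_zero_left (ε : ℤ) (a c b d b' d' : List ℂ) (x y : ℂ) :
    qKdF ε (0 :: a) c b d b' d' x y q = 1 := by
  unfold qKdF
  rw [tsum_eq_single (0, 0)]
  · simp [qPochs, qPoch, qFact]
  · rintro ⟨s, t⟩ hst
    have h0 : qPochs q (0 :: a) (s + t) = 0 := by
      obtain ⟨k, hk⟩ : ∃ k, s + t = k + 1 := ⟨s + t - 1, by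
        have : s ≠ 0 ∨ t ≠ 0 := by
          by_contra! h1
          exact hst (by rw [h1.1, h1.2])
        omega⟩
      simp only [qPochs, List.map_cons, List.prod_cons]
      have := qPoch_neg_nat_eq_zero (q := q) (m := 0) (s := s + t) (by omega)
      simp only [Nat.cast_zero, neg_zero] at this
      rw [this, zero_mul]
    simp [h0]

/-- The joint numerator parameter is 0, so the series reduces to its first term 1, and the binomial
in the prefactor has equal entries. -/
lemma kdfC_eq_kdfClosed (h : QAdm q) (h0 : b2 - b1 - b1' - n + 1 = 0) (hn : n ≤ -b1') :
    kdfC q b1 b1' b2 c2 d f m n = kdfClosed q b1 b1' b2 c2 d f m n := by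
  have hF := qFact_ne h (n := -b1' - n) (by omega)
  have h0' : (b2 : ℂ) - b1 - b1' - n + 1 = 0 := by exact_mod_cast h0
  have hB : qBinom q (b1 - b2 - 1) (-b1' - n) = 1 := by
    rw [show b1 - b2 - 1 = -b1' - n by omega, qBinom, sub_self, mul_zero, zpow_zero, mul_one,
      show qFact q 0 = 1 by simp [qFact], mul_one, div_self hF]
  rw [kdfC, kdfClosed, h0', qKdF_zero_left, hB]
  ring

theorem kdfA_identities_triangular (h : QAdm q) (hT : Triangular b1 b1' b2 d m n)
    (hc2 : qPoch q c2 n ≠ 0) (hf : qPoch q f n ≠ 0) :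
    (n ≤ -b1' → kdfA q b1 b1' b2 c2 d f m n = kdfC q b1 b1' b2 c2 d f m n) ∧
    (0 ≤ b2 - b1' - d - n + 1 →
      kdfA q b1 b1' b2 c2 d f m n = kdfI q b1 b1' b2 c2 d f m n) ∧
    (0 ≤ b2 - b1' - d + 1 →
      kdfA q b1 b1' b2 c2 d f m n = kdfK q b1 b1' b2 c2 d f m n) ∧
    (b2 - b1 - b1' - n + 1 = 0 →
      kdfA q b1 b1' b2 c2 d f m n = kdfClosed q b1 b1' b2 c2 d f m n ∧
      kdfA q b1' b1 c2 b2 f d n m = kdfClosed q b1 b1' b2 c2 d f m n) := by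
  obtain ⟨hb1, hb1', hbd, hd, hdb, hmn, hN, hW⟩ := hT
  obtain ⟨L, hL⟩ := Int.eq_ofNat_of_zero_le (a := d - b2 - 1) (by omega)
  have hA := kdfA_triangular (c2 := c2) h hb1 hb1' hL hd hmn hf
  have hc : 0 ≤ -d - (m : ℤ) := by omega
  have he : d + m - b2 - 1 = (m : ℤ) + L := by omega
  -- These are the inequalities N ≤ e and M ≤ a + c that the chain requires; they are the conditions
  -- m + d - b2 - 1 + b1' ≥ 0 and d ≤ b1.
  have hN' : -b1' ≤ d + m - b2 - 1 := by omega
  have hM : -b1 ≤ (m : ℤ) + (-d - m) := by omega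
  have hsg : (-1 : ℂ) ^ (-b1') = (-1) ^ b1' := by
    rw [zpow_neg, ← inv_zpow]; norm_num
  have hsm : (-1 : ℂ) ^ ((m : ℤ) + b1') = (-1) ^ m * (-1) ^ b1' := by
    rw [zpow_add₀ (by norm_num), zpow_natCast]
  have i1 := qFact_mul_qRF h (n := L) (by omega)
  have i2 := qFact_mul_qRF h (n := -b1 - b1' - m - n) (by omega)
  have hκ : qFact q (-b1 - b1') * qFact q (-d) * qPoch q f n ≠ 0 :=
    mul_ne_zero (mul_ne_zero (qFact_ne h (by omega)) (qFact_ne h (by omega))) hf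
  have hR : qRF q (-b1 + -b1' - m - n) = qRF q (-b1 - b1' - m - n) := by congr 1
  have hC : n ≤ -b1' → kdfA q b1 b1' b2 c2 d f m n = kdfC q b1 b1' b2 c2 d f m n := by
    intro hn
    refine mul_right_cancel₀ hκ ?_
    rw [hA, kdfC_triangular h hb1 hb1' hL hd hdb hW hn hf hc2,
      factA_eq_factD h hc he hN' hM, hR, hsg, hsm,
      show -d - (m : ℤ) + (d + m - b2 - 1) + 1 = -b2 by ring]
    linear_combination ((-1) ^ m * (-1) ^ b1' * (qFact q m * qFact q n * qFact q (-b1)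
      * qFact q (-b1') * qFact q (-b2)) * q ^ (m * b2 + n * b1' - m * b1' : ℂ)
        * qDouble L n (factD q m n (-d - m) (d + m - b2 - 1) (-b1) (-b1') c2 f))
        * (i1 * (qFact q (-b1 - b1' - m - n) * qRF q (-b1 - b1' - m - n)) + i2)
  refine ⟨hC, fun hV => mul_right_cancel₀ hκ ?_, fun hV => mul_right_cancel₀ hκ ?_, fun h0 => ?_⟩
  · rw [hA, kdfI_triangular h hb1 hb1' hL hd hW hV hf hc2,
      factA_eq_factB h hc he hN' hM, hR, hsg, hsm,
      show (m : ℤ) + (-d - m) - -b1 = b1 - d by ring]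
    linear_combination ((-1) ^ m * (-1) ^ b1' * (qFact q m * qFact q n * qFact q (-b1)
      * qFact q (-b1') * (qRF q m * qFact q (b1 - d))) * q ^ (m * b2 + n * b1' - m * b1' : ℂ)
        * qDouble L n (factB q m n (-d - m) (d + m - b2 - 1) (-b1) (-b1') c2 f))
        * (i1 * (qFact q (-b1 - b1' - m - n) * qRF q (-b1 - b1' - m - n)) + i2)
  · rw [hA, kdfK_triangular h hb1 hb1' hL hd hdb hW hV hf hc2,
      factA_eq_factK h hc he hN' hM, hR, hsg, hsm]
    linear_combination ((-1) ^ m * (-1) ^ b1' * (qFact q m * qFact q n * qFact q (-b1)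
      * qFact q (-b1') * qRF q m) * q ^ (m * b2 + n * b1' - m * b1' : ℂ)
        * qDouble L n (factK q m n (-d - m) (d + m - b2 - 1) (-b1) (-b1') c2 f))
        * (i1 * (qFact q (-b1 - b1' - m - n) * qRF q (-b1 - b1' - m - n)) + i2)
  -- From b2 = b1 + b1' + n - 1 and b2 + 1 ≤ d ≤ b1.
  · have hn : n ≤ -b1' := by omega
    have e1 := (hC hn).trans (kdfC_eq_kdfClosed h h0 hn)
    have n0 : qPoch q (b1 + b1') (m + n) ≠ 0 := by
      rw [qPoch_neg_eq_fact h (x := b1 + b1') (y := -b1 - b1') (z := -b1 - b1' - m - n)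
        (k := m + n) (by push_cast; ring) (by push_cast; ring) (by omega)]
      exact mul_ne_zero (mul_ne_zero (neg_one_pow_ne_zero _) (qFact_ne h (by omega)))
        (qRF_ne h (by omega))
    have n1 : qPoch q d m ≠ 0 := by
      rw [qPoch_neg_eq_fact h (x := d) (y := -d) (z := -d - m) (k := m)
        (by push_cast; ring) (by ring) (by omega)]
      exact mul_ne_zero (mul_ne_zero (neg_one_pow_ne_zero _) (qFact_ne h (by omega)))
        (qRF_ne h (by omega))
    exact ⟨e1, (kdfA_comm h n0 n1 hf).symm.trans e1⟩

end Triangular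

end

theorem mainTheorem10 (q : ℂ) (hq0 : q ≠ 0) (hq : ∀ k : ℕ, 0 < k → q ^ k = 1 → q = 1) :
    -- the seven double q-factorial sums
    (∀ a b c d e f m n : ℤ, 0 ≤ a → 0 ≤ b → 0 ≤ c → 0 ≤ d → 0 ≤ m → 0 ≤ n →
      0 ≤ e - a → 0 ≤ f - b →
      dsumA q a b c d e f m n = dsumC q a b c d e f m n ∧
      dsumA q a b c d e f m n = dsumF q a b c d e f m n ∧
      (m ≤ a + c → n ≤ e →
        dsumA q a b c d e f m n = dsumB q a b c d e f m n ∧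
        dsumA q a b c d e f m n = dsumD q a b c d e f m n) ∧
      (m ≤ b + d → n ≤ f →
        dsumA q a b c d e f m n = dsumE q a b c d e f m n ∧
        dsumA q a b c d e f m n = dsumG q a b c d e f m n) ∧
      -- summable cases
      (n = 0 → dsumA q a b c d e f m n =
        qFact q c * qFact q d * qFact q e * qFact q f
          / (qFact q a * qFact q b * qFact q (m - a - b))) ∧
      (m = 0 → dsumA q a b c d e f m n =
        (-1) ^ (a + b) * q ^ (a * (b + c + e - n + 1) - b * (a + d + f - n + 1))
          * (qFact q (a + c) * qFact q (e - a) * qFact q (b + d) * qFact q (f - b))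
          / (qFact q a * qFact q b * qFact q (n - a - b))) ∧
      (m ≤ a + c → n ≤ e → b + c + e = m + n → dsumA q a b c d e f m n =
        (-1) ^ (a + e + n)
          * q ^ (n * (c + 1) - b * (b + d - m) - (b + e - a) * (c + e - n + 1))
          * (qFact q d * qFact q (d + f + 1) * qFact q (c + e - a) * qFact q (c + e - m)
              * qFact q (f - b))
          / (qFact q (m + n - a - b) * qFact q b * qFact q (n - b)
              * qFact q (d + f - b + 1))) ∧
      (m ≤ b + d → n ≤ f → a + d + f = m + n → dsumA q a b c d e f m n =
        (-1) ^ (b + n - f)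
          * q ^ (a * (c + 1) - n * (a + d - m) - (b + n - f) * (m - a + 1))
          * (qFact q (e - a) * qFact q (c + e + 1) * qFact q (f - b) * qFact q c
              * qFact q b * qFact q (d + f - b) * qFact q (a + b + d - m))
          / (qFact q b * qFact q (m + n - a - b) * qFact q a * qFact q (c + e - a + 1)
              * qFact q (b + n - f) * qFact q (f - b)))) ∧
    -- q-Kampé de Fériet functions, `m`, `n` nonnegative integers, six complex parameters
    (∀ (b1 b1' b2 b2' d d' : ℂ) (m n : ℕ),
      qPoch q (b1 + b1') (m + n) ≠ 0 → qPoch q d m ≠ 0 → qPoch q d' n ≠ 0 →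
      (qPoch q b1 m ≠ 0 → qPoch q b2 m ≠ 0 → qPoch q b1' n ≠ 0 → qPoch q b2' n ≠ 0 →
        kdfA q b1 b1' b2 b2' d d' m n = kdfB q b1 b1' b2 b2' d d' m n) ∧
      (qPoch q b1' m ≠ 0 → qPoch q (d' - b2') n ≠ 0 →
        kdfA q b1 b1' b2 b2' d d' m n = kdfF q b1 b1' b2 b2' d d' m n) ∧
      (qPoch q (d - b2) m ≠ 0 → qPoch q (d' - b2') n ≠ 0 →
        kdfA q b1 b1' b2 b2' d d' m n = kdfJ q b1 b1' b2 b2' d d' m n) ∧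
      kdfA q b1 b1' b2 b2' d d' m n = kdfA q b1' b1 b2' b2 d' d n m ∧
      -- summable cases
      (b1 = 0 → kdfA q b1 b1' b2 b2' d d' m n =
        q ^ (n * b2') * (qPoch q (d' - b2') n / qPoch q d' n)) ∧
      (b1' = 0 → kdfA q b1 b1' b2 b2' d d' m n =
        q ^ (m * b2) * (qPoch q (d - b2) m / qPoch q d m))) ∧
    -- `b1'` an integer
    (∀ (b1 : ℂ) (b1' : ℤ) (b2 b2' d d' : ℂ) (m n : ℕ),
      qPoch q (b1 + b1') (m + n) ≠ 0 → qPoch q d m ≠ 0 → qPoch q d' n ≠ 0 →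
      qPoch q b1 (m + n) ≠ 0 → qPoch q (d - b2) m ≠ 0 →
      (∀ k : ℕ, b1' = -k → qPoch q (1 - b1) k ≠ 0) →
      (∀ k : ℕ, b1' = k → qPoch q (1 - b1 - m - n - k) k ≠ 0) →
      kdfA q b1 b1' b2 b2' d d' m n = kdfG q b1 b1' b2 b2' d d' m n ∧
      (qPoch q b2' n ≠ 0 →
        kdfA q b1 b1' b2 b2' d d' m n = kdfE q b1 b1' b2 b2' d d' m n)) ∧
    -- `b1' = -k` a nonpositive integer
    (∀ (b1 : ℂ) (k : ℕ) (b2 b2' d d' : ℂ) (m n : ℕ),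
      qPoch q (b1 - k) (m + n) ≠ 0 → qPoch q d m ≠ 0 → qPoch q d' n ≠ 0 →
      qPoch q (1 - b1) k ≠ 0 →
      (qPoch q d' k ≠ 0 → qPoch q (d' - b2' + b1 - k + n) (m + k) ≠ 0 →
        kdfA q b1 (-k) b2 b2' d d' m n = kdfD q b1 (-k) b2 b2' d d' m n) ∧
      (qPoch q (d - b1) k ≠ 0 → qPoch q (b2 - d - m + 1) k ≠ 0 →
        kdfA q b1 (-k) b2 b2' d d' m n = kdfH q b1 (-k) b2 b2' d d' m n)) ∧
    -- `b1' = -k` a nonpositive integer, `n` complex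
    (∀ (b1 : ℂ) (k : ℕ) (b2 b2' d d' : ℂ) (m : ℕ) (n : ℂ),
      qPoch q (b1 - k) (m + k) ≠ 0 → qPoch q d m ≠ 0 → qPoch q d' k ≠ 0 →
      qPoch q (1 - b1) k ≠ 0 →
      (qPoch q (d' - b2' + b1 - k + n) (m + k) ≠ 0 →
        kdfA q b1 (-k) b2 b2' d d' m n = kdfD q b1 (-k) b2 b2' d d' m n) ∧
      (qPoch q (d - b2) m ≠ 0 → qPoch q (1 - b1 - m - n) k ≠ 0 →
        kdfA q b1 (-k) b2 b2' d d' m n = kdfG q b1 (-k) b2 b2' d d' m n) ∧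
      (qPoch q (d - b1) k ≠ 0 → qPoch q (b2 - d - m + 1) k ≠ 0 →
        kdfA q b1 (-k) b2 b2' d d' m n = kdfH q b1 (-k) b2 b2' d d' m n)) ∧
    -- `b1`, `b1'`, `b2`, `d` integers subject to the triangular conditions
    (∀ (b1 b1' b2 : ℤ) (b2' : ℂ) (d : ℤ) (d' : ℂ) (m n : ℕ),
      Triangular b1 b1' b2 d m n → qPoch q b2' n ≠ 0 → qPoch q d' n ≠ 0 →
      (n ≤ -b1' →
        kdfA q b1 b1' b2 b2' d d' m n = kdfC q b1 b1' b2 b2' d d' m n) ∧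
      (0 ≤ b2 - b1' - d - n + 1 →
        kdfA q b1 b1' b2 b2' d d' m n = kdfI q b1 b1' b2 b2' d d' m n) ∧
      (0 ≤ b2 - b1' - d + 1 →
        kdfA q b1 b1' b2 b2' d d' m n = kdfK q b1 b1' b2 b2' d d' m n) ∧
      -- summable cases
      (b2 - b1 - b1' - n + 1 = 0 →
        kdfA q b1 b1' b2 b2' d d' m n = kdfClosed q b1 b1' b2 b2' d d' m n ∧
        kdfA q b1' b1 b2' b2 d' d n m = kdfClosed q b1 b1' b2 b2' d d' m n)) := by
  have h : QAdm q := ⟨hq0, hq⟩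
  exact ⟨fun _ _ _ _ _ _ _ _ ha hb hc hd hm hn he hf =>
      dsum_identities h ha hb hc hd hm hn he hf,
    fun b1 b1' b2 b2' d d' m n => kdfA_identities h b1 b1' b2 b2' d d' m n,
    fun b1 b1' b2 b2' d d' m n => kdfA_identities_int h b1 b1' b2 b2' d d' m n,
    fun b1 k b2 b2' d d' m n h0 hd _ => kdfA_identities_neg h b1 k b2 b2' d d' m n h0 hd,
    fun b1 k b2 b2' d d' m n => kdfA_identities_neg_complex h b1 k b2 b2' d d' m n,
    fun _ _ _ _ _ _ _ _ hT hc2 hf => kdfA_identities_triangular h hT hc2 hf⟩
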